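/- Let $\beta>0$ and $I=(-1,1)$. For $N=2n$ even, $n\ge 1$, and $\alpha\in I^{N}$ put $\rho_j=\sqrt{1-\alpha_j^2}$ and $\Xi_j=\begin{pmatrix}\alpha_j&\rho_j\\ \rho_j&-\alpha_j\end{pmatrix}$. Let $\mathcal L=\mathrm{diag}(\Xi_1,\Xi_3,\dots,\Xi_{N-1})$, and let $\mathcal M$ be the $N\times N$ matrix with diagonal blocks $\Xi_2,\Xi_4,\dots,\Xi_{N-2}$ in rows and columns $(2,3),(4,5),\dots,(N-2,N-1)$, with $\mathcal M_{1,1}=-\alpha_N$, $\mathcal M_{N,N}=\alpha_N$, $\mathcal M_{1,N}=\mathcal M_{N,1}=\rho_N$, and zeros elsewhere. Let $\mathcal E=\mathcal L\mathcal M$, a real orthogonal matrix. For $V:I\to\mathbb R$ continuous and bounded, the Schur-flow generalized Gibbs ensemble is the probability measure on $I^{N}$ $$d\mathbb P^{V,\beta}_{S,N}(\alpha)=\frac1{Z^S_N(V,\beta)}\prod_{j=1}^{N}(1-\alpha_j^2)^{\beta-1}\,e^{-\mathrm{Tr}\,V(\mathcal E)}\,d\alpha ,\qquad \mathrm{Tr}\,V(\mathcal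 E)=\sum_{e^{i\theta}} V(\cos\theta),$$ where the sum is over all $N$ eigenvalues $e^{i\theta}$ of $\mathcal E$ counted with multiplicity, and $Z^S_N(V,\beta)$ is the normalizing constant. Almost surely the eigenvalues of $\mathcal E$ are $e^{\pm i\theta_1},\dots,e^{\pm i\theta_n}$ with $\theta_j\in(0,\pi)$, and one sets $$\mu_n(\mathcal E)=\frac1n\sum_{j=1}^n\delta_{x_j}\in\mathcal P(I),\qquad x_j=\cos\theta_j ,$$ where $\mathcal P(I)$ is the space of probability measures on $I$ with the topology of weak convergence. Then under $\mathbb P^{0,\beta}_{S,2n}$ the sequence $(\mu_n(\mathcal E))_{n\ge1}$ satisfies a large deviations principle in $\mathcal P(I)$, at speed $N=2n$, with a good, convex rate function $K_\beta:\mathcal P(I)\to[0,+\infty]$. Moreover, for every bounded continuous $V:I\to\mathbb R$ the ensemble $\mathbb P^{V,\beta}_{S,2n}$ and, almost surely, $\mu_n(\mathcal E)$ are well defined, and under $\mathbb P^{V,\beta}_{S,2n}$ the sequence $(\mu_n(\mathcal E))_{n\ge1}$ satisfies a large deviations principle in $\mathcal P(I)$ at speed $N=2n$ with the good, convex rate function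 $$S_\beta^V(\mu)=h_\beta^V(\mu)-\inf_{\nu\in\mathcal P(I)}h_\beta^V(\nu),\qquad h_\beta^V(\nu)=K_\beta(\nu)+\int_I V\,d\nu .$$ Here a large deviations principle at speed $a_n$ with good rate function $J\ge 0$ means that the sets $\{J\le c\}$ are compact, that $-\inf_O J\le\liminf_n \frac1{a_n}\ln\mathbb P(\mu_n\in O)$ for every open $O$, and that $\limsup_n\frac1{a_n}\ln\mathbb P(\mu_n\in F)\le-\inf_F J$ for every closed $F$. -/

import Mathlib

open MeasureTheory Filter Topology
open scoped ENNReal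

noncomputable section

namespace SchurFlow

/-- The open interval `I = (-1, 1)`. -/
abbrev I : Set ℝ := Set.Ioo (-1 : ℝ) 1

/-- `ρ_j = √(1 - |α_j|²)`. -/
def rho {N : ℕ} (α : Fin N → ℂ) (j : Fin N) : ℂ := ((Real.sqrt (1 - ‖α j‖ ^ 2) : ℝ) : ℂ)

/-- The cyclic block matrix with the `2 × 2` blocks
`Ξ_j = [[conj α_j, ρ_j], [ρ_j, -α_j]]`, placed on the rows and columns `j`, `j + 1` (mod `N`),
for all positions `j = 0, …, N - 1` with `j % 2 = p`.  Here `finRotate N j = j + 1` (mod `N`), and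
positions are numbered from `0`, so that `α 0, …, α (N - 1)` are `α_1, …, α_N`. -/
def blockMatrix {N : ℕ} (p : ℕ) (α : Fin N → ℂ) : Matrix (Fin N) (Fin N) ℂ :=
  Matrix.of fun i j =>
    if i = j then
      (if (i : ℕ) % 2 = p then (starRingEnd ℂ) (α i) else -α ((finRotate N).symm i))
    else if (i : ℕ) % 2 = p ∧ j = finRotate N i then rho α i
    else if (j : ℕ) % 2 = p ∧ i = finRotate N j then rho α j
    else 0

/-- `𝓛 = diag(Ξ_1, Ξ_3, …, Ξ_{N-1})`. -/
def matL {N : ℕ} (α : Fin N → ℂ) : Matrix (Fin N) (Fin N) ℂ := blockMatrix 0 α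

/-- `𝓜`, with blocks `Ξ_2, Ξ_4, …, Ξ_{N-2}` on the rows `(2,3), (4,5), …` (numbered from `1`) and
with the block `Ξ_N` wrapped around the corners: `𝓜_{1,1} = -α_N`, `𝓜_{N,N} = conj α_N`,
`𝓜_{1,N} = 𝓜_{N,1} = ρ_N`. -/
def matM {N : ℕ} (α : Fin N → ℂ) : Matrix (Fin N) (Fin N) ℂ := blockMatrix 1 α

/-- The Lax matrix `𝓔 = 𝓛 𝓜`, a periodic CMV matrix (for even `N`). -/
def lax {N : ℕ} (α : Fin N → ℂ) : Matrix (Fin N) (Fin N) ℂ := matL α * matM α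

/-- The eigenvalues, with multiplicity, of the Lax matrix with real coefficients `α`. -/
def eigs {N : ℕ} (α : Fin N → ℝ) : Multiset ℂ :=
  (lax fun j => (α j : ℂ)).charpoly.roots

/-- `Tr V(𝓔)`, where `V` is read as the function `e^{iθ} ↦ V (cos θ)` on the unit circle: the sum
of `V (cos θ)` over all `N` eigenvalues `e^{iθ}` of `𝓔`. -/
def traceV (V : ℝ → ℝ) {N : ℕ} (α : Fin N → ℝ) : ℝ :=
  ((eigs α).map fun z => V z.re).sum

/-- The unnormalised density `∏_j (1 - α_j²)^{β-1} exp(-Tr V(𝓔))`. -/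
def weight (β : ℝ) (V : ℝ → ℝ) {N : ℕ} (α : Fin N → ℝ) : ℝ≥0∞ :=
  ENNReal.ofReal ((∏ j, (1 - α j ^ 2) ^ (β - 1)) * Real.exp (-traceV V α))

/-- The cube `I^N`. -/
def cube (N : ℕ) : Set (Fin N → ℝ) := {α | ∀ j, α j ∈ I}

/-- The partition function `Z_N^S(V, β)`. -/
def partitionFunction (β : ℝ) (V : ℝ → ℝ) (N : ℕ) : ℝ≥0∞ :=
  ∫⁻ α in cube N, weight β V α

/-- The generalized Gibbs ensemble `ℙ_{S,N}^{V,β}` of the Schur flow. -/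
def gge (β : ℝ) (V : ℝ → ℝ) (N : ℕ) : Measure (Fin N → ℝ) :=
  (partitionFunction β V N)⁻¹ • ((volume.restrict (cube N)).withDensity (weight β V))

/-- The empirical spectral measure `n⁻¹ ∑_{j=1}^n δ_{x_j}` on `I`, with `x_j = cos θ_j`, where
`e^{iθ_1}, …, e^{iθ_n}` are the eigenvalues of the `2n × 2n` matrix `𝓔` with `θ_j ∈ (0, π)`. -/
def empiricalMeasure (n : ℕ) (α : Fin (2 * n) → ℝ) : Measure I :=
  (n : ℝ≥0∞)⁻¹ •
    ((((eigs α).filter fun z => 0 < z.im).map fun z => Measure.dirac z.re).sum).comap Subtype.val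

open Classical in
/-- `μ_n(𝓔)` as an element of `𝓟(I)`.  The default value `δ_0` is used only where the empirical
measure does not have mass `1`, that is, where `n = 0` or where `1` or `-1` is an eigenvalue. -/
def muN (n : ℕ) (α : Fin (2 * n) → ℝ) : ProbabilityMeasure I :=
  if h : IsProbabilityMeasure (empiricalMeasure n α) then ⟨empiricalMeasure n α, h⟩
  else ⟨Measure.dirac ⟨0, by norm_num⟩, inferInstance⟩

/-- The sequence `X n`, with `X n` of law given by `P n`, satisfies a large deviations principle at
speed `a n` with good rate function `J : E → [0, +∞]`. -/
structure SatisfiesLDP {E : Type*} [TopologicalSpace E] {Ω : ℕ → Type*}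
    [∀ n, MeasurableSpace (Ω n)] (P : ∀ n, Measure (Ω n)) (X : ∀ n, Ω n → E) (a : ℕ → ℝ)
    (J : E → EReal) : Prop where
  nonneg : ∀ x, 0 ≤ J x
  good : ∀ c : ℝ, IsCompact {x | J x ≤ (c : EReal)}
  lower : ∀ O : Set E, IsOpen O →
    -(⨅ x ∈ O, J x) ≤ liminf (fun n => ENNReal.log (P n (X n ⁻¹' O)) / (a n : EReal)) atTop
  upper : ∀ F : Set E, IsClosed F →
    limsup (fun n => ENNReal.log (P n (X n ⁻¹' F)) / (a n : EReal)) atTop ≤ -(⨅ x ∈ F, J x)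

/-- Convexity of an extended real function on `𝓟(I)`: its value at the mixture
`ξ = s μ + t ν` (`s, t ≥ 0`, `s + t = 1`) is at most `s J(μ) + t J(ν)`. -/
def IsConvexRate (J : ProbabilityMeasure I → EReal) : Prop :=
  ∀ (s t : NNReal) (μ ν ξ : ProbabilityMeasure I), s + t = 1 →
    (ξ : Measure I) = s • (μ : Measure I) + t • (ν : Measure I) →
    J ξ ≤ ((s : ℝ) : EReal) * J μ + ((t : ℝ) : EReal) * J ν

/-- `h^V(ν) = K(ν) + ∫_I V dν`. -/
def hFun (K : ProbabilityMeasure I → EReal) (V : ℝ → ℝ) (ν : ProbabilityMeasure I) : EReal :=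
  K ν + ((∫ x : I, V x ∂(ν : Measure I) : ℝ) : EReal)

/-- `S^V(μ) = h^V(μ) - inf_{ν ∈ 𝓟(I)} h^V(ν)`. -/
def rateS (K : ProbabilityMeasure I → EReal) (V : ℝ → ℝ) (μ : ProbabilityMeasure I) : EReal :=
  hFun K V μ - ⨅ ν : ProbabilityMeasure I, hFun K V ν

end SchurFlow

end

/-!
The Chebyshev moments of `μ_n(𝓔)` are traces of powers of the Lax matrix:
`2n ∫ T_k dμ_n = Re tr 𝓔^k`, because `𝓔` is unitary with real entries, so that its eigenvalues lie
on the unit circle and come in conjugate pairs (`two_mul_chebMoment_muN`). Everything is deduced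
from two facts, about these traces and about `det (1 ∓ 𝓔)`; no formula for the joint law of the
eigenvalues is needed.

*Almost additivity.* If a sequence of coefficients is cut into two pieces of even length, the
matrices `𝓛` and `𝓜` of the whole agree with the direct sums of those of the pieces outside at most
four rows. As all the matrices are unitary, `tr 𝓔^k` differs from the sum of the traces for the
pieces by `O(k)`, uniformly in the size (`abs_traceMoment_concat_le`). For `V = 0` the coefficients
are independent (`gge_zero_eq`), so the probabilities of boxes of moments are supermultiplicative up
to this error (`freeLaw_momentBox_mul_le`). Since the weak topology of `𝓟(I)` is induced by the
Chebyshev moments (`isInducing_chebMoment`), the local exponential upper and lower rates of `μ_n`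
agree at every point (`exists_open_le_of_lt_freeRate`). Their common value is the rate function
`K_β`, called `freeRate` here, and concatenating blocks in the proportions `s : t` shows that it is
convex (`isAdmissible_mix`, `isConvexRate_freeRate`).

*Exponential tightness.* As `I` is open, mass could escape to `±1`. The matrices `𝓛 ∓ 𝓜` factor
through cyclic bidiagonal matrices, which gives
`|det (1 - s𝓔)| = (∏ √(1 + ε_j α_j) - ∏ ε_j √(1 - ε_j α_j))²` for `s = ±1`, where `ε_j` is `1` or
`s` according to parity (`norm_det_one_sub_smul_lax`). The law of a single coefficient gives a short
interval a small mass, so this determinant is at least `e^{-Kn}` outside an event of arbitrarily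
small exponential order (`exists_freeLaw_detRoot_le`). On the other hand
`|det (1 - 𝓔)| |det (1 + 𝓔)| = ∏_{j ≤ n} 4 (1 - x_j²)` is very small when `μ_n` charges a neighbourhood
of `±1` too much (`norm_det_mul_norm_det_le`). Therefore `μ_n` lies in a compact set of
measures with high probability (`exists_freeLaw_tightSet_le`); the same determinants show that
`μ_n` is almost surely well defined (`ae_mem_goodSet`).

*Tilting.* Local rates and exponential tightness give a large deviations principle
(`satisfiesLDP_of_local`). For general `V` the ensemble has density proportional to
`e^{-2n ∫ V dμ_n}` with respect to the free one (`gge_eq`, `traceV_eq`), and `μ ↦ ∫ V dμ` is bounded,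
continuous and affine; so the local rates change by `∫ V dμ`, and normalising subtracts the infimum
(`satisfiesLDP_gge`, `isConvexRate_rateS`).
-/

namespace SchurFlow

/-! ### Cyclic bidiagonal matrices -/

lemma val_finRotate {N : ℕ} (j : Fin N) :
    (finRotate N j : ℕ) = if (j : ℕ) + 1 = N then 0 else (j : ℕ) + 1 := by
  cases N with
  | zero => exact j.elim0
  | succ n =>
    rw [coe_finRotate]
    simp only [Fin.ext_iff, Fin.val_last, Nat.add_right_cancel_iff]

lemma val_finRotate_symm {N : ℕ} (j : Fin N) :
    ((finRotate N).symm j : ℕ) = if (j : ℕ) = 0 then N - 1 else (j : ℕ) - 1 := by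
  have h := val_finRotate ((finRotate N).symm j)
  rw [Equiv.apply_symm_apply] at h
  have h1 := j.2
  have h2 := ((finRotate N).symm j).2
  split_ifs at h ⊢ <;> omega

lemma finRotate_ne {n : ℕ} (j : Fin (2 * n)) : finRotate (2 * n) j ≠ j := by
  intro h
  have := val_finRotate j
  rw [h] at this
  split_ifs at this <;> omega

lemma val_finRotate_mod_two {n : ℕ} (j : Fin (2 * n)) :
    (finRotate (2 * n) j : ℕ) % 2 = ((j : ℕ) + 1) % 2 := by
  rw [val_finRotate]
  split_ifs <;> omega

lemma val_finRotate_symm_mod_two {n : ℕ} (j : Fin (2 * n)) :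
    ((finRotate (2 * n)).symm j : ℕ) % 2 = ((j : ℕ) + 1) % 2 := by
  rw [val_finRotate_symm]
  have := j.2
  split_ifs <;> omega

/-- The matrix whose column `j` has the entry `a j` in row `j`, the entry `b j` in row `j + 1`
(mod `N`), and zeros elsewhere. -/
noncomputable def cyclicBidiagonal {N : ℕ} (a b : Fin N → ℂ) : Matrix (Fin N) (Fin N) ℂ :=
  Matrix.of fun i j => (if i = j then a j else 0) + (if i = finRotate N j then b j else 0)

lemma cyclicBidiagonal_mul_diagonal_mul_transpose_apply {N : ℕ} (a b d : Fin N → ℂ)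
    (i k : Fin N) :
    (cyclicBidiagonal a b * Matrix.diagonal d * (cyclicBidiagonal a b).transpose) i k =
      (if i = k then d i * a i ^ 2 + d ((finRotate N).symm i) * b ((finRotate N).symm i) ^ 2
        else 0) +
      (if k = finRotate N i then d i * a i * b i else 0) +
      (if i = finRotate N k then d k * a k * b k else 0) := by
  have e : ∀ x y : Fin N, x = finRotate N y ↔ y = (finRotate N).symm x := fun x y =>
    ⟨fun h => by rw [h, Equiv.symm_apply_apply], fun h => by rw [h, Equiv.apply_symm_apply]⟩
  have hsum : ∀ f : Fin N → ℂ, ∑ j, ((if i = j then a j else 0) +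
      (if j = (finRotate N).symm i then b j else 0)) * d j * f j =
      a i * d i * f i + b ((finRotate N).symm i) * d ((finRotate N).symm i) *
        f ((finRotate N).symm i) := fun f => by
    simp [add_mul, Finset.sum_add_distrib]
  rw [Matrix.mul_apply]
  simp only [Matrix.mul_diagonal, Matrix.transpose_apply, cyclicBidiagonal, Matrix.of_apply, e]
  rw [hsum]
  simp only [(finRotate N).symm.injective.eq_iff]
  by_cases h : i = k
  · subst h
    simp only [if_true, eq_comm (a := i) (b := (finRotate N).symm i)]
    split_ifs with h1
    · rw [h1]; ring
    · ring
  · have h' : ¬ k = i := fun hh => h hh.symm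
    simp only [h, h', if_false]
    by_cases h1 : i = (finRotate N).symm k <;> by_cases h2 : k = (finRotate N).symm i
    · simp only [← h1, ← h2, if_true]; ring
    · simp only [← h1, h2, if_true, if_false]; ring
    · simp only [h1, ← h2, if_true, if_false]; ring
    · simp only [h1, h2, if_false]; ring

/-- A permutation moving every point by `0` or `1` is the identity or the full rotation, because
the set of points that move is stable under the rotation. -/
lemma eq_one_or_eq_finRotate {n : ℕ} (σ : Equiv.Perm (Fin (n + 2)))
    (h : ∀ i, σ i = i ∨ σ i = finRotate (n + 2) i) : σ = 1 ∨ σ = finRotate (n + 2) := by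
  have hne : ∀ i : Fin (n + 2), finRotate (n + 2) i ≠ i := fun i hi => by
    have := val_finRotate i
    rw [hi] at this
    split_ifs at this <;> omega
  by_cases h0 : ∃ j, σ j = finRotate (n + 2) j
  · right
    obtain ⟨j, hj⟩ := h0
    -- if `i` moves to `i + 1`, injectivity forbids `i + 1` to stay
    have step : ∀ i, σ i = finRotate (n + 2) i →
        σ (finRotate (n + 2) i) = finRotate (n + 2) (finRotate (n + 2) i) := by
      intro i hi
      rcases h (finRotate (n + 2) i) with h1 | h1
      · exact absurd (σ.injective (h1.trans hi.symm)) (hne i)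
      · exact h1
    have all : ∀ k : ℕ, σ ((finRotate (n + 2) ^ k) j)
        = finRotate (n + 2) ((finRotate (n + 2) ^ k) j) := by
      intro k
      induction k with
      | zero => simpa using hj
      | succ k ih =>
        rw [pow_succ', Equiv.Perm.mul_apply]
        exact step _ ih
    ext1 i
    obtain ⟨k, hk⟩ := isCycle_finRotate.exists_pow_eq (hne j) (hne i)
    rw [← hk]
    exact all k
  · left
    push Not at h0
    ext1 i
    exact (h i).resolve_right (h0 i)

/-- In the Leibniz formula only the identity and the full rotation contribute; on an even number of
points the latter is odd. -/
lemma det_cyclicBidiagonal {n : ℕ} (hn : 1 ≤ n) (a b : Fin (2 * n) → ℂ) :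
    (cyclicBidiagonal a b).det = ∏ j, a j - ∏ j, b j := by
  obtain ⟨m, hm⟩ : ∃ m, 2 * n = m + 2 := ⟨2 * n - 2, by omega⟩
  have hodd : Odd (m + 1) := ⟨n - 1, by omega⟩
  generalize 2 * n = N at *
  subst hm
  have hne : ∀ i : Fin (m + 2), finRotate (m + 2) i ≠ i := fun i hi => by
    have := val_finRotate i
    rw [hi] at this
    split_ifs at this <;> omega
  have h1 : (1 : Equiv.Perm (Fin (m + 2))) ≠ finRotate (m + 2) := fun h =>
    hne 0 (by rw [← h]; rfl)
  rw [Matrix.det_apply', Finset.sum_eq_add_of_mem 1 (finRotate (m + 2)) (Finset.mem_univ _)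
    (Finset.mem_univ _) h1]
  · rw [sign_finRotate]
    simp only [Equiv.Perm.sign_one, cyclicBidiagonal, Matrix.of_apply, Equiv.Perm.one_apply,
      if_true, hne, if_false, zero_add, fun i => (hne i).symm, add_zero]
    simp [hodd.neg_one_pow]
    ring
  · intro σ _ hσ
    have : ∃ i, ¬ (σ i = i ∨ σ i = finRotate (m + 2) i) := by
      by_contra hcon
      push Not at hcon
      rcases eq_one_or_eq_finRotate σ hcon with h | h
      · exact hσ.1 h
      · exact hσ.2 h
    obtain ⟨i, hi⟩ := this
    push Not at hi
    apply mul_eq_zero_of_right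
    apply Finset.prod_eq_zero (Finset.mem_univ i)
    simp [cyclicBidiagonal, hi.1, hi.2, -finRotate_apply]

/-! ### The Lax matrix -/

/-- The block matrix with real coefficients: `𝓛` for `p = 0` and `𝓜` for `p = 1`. -/
noncomputable def blockR {N : ℕ} (p : ℕ) (α : Fin N → ℝ) : Matrix (Fin N) (Fin N) ℂ :=
  blockMatrix p fun j => (α j : ℂ)

lemma blockR_apply {N : ℕ} (p : ℕ) (α : Fin N → ℝ) (i j : Fin N) :
    blockR p α i j = if i = j then
      (if (i : ℕ) % 2 = p then (α i : ℂ) else -(α ((finRotate N).symm i) : ℂ))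
    else if (i : ℕ) % 2 = p ∧ j = finRotate N i then (Real.sqrt (1 - α i ^ 2) : ℂ)
    else if (j : ℕ) % 2 = p ∧ i = finRotate N j then (Real.sqrt (1 - α j ^ 2) : ℂ)
    else 0 := by
  simp [blockR, blockMatrix, rho]

lemma blockR_transpose {n : ℕ} (p : ℕ) (α : Fin (2 * n) → ℝ) :
    (blockR p α).transpose = blockR p α := by
  ext i j
  rw [Matrix.transpose_apply, blockR_apply, blockR_apply]
  by_cases h : i = j
  · subst h; rfl
  · have h' : ¬ j = i := fun hh => h hh.symm
    simp only [h, h', if_false]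
    by_cases h1 : (i : ℕ) % 2 = p ∧ j = finRotate (2 * n) i
    · have : ¬ ((j : ℕ) % 2 = p ∧ i = finRotate (2 * n) j) := by
        rintro ⟨h2, -⟩
        have := val_finRotate_mod_two i
        rw [← h1.2] at this
        omega
      rw [if_neg this, if_pos h1, if_pos h1]
    · simp only [if_neg h1]

lemma blockR_conj {N : ℕ} (p : ℕ) (α : Fin N → ℝ) :
    (blockR p α).map (starRingEnd ℂ) = blockR p α := by
  ext i j
  rw [Matrix.map_apply, blockR_apply]
  split_ifs <;> simp

lemma sqrt_mul_sqrt_of_mem {x : ℝ} (hx : x ∈ I) :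
    (Real.sqrt (1 + x)) * (Real.sqrt (1 - x)) = Real.sqrt (1 - x ^ 2) := by
  rw [← Real.sqrt_mul (by linarith [hx.1])]
  congr 1; ring

/-- Blockwise, `Ξ(x) + 1 = v vᵀ` with `v = (√(1 + x), √(1 - x))`; the diagonal matrix selects the
columns of the parity at hand. -/
lemma blockR_add_one {n : ℕ} {p : ℕ} (hp : p < 2) {α : Fin (2 * n) → ℝ} (hα : α ∈ cube (2 * n)) :
    blockR p α + (1 : Matrix (Fin (2 * n)) (Fin (2 * n)) ℂ) =
      cyclicBidiagonal (fun j => (Real.sqrt (1 + α j) : ℂ))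
        (fun j => (Real.sqrt (1 - α j) : ℂ))
      * Matrix.diagonal (fun j : Fin (2 * n) => if (j : ℕ) % 2 = p then 1 else 0)
      * (cyclicBidiagonal (fun j => (Real.sqrt (1 + α j) : ℂ))
        (fun j => (Real.sqrt (1 - α j) : ℂ))).transpose := by
  have hsq1 : ∀ j, ((Real.sqrt (1 + α j) : ℝ) : ℂ) ^ 2 = 1 + α j := fun j => by
    rw [← Complex.ofReal_pow, Real.sq_sqrt (by linarith [(hα j).1])]; push_cast; ring
  have hsq2 : ∀ j, ((Real.sqrt (1 - α j) : ℝ) : ℂ) ^ 2 = 1 - α j := fun j => by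
    rw [← Complex.ofReal_pow, Real.sq_sqrt (by linarith [(hα j).2])]; push_cast; ring
  have hmul : ∀ j, ((Real.sqrt (1 + α j) : ℝ) : ℂ) * (Real.sqrt (1 - α j) : ℝ)
      = (Real.sqrt (1 - α j ^ 2) : ℝ) := fun j => by
    rw [← Complex.ofReal_mul, sqrt_mul_sqrt_of_mem (hα j)]
  ext i k
  rw [cyclicBidiagonal_mul_diagonal_mul_transpose_apply, Matrix.add_apply, blockR_apply,
    Matrix.one_apply]
  have m1 := val_finRotate_mod_two i
  have m2 := val_finRotate_symm_mod_two i
  have m3 := val_finRotate_mod_two k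
  by_cases h : i = k
  · subst h
    have h1 := (finRotate_ne i).symm
    simp only [if_true, h1, if_false, add_zero, hsq1, hsq2]
    by_cases hi : (i : ℕ) % 2 = p
    · have : ¬ ((finRotate (2 * n)).symm i : ℕ) % 2 = p := by omega
      simp only [hi, this, if_true, if_false]; ring
    · have : ((finRotate (2 * n)).symm i : ℕ) % 2 = p := by omega
      simp only [hi, this, if_true, if_false]; ring
  · simp only [h, if_false, zero_add, add_zero, mul_assoc, hmul]
    by_cases h1 : k = finRotate (2 * n) i
    · by_cases h2 : i = finRotate (2 * n) k
      · -- `N = 2`, where `i + 1 = i - 1`; only one of the two off-diagonal terms survives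
        rw [← h1] at m1
        by_cases hi : (i : ℕ) % 2 = p
        · have : ¬ (k : ℕ) % 2 = p := by omega
          simp only [hi, this, ← h1, ← h2]; simp
        · have : (k : ℕ) % 2 = p := by omega
          simp only [hi, this, ← h1, ← h2]; simp
      · simp only [← h1, h2]; simp
    · by_cases h2 : i = finRotate (2 * n) k
      · simp only [← h2, h1]; simp
      · simp [h1, h2, -finRotate_apply]

/-- `𝓛` and `𝓜` are involutions: the columns of the factor in `blockR_add_one` that belong to
blocks of the same parity are orthogonal, of squared length `2`. -/
lemma blockR_mul_self {n : ℕ} {p : ℕ} (hp : p < 2) {α : Fin (2 * n) → ℝ}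
    (hα : α ∈ cube (2 * n)) :
    blockR p α * blockR p α = (1 : Matrix (Fin (2 * n)) (Fin (2 * n)) ℂ) := by
  have key := blockR_add_one hp hα
  set C := cyclicBidiagonal (fun j => (Real.sqrt (1 + α j) : ℂ))
        (fun j => (Real.sqrt (1 - α j) : ℂ)) with hC
  set D : Matrix (Fin (2 * n)) (Fin (2 * n)) ℂ :=
    Matrix.diagonal (fun j => if (j : ℕ) % 2 = p then 1 else 0) with hD
  have hsq1 : ∀ j, ((Real.sqrt (1 + α j) : ℝ) : ℂ) ^ 2 = 1 + α j := fun j => by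
    rw [← Complex.ofReal_pow, Real.sq_sqrt (by linarith [(hα j).1])]; push_cast; ring
  have hsq2 : ∀ j, ((Real.sqrt (1 - α j) : ℝ) : ℂ) ^ 2 = 1 - α j := fun j => by
    rw [← Complex.ofReal_pow, Real.sq_sqrt (by linarith [(hα j).2])]; push_cast; ring
  have horth : D * C.transpose * C * D = (2 : ℂ) • D := by
    ext i k
    rw [hD, Matrix.mul_diagonal, mul_assoc, Matrix.diagonal_mul, Matrix.mul_apply]
    simp only [Matrix.transpose_apply, hC, cyclicBidiagonal, Matrix.of_apply, add_mul, mul_add,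
      Finset.sum_add_distrib, ite_mul, mul_ite, zero_mul, mul_zero, Finset.sum_ite_eq',
      Finset.mem_univ, if_true, Matrix.smul_apply, Matrix.diagonal_apply, smul_eq_mul]
    have m1 := val_finRotate_mod_two i
    have m3 := val_finRotate_mod_two k
    by_cases h : i = k
    · subst h
      have h1 := (finRotate_ne i).symm
      have h2 := finRotate_ne i
      by_cases hi : (i : ℕ) % 2 = p
      · simp only [hi, h1, h2, if_true, if_false]
        linear_combination hsq1 i + hsq2 i
      · simp [hi]
    · by_cases hi : (i : ℕ) % 2 = p
      · by_cases hk : (k : ℕ) % 2 = p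
        · have e1 : ¬ finRotate (2 * n) k = i := fun hh => by rw [hh] at m3; omega
          have e2 : ¬ k = finRotate (2 * n) i := fun hh => by rw [← hh] at m1; omega
          have e3 : ¬ k = i := fun hh => h hh.symm
          simp [h, e1, e2, e3, -finRotate_apply]
        · simp [h, hk]
      · simp [h, hi]
  -- so `(Ξ + 1)² = 2 (Ξ + 1)`, which is `Ξ² = 1`
  have h2 : (blockR p α + 1) * (blockR p α + 1) = (2 : ℂ) • (blockR p α + 1) := by
    calc (blockR p α + 1) * (blockR p α + 1) = C * (D * C.transpose * C * D) * C.transpose := by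
          rw [key]; simp only [Matrix.mul_assoc]
      _ = (2 : ℂ) • (blockR p α + 1) := by
          rw [horth, key]; simp [Matrix.mul_assoc]
  have h3 : (blockR p α + 1) * (blockR p α + 1)
      = blockR p α * blockR p α + (2 : ℂ) • blockR p α + 1 := by
    rw [two_smul]; noncomm_ring
  rw [h3, smul_add, two_smul _ (1 : Matrix _ _ ℂ)] at h2
  have h4 : blockR p α * blockR p α + 1 = 1 + 1 := by
    have := congrArg (fun X => X - (2 : ℂ) • blockR p α) h2
    simpa [add_sub_right_comm, add_right_comm] using this
  exact add_right_cancel h4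

/-- The sign `ε_j`: it is `s` for the blocks of `𝓜` and `1` for those of `𝓛`. -/
def blockSign (s : ℝ) {N : ℕ} (j : Fin N) : ℝ := if (j : ℕ) % 2 = 0 then 1 else s

lemma blockSign_eq {s : ℝ} (hs : s = 1 ∨ s = -1) {N : ℕ} (j : Fin N) :
    blockSign s j = 1 ∨ blockSign s j = -1 := by
  unfold blockSign
  split_ifs
  · exact Or.inl rfl
  · exact hs

lemma blockSign_mul_mem {s : ℝ} (hs : s = 1 ∨ s = -1) {N : ℕ} (j : Fin N) {x : ℝ} (hx : x ∈ I) :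
    blockSign s j * x ∈ I := by
  rcases blockSign_eq hs j with h | h <;> rw [h] <;> constructor <;> linarith [hx.1, hx.2]

/-- Writing `𝓛 - s 𝓜 = (𝓛 + 1) - (s 𝓜 + 1)`, where each block of either term has rank one, gives a
factorisation through a single cyclic bidiagonal matrix. -/
lemma blockR_sub_smul {n : ℕ} {s : ℝ} (hs : s = 1 ∨ s = -1) {α : Fin (2 * n) → ℝ}
    (hα : α ∈ cube (2 * n)) :
    blockR 0 α - (s : ℂ) • blockR 1 α =
      cyclicBidiagonal (fun j => (Real.sqrt (1 + blockSign s j * α j) : ℂ))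
        (fun j => ((blockSign s j * Real.sqrt (1 - blockSign s j * α j) : ℝ) : ℂ))
      * Matrix.diagonal (fun j : Fin (2 * n) => if (j : ℕ) % 2 = 0 then 1 else -1)
      * (cyclicBidiagonal (fun j => (Real.sqrt (1 + blockSign s j * α j) : ℂ))
        (fun j => ((blockSign s j * Real.sqrt (1 - blockSign s j * α j) : ℝ) : ℂ))).transpose := by
  have hε : ∀ j : Fin (2 * n), blockSign s j ^ 2 = 1 := fun j => by
    rcases blockSign_eq hs j with h | h <;> rw [h] <;> norm_num
  have hsq1 : ∀ j, ((Real.sqrt (1 + blockSign s j * α j) : ℝ) : ℂ) ^ 2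
      = 1 + blockSign s j * α j := fun j => by
    rw [← Complex.ofReal_pow, Real.sq_sqrt (by linarith [(blockSign_mul_mem hs j (hα j)).1])]
    push_cast; ring
  have hsq2 : ∀ j, ((blockSign s j * Real.sqrt (1 - blockSign s j * α j) : ℝ) : ℂ) ^ 2
      = 1 - blockSign s j * α j := fun j => by
    rw [← Complex.ofReal_pow, mul_pow, hε,
      Real.sq_sqrt (by linarith [(blockSign_mul_mem hs j (hα j)).2])]
    push_cast; ring
  have hmul : ∀ j, ((Real.sqrt (1 + blockSign s j * α j) : ℝ) : ℂ)
      * ((blockSign s j * Real.sqrt (1 - blockSign s j * α j) : ℝ) : ℂ)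
      = (blockSign s j * Real.sqrt (1 - α j ^ 2) : ℝ) := fun j => by
    rw [← Complex.ofReal_mul, mul_left_comm, sqrt_mul_sqrt_of_mem (blockSign_mul_mem hs j (hα j)),
      mul_pow, hε, one_mul]
  ext i k
  rw [cyclicBidiagonal_mul_diagonal_mul_transpose_apply, Matrix.sub_apply, Matrix.smul_apply,
    blockR_apply, blockR_apply]
  have m1 := val_finRotate_mod_two i
  have m2 := val_finRotate_symm_mod_two i
  have m3 := val_finRotate_mod_two k
  simp only [mul_assoc, hmul, hsq1, hsq2]
  by_cases h : i = k
  · subst h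
    have h1 := (finRotate_ne i).symm
    simp only [if_true, h1, if_false, add_zero, blockSign, smul_eq_mul]
    by_cases hi : (i : ℕ) % 2 = 0
    · have h2 : ¬ ((finRotate (2 * n)).symm i : ℕ) % 2 = 0 := by omega
      have h3 : ¬ (i : ℕ) % 2 = 1 := by omega
      simp only [hi, h2, if_true, if_false, zero_ne_one]
      push_cast; ring
    · have h2 : ((finRotate (2 * n)).symm i : ℕ) % 2 = 0 := by omega
      have h3 : (i : ℕ) % 2 = 1 := by omega
      simp only [h2, h3, if_true, if_false, one_ne_zero]
      push_cast; ring
  · simp only [h, if_false, zero_add, blockSign, smul_eq_mul]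
    have h0 : ∀ j : Fin (2 * n), (j : ℕ) % 2 = 1 ↔ ¬ (j : ℕ) % 2 = 0 := fun j => by omega
    simp only [h0]
    by_cases h1 : k = finRotate (2 * n) i
    · rw [← h1] at m1
      by_cases h2 : i = finRotate (2 * n) k
      · by_cases hi : (i : ℕ) % 2 = 0
        · have : ¬ (k : ℕ) % 2 = 0 := by omega
          simp only [hi, this, ← h1, ← h2]; simp; ring
        · have : (k : ℕ) % 2 = 0 := by omega
          simp only [hi, this, ← h1, ← h2]; simp; ring
      · by_cases hi : (i : ℕ) % 2 = 0
        · simp only [hi, ← h1, h2]; simp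
        · simp only [hi, ← h1, h2]; simp
    · by_cases h2 : i = finRotate (2 * n) k
      · by_cases hk : (k : ℕ) % 2 = 0
        · simp only [hk, ← h2, h1]; simp
        · simp only [hk, ← h2, h1]; simp
      · simp [h1, h2, -finRotate_apply]

/-- `det (1 - s 𝓔)` is, up to sign, a square whose root is an explicit difference of products:
as `𝓛² = 1`, it is `± det (𝓛 - s 𝓜)`. -/
lemma norm_det_one_sub_smul_lax {n : ℕ} (hn : 1 ≤ n) {s : ℝ} (hs : s = 1 ∨ s = -1)
    {α : Fin (2 * n) → ℝ} (hα : α ∈ cube (2 * n)) :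
    ‖(1 - (s : ℂ) • lax fun j => (α j : ℂ)).det‖ =
      (∏ j, Real.sqrt (1 + blockSign s j * α j)
        - ∏ j, (blockSign s j * Real.sqrt (1 - blockSign s j * α j))) ^ 2 := by
  have hL := blockR_mul_self (p := 0) (by norm_num) hα
  have h1 : 1 - (s : ℂ) • (lax fun j => (α j : ℂ)) =
      blockR 0 α * (blockR 0 α - (s : ℂ) • blockR 1 α) := by
    rw [Matrix.mul_sub, hL, Matrix.mul_smul]; rfl
  have hdet : ‖(blockR 0 α).det‖ = 1 := by
    have h2 : (blockR 0 α).det * (blockR 0 α).det = 1 := by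
      rw [← Matrix.det_mul, hL, Matrix.det_one]
    have h3 : ‖(blockR 0 α).det‖ * ‖(blockR 0 α).det‖ = 1 := by
      rw [← norm_mul, h2, norm_one]
    nlinarith [norm_nonneg (blockR 0 α).det]
  have hD : ‖(Matrix.diagonal (fun j : Fin (2 * n) =>
      if (j : ℕ) % 2 = 0 then (1 : ℂ) else -1)).det‖ = 1 := by
    rw [Matrix.det_diagonal, norm_prod]
    apply Finset.prod_eq_one
    intro j _
    split_ifs <;> simp
  rw [h1, Matrix.det_mul, norm_mul, hdet, blockR_sub_smul hs hα, Matrix.det_mul, Matrix.det_mul,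
    Matrix.det_transpose, det_cyclicBidiagonal hn, norm_mul, norm_mul, hD, one_mul, mul_one,
    ← Complex.ofReal_prod, ← Complex.ofReal_prod, ← Complex.ofReal_sub, Complex.norm_real,
    Real.norm_eq_abs, abs_mul_abs_self, sq]

/-! ### Almost additivity of the moments under concatenation -/

/-- The Lax matrix with real coefficients. -/
noncomputable def laxR {N : ℕ} (α : Fin N → ℝ) : Matrix (Fin N) (Fin N) ℂ :=
  lax fun j => (α j : ℂ)

lemma laxR_eq {N : ℕ} (α : Fin N → ℝ) : laxR α = blockR 0 α * blockR 1 α := rfl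

lemma blockR_mem_unitaryGroup {n : ℕ} {p : ℕ} (hp : p < 2) {α : Fin (2 * n) → ℝ}
    (hα : α ∈ cube (2 * n)) : blockR p α ∈ Matrix.unitaryGroup (Fin (2 * n)) ℂ := by
  have hstar : star (blockR p α) = blockR p α := by
    rw [Matrix.star_eq_conjTranspose, Matrix.conjTranspose, blockR_transpose]
    exact blockR_conj p α
  rw [Matrix.mem_unitaryGroup_iff, hstar]
  exact blockR_mul_self hp hα

lemma laxR_mem_unitaryGroup {n : ℕ} {α : Fin (2 * n) → ℝ}
    (hα : α ∈ cube (2 * n)) : laxR α ∈ Matrix.unitaryGroup (Fin (2 * n)) ℂ :=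
  mul_mem (blockR_mem_unitaryGroup (by norm_num) hα) (blockR_mem_unitaryGroup (by norm_num) hα)

/-- The index set of a concatenation of two blocks of sites. -/
def concatEquiv (m n : ℕ) : Fin (2 * m) ⊕ Fin (2 * n) ≃ Fin (2 * (m + n)) :=
  finSumFinEquiv.trans (finCongr (by ring))

lemma val_concatEquiv_inl {m n : ℕ} (i : Fin (2 * m)) :
    (concatEquiv m n (Sum.inl i) : ℕ) = i := by
  simp [concatEquiv]

lemma val_concatEquiv_inr {m n : ℕ} (i : Fin (2 * n)) :
    (concatEquiv m n (Sum.inr i) : ℕ) = 2 * m + i := by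
  simp [concatEquiv]

/-- The first and the last index of a block of sites. -/
def IsEnd {N : ℕ} (i : Fin N) : Prop := (i : ℕ) = 0 ∨ (i : ℕ) + 1 = N

/-- The end points of both blocks of a concatenation. -/
def IsEndSum {M N : ℕ} (i : Fin M ⊕ Fin N) : Prop := Sum.elim IsEnd IsEnd i

open Classical in
lemma card_isEnd_le (N : ℕ) : (Finset.univ.filter fun i : Fin N => IsEnd i).card ≤ 2 := by
  rw [← Finset.card_map Fin.valEmbedding]
  refine (Finset.card_le_card (t := {0, N - 1}) fun x hx => ?_).trans Finset.card_le_two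
  simp only [Finset.mem_map, Finset.mem_filter, Finset.mem_univ, true_and] at hx
  obtain ⟨i, hi, rfl⟩ := hx
  simp only [Fin.valEmbedding_apply, Finset.mem_insert, Finset.mem_singleton]
  rcases hi with h | h <;> omega

open Classical in
lemma card_isEndSum_le (M N : ℕ) :
    (Finset.univ.filter fun i : Fin M ⊕ Fin N => IsEndSum i).card ≤ 4 := by
  rw [Finset.card_filter, Fintype.sum_sum_type]
  have h1 := card_isEnd_le M
  have h2 := card_isEnd_le N
  rw [Finset.card_filter] at h1 h2
  exact Nat.add_le_add (by convert h1) (by convert h2)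

/-- The block diagonal matrix made of the block matrices of the two halves of `α`. -/
noncomputable def blockSum {m n : ℕ} (p : ℕ) (α : Fin (2 * (m + n)) → ℝ) :
    Matrix (Fin (2 * m) ⊕ Fin (2 * n)) (Fin (2 * m) ⊕ Fin (2 * n)) ℂ :=
  Matrix.fromBlocks (blockR p fun i => α (concatEquiv m n (Sum.inl i))) 0 0
    (blockR p fun i => α (concatEquiv m n (Sum.inr i)))

lemma blockR_apply_of_not_isEnd {N : ℕ} (p : ℕ) (α : Fin N → ℝ) (i k : Fin N) (hi : ¬ IsEnd i) :
    blockR p α i k = if (i : ℕ) = k then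
      (if (i : ℕ) % 2 = p then (α i : ℂ) else -(α ((finRotate N).symm i) : ℂ))
    else if (i : ℕ) % 2 = p ∧ (k : ℕ) = i + 1 then (Real.sqrt (1 - α i ^ 2) : ℂ)
    else if (k : ℕ) % 2 = p ∧ (k : ℕ) + 1 = i then (Real.sqrt (1 - α k ^ 2) : ℂ)
    else 0 := by
  have h1 : (i : ℕ) ≠ 0 := fun h => hi (Or.inl h)
  have h2 : (i : ℕ) + 1 ≠ N := fun h => hi (Or.inr h)
  have e1 : k = finRotate N i ↔ (k : ℕ) = i + 1 := by
    rw [Fin.ext_iff, val_finRotate, if_neg h2]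
  have e2 : i = finRotate N k ↔ (k : ℕ) + 1 = i := by
    rw [Fin.ext_iff, val_finRotate]
    split_ifs <;> omega
  rw [blockR_apply]
  simp only [Fin.ext_iff (a := i) (b := k), e1, e2]

/-- Concatenation changes the block matrices only in the rows of the end points. -/
lemma blockR_concat_apply {m n : ℕ} (p : ℕ) (α : Fin (2 * (m + n)) → ℝ)
    (x y : Fin (2 * m) ⊕ Fin (2 * n)) (hx : ¬ IsEndSum x) :
    blockR p α (concatEquiv m n x) (concatEquiv m n y) = blockSum p α x y := by
  have hx' : ¬ IsEnd (concatEquiv m n x) := by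
    rcases x with i | i
    · simp only [IsEndSum, Sum.elim_inl, IsEnd, val_concatEquiv_inl] at hx ⊢
      have := i.2
      omega
    · simp only [IsEndSum, Sum.elim_inr, IsEnd, val_concatEquiv_inr] at hx ⊢
      have := i.2
      omega
  rw [blockR_apply_of_not_isEnd _ _ _ _ hx']
  rcases x with i | i <;> rcases y with j | j
  · have hi : ¬ IsEnd i := hx
    rw [blockSum, Matrix.fromBlocks_apply₁₁, blockR_apply_of_not_isEnd _ _ _ _ hi]
    have : (finRotate (2 * (m + n))).symm (concatEquiv m n (Sum.inl i))
        = concatEquiv m n (Sum.inl ((finRotate (2 * m)).symm i)) := by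
      rw [Fin.ext_iff, val_finRotate_symm, val_concatEquiv_inl, val_concatEquiv_inl,
        val_finRotate_symm]
      have : (i : ℕ) ≠ 0 := fun h => hi (Or.inl h)
      simp [this]
    simp only [val_concatEquiv_inl, this]
  · have hi : ¬ IsEnd i := hx
    simp only [IsEnd] at hi
    have := i.2
    rw [blockSum, Matrix.fromBlocks_apply₁₂, Matrix.zero_apply]
    simp only [val_concatEquiv_inl, val_concatEquiv_inr]
    rw [if_neg (by omega), if_neg (by omega), if_neg (by omega)]
  · have hi : ¬ IsEnd i := hx
    simp only [IsEnd] at hi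
    have := i.2
    have := j.2
    rw [blockSum, Matrix.fromBlocks_apply₂₁, Matrix.zero_apply]
    simp only [val_concatEquiv_inl, val_concatEquiv_inr]
    rw [if_neg (by omega), if_neg (by omega), if_neg (by omega)]
  · have hi : ¬ IsEnd i := hx
    rw [blockSum, Matrix.fromBlocks_apply₂₂, blockR_apply_of_not_isEnd _ _ _ _ hi]
    have h0 : (i : ℕ) ≠ 0 := fun h => hi (Or.inl h)
    have : (finRotate (2 * (m + n))).symm (concatEquiv m n (Sum.inr i))
        = concatEquiv m n (Sum.inr ((finRotate (2 * n)).symm i)) := by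
      rw [Fin.ext_iff, val_finRotate_symm, val_concatEquiv_inr, val_concatEquiv_inr,
        val_finRotate_symm]
      rw [if_neg (by omega), if_neg h0]
      omega
    have e1 : ∀ a b : ℕ, 2 * m + a = 2 * m + b ↔ a = b := fun a b => by omega
    have e2 : ∀ a : ℕ, (2 * m + a) % 2 = a % 2 := fun a => by omega
    simp only [val_concatEquiv_inr, this, e1, e2, add_assoc]

/-- Two unitary matrices that agree outside a set of `r` rows have, against any unitary matrix,
traces at distance at most `2 r`. -/
lemma norm_trace_sub_mul_le {ι : Type*} [Fintype ι] [DecidableEq ι] {A B U : Matrix ι ι ℂ}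
    (hA : A ∈ Matrix.unitaryGroup ι ℂ) (hB : B ∈ Matrix.unitaryGroup ι ℂ)
    (hU : U ∈ Matrix.unitaryGroup ι ℂ) (S : Finset ι) (h : ∀ i, i ∉ S → ∀ j, A i j = B i j) :
    ‖((A - B) * U).trace‖ ≤ 2 * S.card := by
  have h0 : ∀ i ∈ Finset.univ, i ∉ S → ((A - B) * U) i i = 0 := by
    intro i _ hi
    rw [Matrix.mul_apply]
    apply Finset.sum_eq_zero
    intro j _
    rw [Matrix.sub_apply, h i hi j, sub_self, zero_mul]
  have h1 : ∀ i ∈ S, ‖((A - B) * U) i i‖ ≤ 2 := by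
    intro i _
    rw [Matrix.sub_mul, Matrix.sub_apply]
    have h2 := entry_norm_bound_of_unitary (mul_mem hA hU) i i
    have h3 := entry_norm_bound_of_unitary (mul_mem hB hU) i i
    calc _ ≤ ‖(A * U) i i‖ + ‖(B * U) i i‖ := norm_sub_le _ _
      _ ≤ 2 := by linarith
  have h2 : ((A - B) * U).trace = ∑ i ∈ S, ((A - B) * U) i i := by
    rw [Matrix.trace]
    exact (Finset.sum_subset (Finset.subset_univ S) h0).symm
  rw [h2]
  calc _ ≤ ∑ i ∈ S, ‖((A - B) * U) i i‖ := norm_sum_le _ _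
    _ ≤ ∑ _i ∈ S, (2 : ℝ) := Finset.sum_le_sum h1
    _ = 2 * S.card := by rw [Finset.sum_const, nsmul_eq_mul, mul_comm]

/-- The telescoping sum `A^k - B^k = ∑ A^i (A - B) B^(k-1-i)`, with a bound uniform in the unitary
factors. -/
lemma norm_trace_pow_sub_pow_le {ι : Type*} [Fintype ι] [DecidableEq ι] {A B : Matrix ι ι ℂ}
    (hA : A ∈ Matrix.unitaryGroup ι ℂ) (hB : B ∈ Matrix.unitaryGroup ι ℂ) {c : ℝ}
    (h : ∀ U ∈ Matrix.unitaryGroup ι ℂ, ‖((A - B) * U).trace‖ ≤ c) (k : ℕ) :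
    ‖(A ^ k - B ^ k).trace‖ ≤ c * k := by
  have key : ∀ k : ℕ, ∀ U ∈ Matrix.unitaryGroup ι ℂ, ‖((A ^ k - B ^ k) * U).trace‖ ≤ c * k := by
    intro k
    induction k with
    | zero => intro U _; simp
    | succ k ih =>
      intro U hU
      have e : (A ^ (k + 1) - B ^ (k + 1)) * U
          = (A ^ k - B ^ k) * (A * U) + B ^ k * ((A - B) * U) := by
        rw [pow_succ, pow_succ]; noncomm_ring
      rw [e, Matrix.trace_add, Matrix.trace_mul_comm (B ^ k), Matrix.mul_assoc]
      refine (norm_add_le _ _).trans ?_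
      have h1 := ih (A * U) (mul_mem hA hU)
      have h2 := h (U * B ^ k) (mul_mem hU (pow_mem hB k))
      push_cast
      linarith
  simpa using key k 1 (one_mem _)

lemma mem_cube_comp {m n : ℕ} {α : Fin n → ℝ} (hα : α ∈ cube n) (f : Fin m → Fin n) :
    (fun i => α (f i)) ∈ cube m := fun i => hα (f i)

lemma submatrix_mem_unitaryGroup {ι κ : Type*} [Fintype ι] [DecidableEq ι] [Fintype κ]
    [DecidableEq κ] {A : Matrix ι ι ℂ} (hA : A ∈ Matrix.unitaryGroup ι ℂ) (e : κ ≃ ι) :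
    A.submatrix e e ∈ Matrix.unitaryGroup κ ℂ := by
  rw [Matrix.mem_unitaryGroup_iff, Matrix.star_eq_conjTranspose] at hA ⊢
  rw [Matrix.conjTranspose_submatrix, Matrix.submatrix_mul_equiv, hA, Matrix.submatrix_one_equiv]

lemma blockSum_mem_unitaryGroup {m n : ℕ} {p : ℕ} (hp : p < 2) {α : Fin (2 * (m + n)) → ℝ}
    (hα : α ∈ cube (2 * (m + n))) :
    blockSum p α ∈ Matrix.unitaryGroup (Fin (2 * m) ⊕ Fin (2 * n)) ℂ := by
  have h1 := blockR_mem_unitaryGroup (n := m) hp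
    (mem_cube_comp hα fun i => concatEquiv m n (Sum.inl i))
  have h2 := blockR_mem_unitaryGroup (n := n) hp
    (mem_cube_comp hα fun i => concatEquiv m n (Sum.inr i))
  rw [Matrix.mem_unitaryGroup_iff, Matrix.star_eq_conjTranspose] at h1 h2 ⊢
  rw [blockSum, Matrix.fromBlocks_conjTranspose, Matrix.fromBlocks_multiply]
  simp [h1, h2, Matrix.fromBlocks_one]

lemma submatrix_pow_equiv {ι κ : Type*} [Fintype ι] [DecidableEq ι] [Fintype κ]
    [DecidableEq κ] (A : Matrix ι ι ℂ) (e : κ ≃ ι) (k : ℕ) :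
    (A.submatrix e e) ^ k = (A ^ k).submatrix e e := by
  induction k with
  | zero => rw [pow_zero, pow_zero, Matrix.submatrix_one_equiv]
  | succ k ih => rw [pow_succ, pow_succ, ih, Matrix.submatrix_mul_equiv]

/-- The real part of `tr 𝓔^k`, that is, the sum of `cos (k θ)` over the eigenvalues `e^{iθ}`. -/
noncomputable def traceMoment {N : ℕ} (k : ℕ) (α : Fin N → ℝ) : ℝ := ((laxR α ^ k).trace).re

/-- Concatenating two blocks of sites changes at most four rows of `𝓛` and of `𝓜`, so that the
moments are additive up to an error that does not depend on the number of sites. -/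
lemma abs_traceMoment_concat_le {m n : ℕ} (k : ℕ) {α : Fin (2 * (m + n)) → ℝ}
    (hα : α ∈ cube (2 * (m + n))) :
    |traceMoment k α - (traceMoment k (fun i => α (concatEquiv m n (Sum.inl i)))
      + traceMoment k (fun i => α (concatEquiv m n (Sum.inr i))))| ≤ 16 * k := by
  classical
  set e := concatEquiv m n with he
  -- four end points, and at most `2` per row by `norm_trace_sub_mul_le`
  set S := Finset.univ.filter fun i : Fin (2 * m) ⊕ Fin (2 * n) => IsEndSum i with hS
  have hScard : (S.card : ℝ) ≤ 4 := by exact_mod_cast card_isEndSum_le (2 * m) (2 * n)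
  have hLM : ∀ p, p < 2 → ∀ U ∈ Matrix.unitaryGroup (Fin (2 * m) ⊕ Fin (2 * n)) ℂ,
      ‖(((blockR p α).submatrix e e - blockSum p α) * U).trace‖ ≤ 8 := by
    intro p hp U hU
    refine (norm_trace_sub_mul_le
      (submatrix_mem_unitaryGroup (blockR_mem_unitaryGroup hp hα) e)
      (blockSum_mem_unitaryGroup hp hα) hU S fun i hi j => ?_).trans (by linarith)
    rw [Matrix.submatrix_apply]
    exact blockR_concat_apply p α i j (by simpa [hS] using hi)
  have hA : (laxR α).submatrix e e = (blockR 0 α).submatrix e e * (blockR 1 α).submatrix e e := by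
    rw [Matrix.submatrix_mul_equiv]; rfl
  have hB : Matrix.fromBlocks (laxR fun i => α (e (Sum.inl i))) 0 0
      (laxR fun i => α (e (Sum.inr i))) = blockSum 0 α * blockSum 1 α := by
    rw [blockSum, blockSum, Matrix.fromBlocks_multiply]
    simp [laxR_eq, he]
  have hmain := norm_trace_pow_sub_pow_le
    (submatrix_mem_unitaryGroup (laxR_mem_unitaryGroup hα) e)
    (mul_mem (blockSum_mem_unitaryGroup (p := 0) (by norm_num) hα)
      (blockSum_mem_unitaryGroup (p := 1) (by norm_num) hα)) (c := 16) (fun U hU => by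
    have e1 : ((laxR α).submatrix e e - blockSum 0 α * blockSum 1 α) * U
        = ((blockR 0 α).submatrix e e - blockSum 0 α) * ((blockR 1 α).submatrix e e * U)
          + blockSum 0 α * (((blockR 1 α).submatrix e e - blockSum 1 α) * U) := by
      rw [hA]; noncomm_ring
    rw [e1, Matrix.trace_add, Matrix.trace_mul_comm (blockSum 0 α), Matrix.mul_assoc]
    refine (norm_add_le _ _).trans ?_
    have h1 := hLM 0 (by norm_num) _ (mul_mem (submatrix_mem_unitaryGroup
      (blockR_mem_unitaryGroup (p := 1) (by norm_num) hα) e) hU)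
    have h2 := hLM 1 (by norm_num) _ (mul_mem hU
      (blockSum_mem_unitaryGroup (p := 0) (by norm_num) hα))
    linarith) k
  have ht : ((laxR α).submatrix e e ^ k - (blockSum 0 α * blockSum 1 α) ^ k).trace
      = (laxR α ^ k).trace - ((laxR (fun i => α (e (Sum.inl i))) ^ k).trace
        + (laxR (fun i => α (e (Sum.inr i))) ^ k).trace) := by
    rw [← hB, Matrix.fromBlocks_diagonal_pow, Matrix.trace_sub, submatrix_pow_equiv]
    congr 1
    · rw [Matrix.trace, Matrix.trace, ← e.sum_comp]; rfl
    · rw [Matrix.trace, Fintype.sum_sum_type]; rfl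
  rw [ht] at hmain
  refine le_trans ?_ hmain
  refine le_trans (le_of_eq ?_) (Complex.abs_re_le_norm _)
  simp [traceMoment]

lemma abs_traceMoment_le {n : ℕ} (k : ℕ) {α : Fin (2 * n) → ℝ} (hα : α ∈ cube (2 * n)) :
    |traceMoment k α| ≤ 2 * n := by
  refine (Complex.abs_re_le_norm _).trans ?_
  rw [Matrix.trace]
  refine (norm_sum_le _ _).trans ?_
  calc _ ≤ ∑ _i : Fin (2 * n), (1 : ℝ) := Finset.sum_le_sum fun i _ =>
        entry_norm_bound_of_unitary (pow_mem (laxR_mem_unitaryGroup hα) k) i i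
    _ = 2 * n := by simp

lemma continuous_traceMoment {N : ℕ} (k : ℕ) :
    Continuous fun α : Fin N → ℝ => traceMoment k α := by
  have h : ∀ p, Continuous fun α : Fin N → ℝ => blockR p α := by
    intro p
    refine continuous_matrix fun i j => ?_
    simp only [blockR_apply]
    split_ifs <;> fun_prop
  have h2 : Continuous fun α : Fin N → ℝ => laxR α := by
    simp only [laxR_eq]
    exact (h 0).matrix_mul (h 1)
  exact Complex.continuous_re.comp (h2.pow k).matrix_trace

/-! ### Eigenvalues and the empirical measure -/

open Polynomial in
lemma det_aeval_prod_X_sub_C {ι : Type*} [Fintype ι] [DecidableEq ι] (A : Matrix ι ι ℂ)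
    (s : Multiset ℂ) :
    (aeval A (s.map fun r => X - C r).prod).det
      = (A.charpoly.roots.map fun z => (s.map fun r => z - r).prod).prod := by
  have hcard : Multiset.card A.charpoly.roots = Fintype.card ι := by
    rw [← Matrix.charpoly_natDegree_eq_dim A]
    exact (IsAlgClosed.splits A.charpoly).natDegree_eq_card_roots.symm
  have h1 : ∀ r : ℂ, (aeval A (X - C r)).det = (A.charpoly.roots.map fun z => z - r).prod := by
    intro r
    have e1 : aeval A (X - C r) = -(Matrix.scalar ι r - A) := by
      simp [Matrix.algebraMap_eq_diagonal, Matrix.scalar_apply]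
    have e2 := (IsAlgClosed.splits A.charpoly).eval_eq_prod_roots_of_monic
      (Matrix.charpoly_monic A) r
    rw [e1, Matrix.det_neg, ← Matrix.eval_charpoly, e2, ← hcard]
    have e3 : (A.charpoly.roots.map fun z => z - r)
        = A.charpoly.roots.map fun z => (-1) * (r - z) := by
      congr 1; ext z; ring
    rw [e3, Multiset.prod_map_mul, Multiset.map_const', Multiset.prod_replicate]
  induction s using Multiset.induction_on with
  | empty => simp
  | cons r s ih =>
    simp only [Multiset.map_cons, Multiset.prod_cons]
    rw [map_mul, Matrix.det_mul, h1, ih, Multiset.prod_map_mul]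

open Polynomial in
/-- The determinant of `q(A)` is the product of the values of `q` at the eigenvalues of `A`. -/
lemma det_aeval_eq_prod {ι : Type*} [Fintype ι] [DecidableEq ι] (A : Matrix ι ι ℂ) (q : ℂ[X]) :
    (aeval A q).det = (A.charpoly.roots.map fun z => q.eval z).prod := by
  have hcard : Multiset.card A.charpoly.roots = Fintype.card ι := by
    rw [← Matrix.charpoly_natDegree_eq_dim A]
    exact (IsAlgClosed.splits A.charpoly).natDegree_eq_card_roots.symm
  have hq := IsAlgClosed.splits q
  have e : (fun z => q.eval z) = fun z => q.leadingCoeff * (q.roots.map fun r => z - r).prod := by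
    ext z; exact hq.eval_eq_prod_roots z
  rw [e, Multiset.prod_map_mul, Multiset.map_const', Multiset.prod_replicate, hcard,
    ← det_aeval_prod_X_sub_C]
  conv_lhs => rw [hq.eq_prod_roots, map_mul, aeval_C]
  rw [Matrix.det_mul, Matrix.algebraMap_eq_diagonal, Matrix.det_diagonal]
  simp

open Polynomial in
/-- The eigenvalues of `A^k`, with multiplicity, are the `k`-th powers of those of `A`. -/
lemma trace_pow_eq_sum_roots {ι : Type*} [Fintype ι] [DecidableEq ι] (A : Matrix ι ι ℂ) (k : ℕ) :
    (A ^ k).trace = (A.charpoly.roots.map fun z => z ^ k).sum := by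
  have h : (A ^ k).charpoly = ((A.charpoly.roots.map fun z => z ^ k).map fun a => X - C a).prod := by
    refine Polynomial.funext fun t => ?_
    have e : Matrix.scalar ι t - A ^ k = aeval A (C t - X ^ k) := by
      simp [Matrix.algebraMap_eq_diagonal, Matrix.scalar_apply]
    rw [Matrix.eval_charpoly, e, det_aeval_eq_prod, eval_multiset_prod, Multiset.map_map,
      Multiset.map_map]
    simp
  rw [Matrix.trace_eq_sum_roots_charpoly, h, roots_multiset_prod_X_sub_C]

lemma eigs_eq {N : ℕ} (α : Fin N → ℝ) : eigs α = (laxR α).charpoly.roots := rfl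

lemma card_eigs {N : ℕ} (α : Fin N → ℝ) : Multiset.card (eigs α) = N := by
  rw [eigs_eq, ← (IsAlgClosed.splits (laxR α).charpoly).natDegree_eq_card_roots,
    Matrix.charpoly_natDegree_eq_dim, Fintype.card_fin]

open scoped Matrix.Norms.L2Operator in
lemma norm_of_mem_eigs {n : ℕ} {α : Fin (2 * n) → ℝ} (hα : α ∈ cube (2 * n)) {z : ℂ}
    (hz : z ∈ eigs α) : ‖z‖ = 1 := by
  rcases Nat.eq_zero_or_pos n with rfl | hn
  · have h0 : eigs α = 0 := Multiset.card_eq_zero.1 (card_eigs α)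
    rw [h0] at hz
    exact absurd hz (Multiset.notMem_zero z)
  · have : Nonempty (Fin (2 * n)) := ⟨⟨0, by omega⟩⟩
    have h1 : z ∈ spectrum ℂ (laxR α) :=
      Matrix.mem_spectrum_of_isRoot_charpoly (Polynomial.isRoot_of_mem_roots hz)
    have h2 := spectrum.subset_circle_of_unitary (laxR_mem_unitaryGroup hα) h1
    simpa using h2

lemma eigs_map_conj {N : ℕ} (α : Fin N → ℝ) : (eigs α).map (starRingEnd ℂ) = eigs α := by
  have hreal : (laxR α).map (starRingEnd ℂ) = laxR α := by
    rw [laxR_eq, Matrix.map_mul, blockR_conj, blockR_conj]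
  rw [eigs_eq, ← (IsAlgClosed.splits (laxR α).charpoly).roots_map, ← Matrix.charpoly_map, hreal]

/-- The configurations for which neither `1` nor `-1` is an eigenvalue. -/
def goodSet (n : ℕ) : Set (Fin (2 * n) → ℝ) :=
  {α | α ∈ cube (2 * n) ∧ ∀ s : ℝ, s = 1 ∨ s = -1 → (1 - (s : ℂ) • laxR α).det ≠ 0}

lemma det_one_sub_smul_laxR {N : ℕ} (α : Fin N → ℝ) (s : ℂ) :
    (1 - s • laxR α).det = ((eigs α).map fun z => 1 - s * z).prod := by
  have e : 1 - s • laxR α = Polynomial.aeval (laxR α) (1 - Polynomial.C s * Polynomial.X) := by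
    simp [Algebra.smul_def]
  rw [e, det_aeval_eq_prod, eigs_eq]
  simp

lemma im_ne_zero_of_mem_eigs {n : ℕ} {α : Fin (2 * n) → ℝ} (hα : α ∈ goodSet n) {z : ℂ}
    (hz : z ∈ eigs α) : z.im ≠ 0 := by
  intro him
  have h1 := norm_of_mem_eigs hα.1 hz
  have h2 : z = (z.re : ℂ) := by
    apply Complex.ext <;> simp [him]
  have hs : z.re = 1 ∨ z.re = -1 := by
    rw [h2, Complex.norm_real, Real.norm_eq_abs] at h1
    exact eq_or_eq_neg_of_abs_eq h1
  apply hα.2 z.re hs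
  rw [det_one_sub_smul_laxR]
  apply Multiset.prod_eq_zero
  rw [Multiset.mem_map]
  refine ⟨z, hz, ?_⟩
  conv_lhs => rw [h2]
  rcases hs with h | h <;> rw [h] <;> norm_num

lemma re_mem_I_of_mem_eigs {n : ℕ} {α : Fin (2 * n) → ℝ} (hα : α ∈ goodSet n) {z : ℂ}
    (hz : z ∈ eigs α) : z.re ∈ I := by
  have h1 := norm_of_mem_eigs hα.1 hz
  have h2 := im_ne_zero_of_mem_eigs hα hz
  have h3 : z.re ^ 2 + z.im ^ 2 = 1 := by
    have := Complex.sq_norm z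
    rw [h1, Complex.normSq_apply] at this
    nlinarith
  have h4 : 0 < z.im ^ 2 := by positivity
  exact abs_lt.1 ((sq_lt_one_iff_abs_lt_one _).1 (by linarith))

/-- By the symmetry under complex conjugation, summing over all eigenvalues a function of the
real part is twice summing over those in the upper half plane. -/
lemma sum_eigs_eq_two_mul {n : ℕ} {α : Fin (2 * n) → ℝ} (hα : α ∈ goodSet n) (f : ℝ → ℝ) :
    ((eigs α).map fun z => f z.re).sum
      = 2 * (((eigs α).filter fun z => 0 < z.im).map fun z => f z.re).sum := by
  have hneg : (eigs α).filter (fun z => ¬ 0 < z.im)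
      = ((eigs α).filter fun z => 0 < z.im).map (starRingEnd ℂ) := by
    conv_lhs => rw [← eigs_map_conj]
    rw [Multiset.filter_map]
    congr 1
    apply Multiset.filter_congr
    intro z hz
    have := im_ne_zero_of_mem_eigs hα hz
    simp only [Function.comp, Complex.conj_im, not_lt, Left.neg_nonpos_iff]
    exact ⟨fun h => lt_of_le_of_ne h this.symm, le_of_lt⟩
  conv_lhs => rw [← Multiset.filter_add_not (fun z : ℂ => 0 < z.im) (eigs α), hneg]
  rw [Multiset.map_add, Multiset.sum_add, Multiset.map_map]
  simp [two_mul]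

lemma card_filter_eigs {n : ℕ} {α : Fin (2 * n) → ℝ} (hα : α ∈ goodSet n) :
    Multiset.card ((eigs α).filter fun z => 0 < z.im) = n := by
  have h := sum_eigs_eq_two_mul hα (fun _ => 1)
  simp only [Multiset.map_const', Multiset.sum_replicate, card_eigs, nsmul_eq_mul, mul_one] at h
  have h2 : 2 * n = 2 * Multiset.card ((eigs α).filter fun z => 0 < z.im) := by exact_mod_cast h
  omega

lemma sum_dirac_apply (s : Multiset ℂ) (S : Set ℝ) [DecidablePred (· ∈ S)] :
    ((s.map fun z => Measure.dirac z.re).sum : Measure ℝ) S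
      = (Multiset.card (s.filter fun z => z.re ∈ S) : ℝ≥0∞) := by
  induction s using Multiset.induction_on with
  | empty => simp
  | cons z s ih =>
    rw [Multiset.map_cons, Multiset.sum_cons, Measure.add_apply, ih, Measure.dirac_apply,
      Multiset.filter_cons]
    by_cases h : z.re ∈ S <;> simp [h, add_comm]

lemma integral_sum_dirac (s : Multiset ℂ) (f : ℝ → ℝ) :
    Integrable f ((s.map fun z => Measure.dirac z.re).sum : Measure ℝ) ∧
    ∫ x, f x ∂((s.map fun z => Measure.dirac z.re).sum : Measure ℝ)
      = (s.map fun z => f z.re).sum := by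
  induction s using Multiset.induction_on with
  | empty => simp
  | cons z s ih =>
    have h1 : Integrable f (Measure.dirac z.re) := integrable_dirac (by simp)
    simp only [Multiset.map_cons, Multiset.sum_cons]
    exact ⟨h1.add_measure ih.1, by rw [integral_add_measure h1 ih.1, ih.2, integral_dirac]⟩

lemma sum_dirac_compl_I {n : ℕ} {α : Fin (2 * n) → ℝ} (hα : α ∈ goodSet n) :
    ((((eigs α).filter fun z => 0 < z.im).map fun z => Measure.dirac z.re).sum : Measure ℝ) Iᶜ
      = 0 := by
  classical
  rw [sum_dirac_apply, Nat.cast_eq_zero, Multiset.card_eq_zero, Multiset.filter_eq_nil]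
  intro z hz
  exact fun h => h (re_mem_I_of_mem_eigs hα (Multiset.mem_of_mem_filter hz))

lemma isProbabilityMeasure_empiricalMeasure {n : ℕ} (hn : 1 ≤ n) {α : Fin (2 * n) → ℝ}
    (hα : α ∈ goodSet n) : IsProbabilityMeasure (empiricalMeasure n α) := by
  classical
  constructor
  have h1 : ((((eigs α).filter fun z => 0 < z.im).map fun z => Measure.dirac z.re).sum :
      Measure ℝ) Set.univ = n := by
    rw [sum_dirac_apply]; simp [card_filter_eigs hα]
  have h2 : ((((eigs α).filter fun z => 0 < z.im).map fun z => Measure.dirac z.re).sum :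
      Measure ℝ) I = n := by
    rw [← h1]
    exact measure_eq_measure_of_null_sdiff (Set.subset_univ _)
      (by rw [← Set.compl_eq_univ_sdiff]; exact sum_dirac_compl_I hα)
  rw [empiricalMeasure, Measure.smul_apply,
    (MeasurableEmbedding.subtype_coe measurableSet_Ioo).comap_apply, Set.image_univ,
    Subtype.range_coe, h2, smul_eq_mul, ENNReal.inv_mul_cancel (by simp; omega) (by simp)]

lemma coe_muN {n : ℕ} (hn : 1 ≤ n) {α : Fin (2 * n) → ℝ} (hα : α ∈ goodSet n) :
    (muN n α : Measure I) = empiricalMeasure n α := by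
  have h : muN n α = ⟨empiricalMeasure n α, isProbabilityMeasure_empiricalMeasure hn hα⟩ :=
    dif_pos (isProbabilityMeasure_empiricalMeasure hn hα)
  rw [h]
  rfl

/-- The integral of any function against `μ_n` is an average over all eigenvalues. -/
lemma two_mul_integral_muN {n : ℕ} (hn : 1 ≤ n) {α : Fin (2 * n) → ℝ} (hα : α ∈ goodSet n)
    (f : ℝ → ℝ) :
    2 * (n : ℝ) * ∫ x : I, f x ∂(muN n α : Measure I) = ((eigs α).map fun z => f z.re).sum := by
  have hn' : (n : ℝ) ≠ 0 := by exact_mod_cast (by omega : n ≠ 0)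
  rw [coe_muN hn hα, empiricalMeasure, integral_smul_measure,
    integral_subtype_comap measurableSet_Ioo (fun x => f x),
    Measure.restrict_eq_self_of_ae_mem (by
      rw [ae_iff]; exact sum_dirac_compl_I hα),
    (integral_sum_dirac _ f).2, sum_eigs_eq_two_mul hα, ENNReal.toReal_inv, ENNReal.toReal_natCast,
    smul_eq_mul]
  field_simp

lemma traceV_eq {n : ℕ} (hn : 1 ≤ n) {α : Fin (2 * n) → ℝ} (hα : α ∈ goodSet n) (V : ℝ → ℝ) :
    traceV V α = 2 * (n : ℝ) * ∫ x : I, V x ∂(muN n α : Measure I) := by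
  rw [two_mul_integral_muN hn hα]; rfl

/-- The Chebyshev moments `∫ T_k dμ`. -/
noncomputable def chebMoment (μ : ProbabilityMeasure I) (k : ℕ) : ℝ :=
  ∫ x : I, (Polynomial.Chebyshev.T ℝ k).eval (x : ℝ) ∂(μ : Measure I)

lemma two_mul_chebMoment_muN {n : ℕ} (hn : 1 ≤ n) {α : Fin (2 * n) → ℝ} (hα : α ∈ goodSet n)
    (k : ℕ) : 2 * (n : ℝ) * chebMoment (muN n α) k = traceMoment k α := by
  rw [chebMoment, two_mul_integral_muN hn hα fun x => (Polynomial.Chebyshev.T ℝ k).eval x,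
    traceMoment, trace_pow_eq_sum_roots, ← eigs_eq]
  have h : ∀ s : Multiset ℂ, s.sum.re = (s.map Complex.re).sum := fun s =>
    map_multiset_sum Complex.reLm s
  rw [h, Multiset.map_map]
  congr 1
  apply Multiset.map_congr rfl
  intro z hz
  have h1 := norm_of_mem_eigs hα.1 hz
  have h2 : z = Complex.exp (z.arg * Complex.I) := by
    conv_lhs => rw [← Complex.norm_mul_exp_arg_mul_I z, h1]
    simp
  have h3 : z.re = Real.cos z.arg := by
    conv_lhs => rw [h2]
    exact Complex.exp_ofReal_mul_I_re _
  rw [h3, Polynomial.Chebyshev.T_real_cos, Function.comp]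
  conv_rhs => rw [h2, ← Complex.exp_nat_mul]
  rw [← mul_assoc, show ((k : ℂ) * (z.arg : ℂ)) = ((k * z.arg : ℝ) : ℂ) by push_cast; ring,
    Complex.exp_ofReal_mul_I_re]
  push_cast
  rfl

/-- If `μ_n` puts mass more than `1 / j` on the points with `1 - x² < e^{-2jM}`, then the product
of `|1 - z²| = 2 √(1 - x²)` over the eigenvalues `z`, with `x = Re z`, is small; this product is
`|det (1 - 𝓔)| |det (1 + 𝓔)|`. -/
lemma norm_det_mul_norm_det_le {n : ℕ} (hn : 1 ≤ n) {α : Fin (2 * n) → ℝ} (hα : α ∈ goodSet n)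
    {M : ℝ} (hM : 0 ≤ M) {j : ℕ} (hj : 1 ≤ j)
    (h : (1 / j : ℝ) < (muN n α : Measure I).real {x | 1 - (x : ℝ) ^ 2 < Real.exp (-2 * j * M)}) :
    ‖(1 - (1 : ℂ) • laxR α).det‖ * ‖(1 - (-1 : ℂ) • laxR α).det‖
      ≤ 2 ^ (2 * n) * Real.exp (-(2 * n * M)) := by
  have hj' : (0 : ℝ) < j := by exact_mod_cast hj
  have hn' : (0 : ℝ) < n := by exact_mod_cast hn
  set S : Set ℝ := {x | 1 - x ^ 2 < Real.exp (-2 * j * M)} with hS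
  set f : ℝ → ℝ := S.indicator fun _ => 1 with hf
  have hSm : MeasurableSet (Subtype.val ⁻¹' S : Set I) := by
    apply measurable_subtype_coe
    exact measurableSet_lt (by fun_prop) (by fun_prop)
  have h1 : 2 * (n : ℝ) * (1 / j) ≤ ((eigs α).map fun z => f z.re).sum := by
    rw [← two_mul_integral_muN hn hα]
    have : ∫ x : I, f x ∂(muN n α : Measure I) = (muN n α : Measure I).real (Subtype.val ⁻¹' S) := by
      rw [← integral_indicator_one hSm]
      rfl
    rw [this]
    have h' := h.le
    gcongr
    exact h'
  rw [det_one_sub_smul_laxR, det_one_sub_smul_laxR, ← norm_mul, ← Multiset.prod_map_mul]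
  have hnorm : ∀ s : Multiset ℂ, ‖s.prod‖ = (s.map fun z => ‖z‖).prod := fun s =>
    map_multiset_prod (normHom : ℂ →*₀ ℝ) s
  rw [hnorm, Multiset.map_map]
  have hle : ∀ z ∈ eigs α, ‖(1 - 1 * z) * (1 - -1 * z)‖ ≤ 2 * Real.exp (-(j * M) * f z.re) := by
    intro z hz
    have hz1 := norm_of_mem_eigs hα.1 hz
    by_cases hzS : z.re ∈ S
    · have e1 : f z.re = 1 := Set.indicator_of_mem hzS _
      rw [e1, mul_one]
      have e2 : z.re ^ 2 + z.im ^ 2 = 1 := by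
        have := Complex.sq_norm z
        rw [hz1, Complex.normSq_apply] at this
        nlinarith
      have e3 : ‖(1 - 1 * z) * (1 - -1 * z)‖ ^ 2 = 4 * (1 - z.re ^ 2) := by
        rw [norm_mul, mul_pow, Complex.sq_norm, Complex.sq_norm, Complex.normSq_apply,
          Complex.normSq_apply]
        simp
        nlinarith
      have e4 : (2 * Real.exp (-(j * M))) ^ 2 = 4 * Real.exp (-2 * j * M) := by
        rw [mul_pow, ← Real.exp_nat_mul]
        norm_num
        ring_nf
      refine le_of_sq_le_sq ?_ (by positivity)
      rw [e3, e4]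
      have : 1 - z.re ^ 2 < Real.exp (-2 * j * M) := hzS
      linarith
    · have e1 : f z.re = 0 := Set.indicator_of_notMem hzS _
      rw [e1, mul_zero, Real.exp_zero, mul_one]
      have e2 : (1 - 1 * z) * (1 - -1 * z) = 1 - z ^ 2 := by ring
      rw [e2]
      refine (norm_sub_le _ _).trans ?_
      rw [norm_pow, hz1]; norm_num
  have hprod : ((eigs α).map fun z => ‖(1 - 1 * z) * (1 - -1 * z)‖).prod
      ≤ ((eigs α).map fun z => 2 * Real.exp (-(j * M) * f z.re)).prod :=
    Multiset.prod_map_le_prod_map₀ _ _ (fun z _ => norm_nonneg _) hle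
  refine hprod.trans ?_
  rw [Multiset.prod_map_mul, Multiset.map_const', Multiset.prod_replicate, card_eigs]
  gcongr
  have e5 : ((eigs α).map fun z => Real.exp (-(j * M) * f z.re)).prod
      = Real.exp (((eigs α).map fun z => -(j * M) * f z.re).sum) := by
    rw [Real.exp_multiset_sum, Multiset.map_map]; rfl
  rw [e5, Multiset.sum_map_mul_left, Real.exp_le_exp]
  have h2 : (j * M) * (2 * (n : ℝ) * (1 / j)) ≤ (j * M) * ((eigs α).map fun z => f z.re).sum := by
    gcongr
  have h3 : (j * M) * (2 * (n : ℝ) * (1 / j)) = 2 * n * M := by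
    field_simp
  linarith

/-! ### The weak topology of `𝓟(I)` through Chebyshev moments -/

/-- The inclusion of `I` into its closure, on which Weierstrass approximation is available. -/
def toIcc : C(I, Set.Icc (-1 : ℝ) 1) :=
  ⟨Set.inclusion Set.Ioo_subset_Icc_self, continuous_inclusion _⟩

lemma coe_toIcc (x : I) : (toIcc x : ℝ) = x := rfl

lemma integrable_comp_toIcc (μ : ProbabilityMeasure I) (g : C(Set.Icc (-1 : ℝ) 1, ℝ)) :
    Integrable (fun x => g (toIcc x)) (μ : Measure I) :=
  ((BoundedContinuousFunction.mkOfCompact g).compContinuous toIcc).integrable _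

lemma integrable_polynomial (μ : ProbabilityMeasure I) (p : Polynomial ℝ) :
    Integrable (fun x : I => p.eval (x : ℝ)) (μ : Measure I) :=
  integrable_comp_toIcc μ (p.toContinuousMapOn _)

open Polynomial in
/-- The span of the `T_k` is stable under multiplication by `X`, by the three-term recurrence. -/
lemma span_chebyshev_eq_top :
    Submodule.span ℝ (Set.range fun k : ℕ => Chebyshev.T ℝ (k : ℤ)) = ⊤ := by
  set W := Submodule.span ℝ (Set.range fun k : ℕ => Chebyshev.T ℝ (k : ℤ)) with hW
  have hT : ∀ k : ℕ, Chebyshev.T ℝ (k : ℤ) ∈ W := fun k => Submodule.subset_span ⟨k, rfl⟩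
  have hX : ∀ p ∈ W, X * p ∈ W := by
    intro p hp
    refine Submodule.span_induction (p := fun p _ => X * p ∈ W) ?_ ?_ ?_ ?_ hp
    · rintro _ ⟨k, rfl⟩
      rcases k with _ | k
      · simpa using hT 1
      · have h := Chebyshev.T_add_two ℝ (k : ℤ)
        have e : X * Chebyshev.T ℝ ((k + 1 : ℕ) : ℤ)
            = (1 / 2 : ℝ) • (Chebyshev.T ℝ ((k + 2 : ℕ) : ℤ) + Chebyshev.T ℝ (k : ℤ)) := by
          push_cast
          rw [h, sub_add_cancel, mul_assoc, ← C_ofNat 2, smul_eq_C_mul,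
            ← mul_assoc, ← C_mul]
          norm_num
        simp only [e]
        exact W.smul_mem _ (W.add_mem (hT _) (hT _))
    · simp
    · intro a b _ _ ha hb
      rw [mul_add]
      exact W.add_mem ha hb
    · intro c a _ ha
      rw [mul_smul_comm]
      exact W.smul_mem _ ha
  rw [eq_top_iff]
  intro p _
  induction p using Polynomial.induction_on with
  | C a =>
    have : C a = a • Chebyshev.T ℝ ((0 : ℕ) : ℤ) := by simp [smul_eq_C_mul]
    rw [this]
    exact W.smul_mem _ (hT 0)
  | add p q hp hq => exact W.add_mem (hp trivial) (hq trivial)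
  | monomial n a h =>
    have : C a * X ^ (n + 1) = X * (C a * X ^ n) := by ring
    rw [this]
    exact hX _ (h trivial)

/-- Convergence of the Chebyshev moments implies convergence of the integrals of all continuous
functions on `[-1, 1]`. -/
lemma tendsto_integral_toIcc {F : Filter (ProbabilityMeasure I)} {μ : ProbabilityMeasure I}
    (h : ∀ k, Tendsto (fun ν => chebMoment ν k) F (𝓝 (chebMoment μ k)))
    (g : C(Set.Icc (-1 : ℝ) 1, ℝ)) :
    Tendsto (fun ν : ProbabilityMeasure I => ∫ x, g (toIcc x) ∂(ν : Measure I)) F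
      (𝓝 (∫ x, g (toIcc x) ∂(μ : Measure I))) := by
  have hpoly : ∀ p : Polynomial ℝ,
      Tendsto (fun ν : ProbabilityMeasure I => ∫ x : I, p.eval (x : ℝ) ∂(ν : Measure I)) F
        (𝓝 (∫ x : I, p.eval (x : ℝ) ∂(μ : Measure I))) := by
    intro p
    have hp : p ∈ Submodule.span ℝ
        (Set.range fun k : ℕ => Polynomial.Chebyshev.T ℝ (k : ℤ)) := by
      rw [span_chebyshev_eq_top]; trivial
    induction hp using Submodule.span_induction with
    | mem p hp =>
      obtain ⟨k, rfl⟩ := hp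
      exact h k
    | zero => simpa using tendsto_const_nhds
    | add p q _ _ hp hq =>
      have e : ∀ ν : ProbabilityMeasure I, ∫ x : I, (p + q).eval (x : ℝ) ∂(ν : Measure I)
          = ∫ x : I, p.eval (x : ℝ) ∂(ν : Measure I)
            + ∫ x : I, q.eval (x : ℝ) ∂(ν : Measure I) := fun ν => by
        simp only [Polynomial.eval_add]
        exact integral_add (integrable_polynomial ν p) (integrable_polynomial ν q)
      simp only [e]
      exact hp.add hq
    | smul c p _ hp =>
      have e : ∀ ν : ProbabilityMeasure I, ∫ x : I, (c • p).eval (x : ℝ) ∂(ν : Measure I)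
          = c * ∫ x : I, p.eval (x : ℝ) ∂(ν : Measure I) := fun ν => by
        simp only [Polynomial.eval_smul, smul_eq_mul]
        exact integral_const_mul _ _
      simp only [e]
      exact hp.const_mul c
  rw [Metric.tendsto_nhds]
  intro ε hε
  obtain ⟨p, hp⟩ := exists_polynomial_near_continuousMap (-1) 1 g (ε / 4) (by positivity)
  have happrox : ∀ ν : ProbabilityMeasure I, |∫ x : I, p.eval (x : ℝ) ∂(ν : Measure I)
      - ∫ x, g (toIcc x) ∂(ν : Measure I)| ≤ ε / 4 := by
    intro ν
    rw [← integral_sub (integrable_polynomial ν p) (integrable_comp_toIcc ν g)]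
    have hb : ∀ x : I, ‖p.eval (x : ℝ) - g (toIcc x)‖ ≤ ε / 4 := fun x =>
      ((p.toContinuousMapOn _ - g).norm_coe_le_norm (toIcc x)).trans hp.le
    have := norm_integral_le_of_norm_le_const (μ := (ν : Measure I))
      (Filter.Eventually.of_forall hb)
    simpa using this
  filter_upwards [Metric.tendsto_nhds.1 (hpoly p) (ε / 4) (by positivity)] with ν hν
  rw [Real.dist_eq] at hν ⊢
  have h1 := abs_le.1 (happrox ν)
  have h2 := abs_le.1 (happrox μ)
  have h3 := abs_lt.1 hν
  rw [abs_lt]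
  constructor <;> linarith [h1.1, h1.2, h2.1, h2.2, h3.1, h3.2]

lemma continuous_chebMoment (k : ℕ) : Continuous fun μ : ProbabilityMeasure I => chebMoment μ k :=
  ProbabilityMeasure.continuous_integral_boundedContinuousFunction
    ((BoundedContinuousFunction.mkOfCompact
      ((Polynomial.Chebyshev.T ℝ k).toContinuousMapOn (Set.Icc (-1 : ℝ) 1))).compContinuous toIcc)

/-- The weak topology on `𝓟(I)` is the topology of convergence of moments. The open interval `I`
is not compact, but an open subset of `I` is open in `[-1, 1]`, so that no mass is lost at the end
points when the limit is carried by `I`. -/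
lemma isInducing_chebMoment : IsInducing (chebMoment : ProbabilityMeasure I → ℕ → ℝ) := by
  rw [isInducing_iff_nhds]
  intro μ
  apply le_antisymm
  · exact ((continuous_pi fun k => continuous_chebMoment k).tendsto μ).le_comap
  · set L := comap (chebMoment : ProbabilityMeasure I → ℕ → ℝ) (𝓝 (chebMoment μ)) with hL
    have hk : ∀ k, Tendsto (fun ν => chebMoment ν k) L (𝓝 (chebMoment μ k)) := fun k =>
      ((continuous_apply k).tendsto (chebMoment μ)).comp
        (tendsto_comap (f := (chebMoment : ProbabilityMeasure I → ℕ → ℝ)))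
    have hm : Measurable toIcc := toIcc.continuous.measurable
    have hconv : Tendsto (fun ν : ProbabilityMeasure I => ν.map hm.aemeasurable) L
        (𝓝 (μ.map hm.aemeasurable)) := by
      rw [ProbabilityMeasure.tendsto_iff_forall_integral_tendsto]
      intro f
      have e : ∀ ν : ProbabilityMeasure I,
          ∫ y, f y ∂((ν.map hm.aemeasurable : ProbabilityMeasure _) : Measure _)
            = ∫ x, f (toIcc x) ∂(ν : Measure I) := fun ν => by
        rw [ProbabilityMeasure.toMeasure_map]
        exact integral_map hm.aemeasurable f.continuous.measurable.aestronglyMeasurable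
      simp only [e]
      exact tendsto_integral_toIcc hk f.toContinuousMap
    -- by the portmanteau theorem, weak convergence on `[-1, 1]` is tested on open subsets of `I`
    change Tendsto (fun ν : ProbabilityMeasure I => ν) L (𝓝 μ)
    refine tendsto_of_forall_isOpen_le_liminf' fun G hG => ?_
    obtain ⟨U, hU, rfl⟩ := isOpen_induced_iff.1 hG
    have hO : IsOpen (Subtype.val ⁻¹' (U ∩ I) : Set (Set.Icc (-1 : ℝ) 1)) :=
      (hU.inter isOpen_Ioo).preimage continuous_subtype_val
    have hle := ProbabilityMeasure.le_liminf_measure_open_of_tendsto hconv hO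
    have e : ∀ ν : ProbabilityMeasure I,
        ((ν.map hm.aemeasurable : ProbabilityMeasure _) : Measure _)
          (Subtype.val ⁻¹' (U ∩ I) : Set (Set.Icc (-1 : ℝ) 1))
        = (ν : Measure I) (Subtype.val ⁻¹' U) := fun ν => by
      rw [ProbabilityMeasure.toMeasure_map, Measure.map_apply hm hO.measurableSet]
      congr 1
      ext x
      simp [coe_toIcc]
    simpa only [e] using hle

lemma exists_moment_box_subset {μ : ProbabilityMeasure I} {O : Set (ProbabilityMeasure I)}
    (hO : IsOpen O) (hμ : μ ∈ O) : ∃ k : ℕ, ∃ ε : ℝ, 0 < ε ∧ ∀ ν : ProbabilityMeasure I,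
      (∀ j ≤ k, |chebMoment ν j - chebMoment μ j| ≤ ε) → ν ∈ O := by
  obtain ⟨W, hW, rfl⟩ := isInducing_chebMoment.isOpen_iff.1 hO
  obtain ⟨J, u, hu, hJ⟩ := isOpen_pi_iff.1 hW _ hμ
  have hball : ∀ j ∈ J, ∃ ε : ℝ, 0 < ε ∧ Metric.closedBall (chebMoment μ j) ε ⊆ u j := fun j hj =>
    Metric.nhds_basis_closedBall.mem_iff.1 ((hu j hj).1.mem_nhds (hu j hj).2)
  choose! r hr hru using hball
  obtain ⟨ε, hε, hεr⟩ : ∃ ε : ℝ, 0 < ε ∧ ∀ j ∈ J, ε ≤ r j := by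
    rcases J.eq_empty_or_nonempty with rfl | hJne
    · exact ⟨1, one_pos, by simp⟩
    · obtain ⟨i, hi, hmin⟩ := J.exists_min_image r hJne
      exact ⟨r i, hr i hi, hmin⟩
  refine ⟨J.sup id, ε, hε, fun ν hν => hJ fun j hj => hru j hj ?_⟩
  rw [Metric.mem_closedBall, Real.dist_eq]
  exact (hν j (Finset.le_sup (f := id) hj)).trans (hεr j hj)

lemma isOpen_moment_box (x : ℕ → ℝ) (k : ℕ) (ε : ℝ) :
    IsOpen {ν : ProbabilityMeasure I | ∀ j ≤ k, |chebMoment ν j - x j| < ε} := by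
  have : {ν : ProbabilityMeasure I | ∀ j ≤ k, |chebMoment ν j - x j| < ε}
      = ⋂ j ∈ Set.Iic k, {ν : ProbabilityMeasure I | |chebMoment ν j - x j| < ε} := by
    ext; simp
  rw [this]
  refine (Set.finite_Iic k).isOpen_biInter fun j _ => ?_
  exact isOpen_lt (((continuous_chebMoment j).sub continuous_const).abs) continuous_const

lemma abs_chebMoment_le_one (μ : ProbabilityMeasure I) (k : ℕ) : |chebMoment μ k| ≤ 1 := by
  have hb : ∀ x : I, ‖(Polynomial.Chebyshev.T ℝ k).eval (x : ℝ)‖ ≤ 1 := by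
    intro x
    rw [← Real.cos_arccos x.2.1.le x.2.2.le, Polynomial.Chebyshev.T_real_cos, Real.norm_eq_abs]
    exact Real.abs_cos_le_one _
  have := norm_integral_le_of_norm_le_const (μ := (μ : Measure I)) (Filter.Eventually.of_forall hb)
  simpa [chebMoment] using this

/-- The measures with mass at most `1 / j` on `{1 - x² < e^{-2jM}}` for every `j ≥ 1`; the index of
the definition is `j - 1`. It is compact, because the complements of these sets are compact in `I`. -/
def tightSet (M : ℝ) : Set (ProbabilityMeasure I) :=
  {μ | ∀ j : ℕ, μ {x : I | Real.exp (-2 * (j + 1 : ℕ) * M) ≤ 1 - (x : ℝ) ^ 2}ᶜ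
    ≤ (1 / ((j : NNReal) + 1))}

lemma isCompact_tightSet (M : ℝ) : IsCompact (tightSet M) := by
  refine isCompact_setOfPred_probabilityMeasure_mass_eq_compl_isCompact_le
    (tendsto_one_div_add_atTop_nhds_zero_nat (𝕜 := NNReal)) (fun j => ?_) (Or.inl inferInstance)
  rw [Subtype.isCompact_iff]
  have e : Subtype.val '' {x : I | Real.exp (-2 * (j + 1 : ℕ) * M) ≤ 1 - (x : ℝ) ^ 2}
      = {x : ℝ | Real.exp (-2 * (j + 1 : ℕ) * M) ≤ 1 - x ^ 2} := by
    ext x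
    constructor
    · rintro ⟨y, hy, rfl⟩; exact hy
    · intro hx
      have h1 : 0 < 1 - x ^ 2 := (Real.exp_pos _).trans_le hx
      exact ⟨⟨x, abs_lt.1 ((sq_lt_one_iff_abs_lt_one _).1 (by linarith))⟩, hx, rfl⟩
  rw [e]
  refine Metric.isCompact_of_isClosed_isBounded
    (isClosed_le continuous_const (by fun_prop)) ?_
  refine (Metric.isBounded_Icc (-1) 1).subset fun x hx => ?_
  have h1 : 0 < 1 - x ^ 2 := (Real.exp_pos _).trans_le hx
  exact abs_le.1 ((sq_lt_one_iff_abs_lt_one _).1 (by linarith)).le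

/-- The relation between `j` and the mass in `tightSet` makes the bound independent of `j`. -/
lemma norm_det_mul_norm_det_le_of_notMem_tightSet {n : ℕ} (hn : 1 ≤ n) {α : Fin (2 * n) → ℝ}
    (hα : α ∈ goodSet n) {M : ℝ} (hM : 0 ≤ M) (h : muN n α ∉ tightSet M) :
    ‖(1 - (1 : ℂ) • laxR α).det‖ * ‖(1 - (-1 : ℂ) • laxR α).det‖
      ≤ 2 ^ (2 * n) * Real.exp (-(2 * n * M)) := by
  simp only [tightSet, Set.mem_ofPred_eq, not_forall, not_le] at h
  obtain ⟨j, hj⟩ := h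
  refine norm_det_mul_norm_det_le hn hα hM (j := j + 1) (by omega) ?_
  have e : {x : I | Real.exp (-2 * (j + 1 : ℕ) * M) ≤ 1 - (x : ℝ) ^ 2}ᶜ
      = {x : I | 1 - (x : ℝ) ^ 2 < Real.exp (-2 * (j + 1 : ℕ) * M)} := by
    ext x; simp
  rw [e] at hj
  rw [ProbabilityMeasure.measureReal_eq_coe_coeFn]
  have := NNReal.coe_lt_coe.2 hj
  push_cast at this ⊢
  exact this

/-! ### Products of one-dimensional densities -/

lemma lintegral_pi_prod {n : ℕ} (μ : Fin n → Measure ℝ) [∀ i, SigmaFinite (μ i)]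
    (f : Fin n → ℝ → ℝ≥0∞) (hf : ∀ i, Measurable (f i)) :
    ∫⁻ x, ∏ i, f i (x i) ∂(Measure.pi μ) = ∏ i, ∫⁻ x, f i x ∂(μ i) := by
  induction n with
  | zero => simp
  | succ n ih =>
    have hmp := (measurePreserving_piFinSuccAbove μ 0).symm
    rw [← hmp.lintegral_comp_emb (MeasurableEquiv.measurableEmbedding _), Fin.prod_univ_succ]
    have e : ∀ p : ℝ × (Fin n → ℝ),
        ∏ i, f i ((MeasurableEquiv.piFinSuccAbove (fun _ : Fin (n + 1) => ℝ) 0).symm p i)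
          = f 0 p.1 * ∏ i : Fin n, f i.succ (p.2 i) := by
      intro p
      rw [Fin.prod_univ_succ]
      rfl
    simp only [e]
    rw [← ih (fun i => μ i.succ) (fun i => f i.succ) (fun i => hf i.succ)]
    have hm : Measurable fun y : Fin n → ℝ => ∏ i : Fin n, f i.succ (y i) :=
      Finset.measurable_prod _ fun i _ => (hf i.succ).comp (measurable_pi_apply i)
    exact lintegral_prod_mul (hf 0).aemeasurable hm.aemeasurable

lemma cube_eq_pi (N : ℕ) : cube N = Set.pi Set.univ fun _ => I := by
  ext; simp [cube]

lemma measurableSet_cube (N : ℕ) : MeasurableSet (cube N) := by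
  rw [cube_eq_pi]
  exact MeasurableSet.univ_pi fun _ => measurableSet_Ioo

/-- The density `(1 - x²)^{β-1}`. -/
noncomputable def siteDensity (β x : ℝ) : ℝ≥0∞ := ENNReal.ofReal ((1 - x ^ 2) ^ (β - 1))

lemma measurable_siteDensity (β : ℝ) : Measurable (siteDensity β) := by
  unfold siteDensity
  fun_prop

/-- The unnormalised law of one coefficient. -/
noncomputable def siteMeasure (β : ℝ) : Measure ℝ :=
  (volume.restrict I).withDensity (siteDensity β)

/-- Powers of the distances to the end points are integrable on `I` above the exponent `-1`. -/
lemma lintegral_rpow_mul_rpow_lt_top {a b : ℝ} (ha : -1 < a) (hb : -1 < b) :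
    ∫⁻ x in I, ENNReal.ofReal ((1 + x) ^ a * (1 - x) ^ b) < ∞ := by
  have hint1 : IntegrableOn (fun x : ℝ => (1 + x) ^ a) I := by
    have h1 : IntervalIntegrable (fun x : ℝ => x ^ a) volume 0 2 :=
      intervalIntegral.intervalIntegrable_rpow' ha
    have h2 := h1.comp_add_left 1
    norm_num at h2
    exact ((intervalIntegrable_iff_integrableOn_Ioo_of_le (by norm_num)).1 h2)
  have hint2 : IntegrableOn (fun x : ℝ => (1 - x) ^ b) I := by
    have h1 : IntervalIntegrable (fun x : ℝ => x ^ b) volume 0 2 :=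
      intervalIntegral.intervalIntegrable_rpow' hb
    have h2 := (h1.comp_sub_left 1).symm
    norm_num at h2
    exact ((intervalIntegrable_iff_integrableOn_Ioo_of_le (by norm_num)).1 h2)
  have hbd : ∀ c y : ℝ, 1 ≤ y → y ≤ 2 → y ^ c ≤ 2 ^ |c| := fun c y h1 h2 =>
    (Real.rpow_le_rpow_of_exponent_le h1 (le_abs_self c)).trans
      (Real.rpow_le_rpow (by linarith) h2 (abs_nonneg c))
  have hsum : IntegrableOn (fun x : ℝ => (2 : ℝ) ^ |b| * (1 + x) ^ a + 2 ^ |a| * (1 - x) ^ b) I :=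
    (hint1.const_mul _).add (hint2.const_mul _)
  refine lt_of_le_of_lt (setLIntegral_mono_ae' measurableSet_Ioo
    (Filter.Eventually.of_forall fun x hx => ?_)) hsum.lintegral_lt_top
  apply ENNReal.ofReal_le_ofReal
  have p1 : 0 ≤ (1 + x) ^ a := Real.rpow_nonneg (by linarith [hx.1]) _
  have p2 : 0 ≤ (1 - x) ^ b := Real.rpow_nonneg (by linarith [hx.2]) _
  rcases le_total x 0 with h | h
  · have h1 := hbd b (1 - x) (by linarith) (by linarith [hx.1])
    have : (1 + x) ^ a * (1 - x) ^ b ≤ (1 + x) ^ a * 2 ^ |b| := by gcongr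
    have : 0 ≤ (2 : ℝ) ^ |a| * (1 - x) ^ b := by positivity
    linarith
  · have h1 := hbd a (1 + x) (by linarith) (by linarith [hx.2])
    have : (1 + x) ^ a * (1 - x) ^ b ≤ 2 ^ |a| * (1 - x) ^ b := by gcongr
    have : 0 ≤ (2 : ℝ) ^ |b| * (1 + x) ^ a := by positivity
    linarith

lemma one_sub_sq_rpow {x : ℝ} (hx : x ∈ I) (c : ℝ) :
    (1 - x ^ 2) ^ c = (1 + x) ^ c * (1 - x) ^ c := by
  rw [← Real.mul_rpow (by linarith [hx.1]) (by linarith [hx.2])]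
  congr 1; ring

lemma isFiniteMeasure_siteMeasure {β : ℝ} (hβ : 0 < β) : IsFiniteMeasure (siteMeasure β) := by
  apply isFiniteMeasure_withDensity
  refine ne_of_lt (lt_of_le_of_lt (le_of_eq ?_)
    (lintegral_rpow_mul_rpow_lt_top (a := β - 1) (b := β - 1) (by linarith) (by linarith)))
  refine setLIntegral_congr_fun measurableSet_Ioo fun x hx => ?_
  simp only [siteDensity, one_sub_sq_rpow hx]

lemma siteMeasure_univ_ne_zero (β : ℝ) : siteMeasure β Set.univ ≠ 0 := by
  rw [siteMeasure, withDensity_apply _ MeasurableSet.univ, Measure.restrict_univ]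
  intro h
  rw [setLIntegral_eq_zero_iff measurableSet_Ioo (measurable_siteDensity β)] at h
  have h2 : ∀ᵐ x ∂(volume : Measure ℝ), x ∉ I := by
    filter_upwards [h] with x hx hxI
    have h3 : 0 < 1 - x ^ 2 := by nlinarith [hxI.1, hxI.2]
    have := hx hxI
    simp only [siteDensity, ENNReal.ofReal_eq_zero] at this
    linarith [Real.rpow_pos_of_pos h3 (β - 1)]
  rw [ae_iff] at h2
  have h3 : volume (Set.Ioo (-1 : ℝ) 1) = 0 := by
    convert h2 using 2
    ext; simp
  rw [Real.volume_Ioo] at h3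
  norm_num at h3

/-- The law of one coefficient, with density proportional to `(1 - x²)^{β-1}`. -/
noncomputable def siteLaw (β : ℝ) : Measure ℝ := (siteMeasure β Set.univ)⁻¹ • siteMeasure β

lemma isProbabilityMeasure_siteLaw {β : ℝ} (hβ : 0 < β) : IsProbabilityMeasure (siteLaw β) := by
  have := isFiniteMeasure_siteMeasure hβ
  constructor
  rw [siteLaw, Measure.smul_apply, smul_eq_mul]
  exact ENNReal.inv_mul_cancel (siteMeasure_univ_ne_zero β) (measure_ne_top _ _)

/-- The law of `N` independent coefficients. -/
noncomputable def freeLaw (β : ℝ) (N : ℕ) : Measure (Fin N → ℝ) := Measure.pi fun _ => siteLaw β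

lemma isProbabilityMeasure_freeLaw {β : ℝ} (hβ : 0 < β) (N : ℕ) :
    IsProbabilityMeasure (freeLaw β N) := by
  have := isProbabilityMeasure_siteLaw hβ
  unfold freeLaw
  infer_instance

lemma withDensity_cube_eq {β : ℝ} (hβ : 0 < β) (N : ℕ) :
    (volume.restrict (cube N)).withDensity (fun α : Fin N → ℝ => ∏ j, siteDensity β (α j))
      = siteMeasure β Set.univ ^ N • freeLaw β N := by
  have hfin := isFiniteMeasure_siteMeasure hβ
  have hprob := isProbabilityMeasure_siteLaw hβ
  have h0 := siteMeasure_univ_ne_zero β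
  have ht : siteMeasure β Set.univ ≠ ∞ := measure_ne_top _ _
  have h1 : (volume.restrict (cube N)).withDensity (fun α : Fin N → ℝ => ∏ j, siteDensity β (α j))
      = Measure.pi fun _ => siteMeasure β := by
    symm
    refine Measure.pi_eq fun s hs => ?_
    rw [withDensity_apply _ (MeasurableSet.univ_pi hs), cube_eq_pi,
      volume_pi, Measure.restrict_pi_pi, Measure.restrict_pi_pi,
      lintegral_pi_prod _ (fun _ => siteDensity β) (fun _ => measurable_siteDensity β)]
    refine Finset.prod_congr rfl fun i _ => ?_
    rw [siteMeasure, withDensity_apply _ (hs i)]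
  rw [h1]
  refine Measure.pi_eq fun s hs => ?_
  rw [Measure.smul_apply, freeLaw, Measure.pi_pi, smul_eq_mul]
  simp only [siteLaw, Measure.smul_apply, smul_eq_mul]
  rw [Finset.prod_mul_distrib, Finset.prod_const, Finset.card_univ, Fintype.card_fin, ← mul_assoc,
    ← mul_pow, ENNReal.mul_inv_cancel h0 ht, one_pow, one_mul]

lemma ae_mem_cube {β : ℝ} (hβ : 0 < β) (N : ℕ) : ∀ᵐ α ∂(freeLaw β N), α ∈ cube N := by
  have hfin := isFiniteMeasure_siteMeasure hβ
  have h := withDensity_cube_eq hβ N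
  have h2 : ∀ᵐ α ∂((volume.restrict (cube N)).withDensity
      (fun α : Fin N → ℝ => ∏ j, siteDensity β (α j))), α ∈ cube N :=
    (withDensity_absolutelyContinuous _ _).ae_le (ae_restrict_mem (measurableSet_cube N))
  rw [h] at h2
  exact (Measure.ae_ennreal_smul_measure_iff
    (pow_ne_zero _ (siteMeasure_univ_ne_zero β))).1 h2

/-! ### Lower tails of the determinants -/

/-- By Hölder's inequality, the law of one coefficient is bounded by a power of the length. -/
lemma exists_siteLaw_le {β : ℝ} (hβ : 0 < β) : ∃ C : ℝ≥0∞, C ≠ ∞ ∧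
    ∀ T : Set ℝ, MeasurableSet T → siteLaw β T ≤ C * volume T ^ (β / (1 + β)) := by
  -- the density is in `L^{1+β}`, because `(β - 1) (1 + β) = β² - 1 > -1`
  have hpq : (1 + β).HolderConjugate ((1 + β) / β) := by
    rw [Real.holderConjugate_iff]
    refine ⟨by linarith, ?_⟩
    field_simp
  set A := ∫⁻ x in I, siteDensity β x ^ (1 + β) with hA
  have hAfin : A ≠ ∞ := by
    refine ne_of_lt (lt_of_le_of_lt (le_of_eq ?_)
      (lintegral_rpow_mul_rpow_lt_top (a := (β - 1) * (1 + β)) (b := (β - 1) * (1 + β))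
        (by nlinarith) (by nlinarith)))
    refine setLIntegral_congr_fun measurableSet_Ioo fun x hx => ?_
    have h0 : 0 ≤ 1 - x ^ 2 := by nlinarith [hx.1, hx.2]
    simp only [siteDensity]
    rw [ENNReal.ofReal_rpow_of_nonneg (Real.rpow_nonneg h0 _) (by linarith), ← Real.rpow_mul h0,
      one_sub_sq_rpow hx]
  have hZ := siteMeasure_univ_ne_zero β
  refine ⟨(siteMeasure β Set.univ)⁻¹ * A ^ (1 / (1 + β)),
    ENNReal.mul_ne_top (ENNReal.inv_ne_top.2 hZ) (ENNReal.rpow_ne_top_of_nonneg (by positivity)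
      hAfin), fun T hT => ?_⟩
  rw [siteLaw, Measure.smul_apply, smul_eq_mul, mul_assoc]
  gcongr
  have h1 : siteMeasure β T = ∫⁻ x in I, (siteDensity β * T.indicator (1 : ℝ → ℝ≥0∞)) x := by
    rw [siteMeasure, withDensity_apply _ hT, ← lintegral_indicator hT]
    refine lintegral_congr fun x => ?_
    by_cases hx : x ∈ T <;> simp [hx]
  have h2 : ∫⁻ x in I, (T.indicator (1 : ℝ → ℝ≥0∞) x) ^ ((1 + β) / β) ≤ volume T := by
    have e : ∀ x, (T.indicator (1 : ℝ → ℝ≥0∞) x) ^ ((1 + β) / β) = T.indicator 1 x := fun x => by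
      have : 0 < (1 + β) / β := by positivity
      by_cases hx : x ∈ T <;> simp [hx, this]
    simp only [e]
    rw [lintegral_indicator_one hT]
    exact Measure.restrict_apply_le _ _
  rw [h1]
  refine (ENNReal.lintegral_mul_le_Lp_mul_Lq _ hpq (measurable_siteDensity β).aemeasurable
    (measurable_one.indicator hT).aemeasurable).trans ?_
  rw [one_div_div]
  gcongr

/-- A negative moment of `1 ± α` is finite; the exponent `-β / 2` leaves `β / 2 - 1 > -1` at the end
point. -/
lemma exists_lintegral_rpow_le {β : ℝ} (hβ : 0 < β) : ∃ c : ℝ, 0 < c ∧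
    ∀ e : ℝ, e = 1 ∨ e = -1 →
      ∫⁻ x, ENNReal.ofReal ((1 + e * x) ^ (-(β / 2))) ∂(siteLaw β) ≤ ENNReal.ofReal c := by
  have hfinite : ∀ e : ℝ, e = 1 ∨ e = -1 →
      ∫⁻ x, ENNReal.ofReal ((1 + e * x) ^ (-(β / 2))) ∂(siteLaw β) < ∞ := by
    intro e he
    rw [siteLaw, lintegral_smul_measure, smul_eq_mul]
    refine ENNReal.mul_lt_top (ENNReal.inv_ne_top.2 (siteMeasure_univ_ne_zero β)).lt_top ?_
    rw [siteMeasure, lintegral_withDensity_eq_lintegral_mul _ (measurable_siteDensity β)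
      (by fun_prop)]
    rcases he with rfl | rfl
    · refine lt_of_le_of_lt (le_of_eq ?_) (lintegral_rpow_mul_rpow_lt_top
        (a := β / 2 - 1) (b := β - 1) (by linarith) (by linarith))
      refine setLIntegral_congr_fun measurableSet_Ioo fun x hx => ?_
      have h1 : 0 < 1 + x := by linarith [hx.1]
      have h2 : 0 < 1 - x := by linarith [hx.2]
      simp only [Pi.mul_apply, siteDensity, one_sub_sq_rpow hx, one_mul]
      rw [← ENNReal.ofReal_mul (by positivity), mul_right_comm, ← Real.rpow_add h1]
      congr 3; ring
    · refine lt_of_le_of_lt (le_of_eq ?_) (lintegral_rpow_mul_rpow_lt_top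
        (a := β - 1) (b := β / 2 - 1) (by linarith) (by linarith))
      refine setLIntegral_congr_fun measurableSet_Ioo fun x hx => ?_
      have h1 : 0 < 1 + x := by linarith [hx.1]
      have h2 : 0 < 1 - x := by linarith [hx.2]
      simp only [Pi.mul_apply, siteDensity, one_sub_sq_rpow hx, neg_one_mul, ← sub_eq_add_neg]
      rw [← ENNReal.ofReal_mul (by positivity), mul_assoc, ← Real.rpow_add h2]
      congr 3; ring
  refine ⟨max 1 (max (∫⁻ x, ENNReal.ofReal ((1 + 1 * x) ^ (-(β / 2))) ∂(siteLaw β)).toReal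
    (∫⁻ x, ENNReal.ofReal ((1 + -1 * x) ^ (-(β / 2))) ∂(siteLaw β)).toReal),
    lt_of_lt_of_le one_pos (le_max_left _ _), fun e he => ?_⟩
  rw [← ENNReal.ofReal_toReal (hfinite e he).ne]
  apply ENNReal.ofReal_le_ofReal
  rcases he with rfl | rfl
  · exact (le_max_left _ _).trans (le_max_right _ _)
  · exact (le_max_right _ _).trans (le_max_right _ _)

/-- The square root of `|det (1 - s 𝓔)|`, up to sign. -/
noncomputable def detRoot (s : ℝ) {N : ℕ} (α : Fin N → ℝ) : ℝ :=
  ∏ j, Real.sqrt (1 + blockSign s j * α j)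
    - ∏ j, (blockSign s j * Real.sqrt (1 - blockSign s j * α j))

lemma continuous_detRoot (s : ℝ) (N : ℕ) : Continuous fun α : Fin N → ℝ => detRoot s α := by
  unfold detRoot
  fun_prop

/-- The positive term of `detRoot`. -/
noncomputable def detLead (s : ℝ) {N : ℕ} (α : Fin N → ℝ) : ℝ :=
  ∏ j, Real.sqrt (1 + blockSign s j * α j)

lemma continuous_detLead (s : ℝ) (N : ℕ) : Continuous fun α : Fin N → ℝ => detLead s α := by
  unfold detLead
  fun_prop

/-- The function `x ↦ p √(1 + x) - c √(1 - x)` is small only on a short interval: for `c ≥ 0` it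
increases at least as fast as `p √(1 + x)`, and for `c ≤ 0` it is at least `p √(1 + x)`. -/
lemma volume_slice_le {p c t : ℝ} (hp : 0 < p) (ht : 0 ≤ t) :
    volume {x : ℝ | x ∈ I ∧ |Real.sqrt (1 + x) * p - c * Real.sqrt (1 - x)|
      ≤ t * (Real.sqrt (1 + x) * p)} ≤ ENNReal.ofReal (24 * t) := by
  set T := {x : ℝ | x ∈ I ∧ |Real.sqrt (1 + x) * p - c * Real.sqrt (1 - x)|
      ≤ t * (Real.sqrt (1 + x) * p)} with hT
  have hs2 : ∀ x ∈ I, Real.sqrt (1 + x) ≤ 3 / 2 := fun x hx => by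
    rw [Real.sqrt_le_left (by norm_num)]; linarith [hx.2]
  have hs0 : ∀ x, 0 ≤ Real.sqrt (1 + x) := fun x => Real.sqrt_nonneg _
  have key : ∀ x ∈ T, ∀ y ∈ T, x ≤ y → y - x ≤ 12 * t := by
    rintro x ⟨hx, hxt⟩ y ⟨hy, hyt⟩ hxy
    have h1 := abs_le.1 hxt
    have h2 := abs_le.1 hyt
    have m1 : Real.sqrt (1 + x) ≤ Real.sqrt (1 + y) := Real.sqrt_le_sqrt (by linarith)
    have m2 : Real.sqrt (1 - y) ≤ Real.sqrt (1 - x) := Real.sqrt_le_sqrt (by linarith)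
    have b1 : t * (Real.sqrt (1 + x) * p) ≤ 3 / 2 * t * p := by
      have := mul_le_mul_of_nonneg_left (hs2 x hx) (mul_nonneg ht hp.le); linarith
    have b2 : t * (Real.sqrt (1 + y) * p) ≤ 3 / 2 * t * p := by
      have := mul_le_mul_of_nonneg_left (hs2 y hy) (mul_nonneg ht hp.le); linarith
    have hd : Real.sqrt (1 + y) - Real.sqrt (1 + x) ≤ 3 * t := by
      rcases le_total 0 c with hc | hc
      · have h3 : c * Real.sqrt (1 - y) ≤ c * Real.sqrt (1 - x) :=
          mul_le_mul_of_nonneg_left m2 hc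
        have h4 : (Real.sqrt (1 + y) - Real.sqrt (1 + x)) * p ≤ 3 * t * p := by
          nlinarith [h1.1, h2.2]
        exact le_of_mul_le_mul_right h4 hp
      · have h3 : c * Real.sqrt (1 - y) ≤ 0 :=
          mul_nonpos_of_nonpos_of_nonneg hc (Real.sqrt_nonneg _)
        have h4 : Real.sqrt (1 + y) * p ≤ 3 / 2 * t * p := by linarith [h2.2]
        have h5 := le_of_mul_le_mul_right h4 hp
        linarith [hs0 x]
    have e1 : y - x = (Real.sqrt (1 + y) - Real.sqrt (1 + x))
        * (Real.sqrt (1 + y) + Real.sqrt (1 + x)) := by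
      have q1 := Real.sq_sqrt (show 0 ≤ 1 + x by linarith [hx.1])
      have q2 := Real.sq_sqrt (show 0 ≤ 1 + y by linarith [hy.1])
      nlinarith
    rw [e1]
    calc _ ≤ (3 * t) * (3 / 2 + 3 / 2) := by
          have := hs2 y hy
          have := hs2 x hx
          have := hs0 x
          have := hs0 y
          exact mul_le_mul hd (by linarith) (by linarith) (by linarith)
      _ ≤ 12 * t := by linarith
  rcases T.eq_empty_or_nonempty with h | ⟨x0, hx0⟩
  · rw [h]; simp
  · have hsub : T ⊆ Set.Icc (x0 - 12 * t) (x0 + 12 * t) := by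
      intro x hx
      rcases le_total x x0 with h | h
      · have := key x hx x0 hx0 h
        constructor <;> linarith
      · have := key x0 hx0 x hx h
        constructor <;> linarith
    refine (measure_mono hsub).trans ?_
    rw [Real.volume_Icc]
    apply ENNReal.ofReal_le_ofReal
    linarith

/-- Conditionally on all but the first coefficient, `detRoot` is unlikely to be much smaller
than `detLead`. -/
lemma exists_freeLaw_detRoot_le_mul {β : ℝ} (hβ : 0 < β) : ∃ C : ℝ≥0∞, C ≠ ∞ ∧
    ∀ (N : ℕ) (s t : ℝ), 0 < N → s = 1 ∨ s = -1 → 0 ≤ t →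
      freeLaw β N {α | α ∈ cube N ∧ |detRoot s α| ≤ t * detLead s α}
        ≤ C * ENNReal.ofReal (24 * t) ^ (β / (1 + β)) := by
  obtain ⟨C, hC, hCT⟩ := exists_siteLaw_le hβ
  refine ⟨C, hC, fun N s t hN hs ht => ?_⟩
  obtain ⟨m, rfl⟩ : ∃ m, N = m + 1 := ⟨N - 1, by omega⟩
  have hprob := isProbabilityMeasure_siteLaw hβ
  have hprob' := isProbabilityMeasure_freeLaw hβ m
  set A : Set (Fin (m + 1) → ℝ) := {α | α ∈ cube (m + 1) ∧ |detRoot s α| ≤ t * detLead s α}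
    with hA
  have hAm : MeasurableSet A :=
    (measurableSet_cube _).inter (measurableSet_le (continuous_detRoot s _).abs.measurable
      ((continuous_detLead s _).measurable.const_mul t))
  have hmp := (measurePreserving_piFinSuccAbove (fun _ : Fin (m + 1) => siteLaw β) 0).symm
  have e1 : freeLaw β (m + 1) A = ((siteLaw β).prod (freeLaw β m))
      ((MeasurableEquiv.piFinSuccAbove (fun _ : Fin (m + 1) => ℝ) 0).symm ⁻¹' A) :=
    (hmp.measure_preimage hAm.nullMeasurableSet).symm
  rw [e1, Measure.prod_apply_symm (hmp.measurable hAm)]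
  have hslice : ∀ y : Fin m → ℝ, siteLaw β ((fun x => (x, y)) ⁻¹'
      ((MeasurableEquiv.piFinSuccAbove (fun _ : Fin (m + 1) => ℝ) 0).symm ⁻¹' A))
      ≤ C * ENNReal.ofReal (24 * t) ^ (β / (1 + β)) := by
    intro y
    refine (hCT _ (measurable_prodMk_right (hmp.measurable hAm))).trans ?_
    gcongr
    have hsym : ∀ x : ℝ, (MeasurableEquiv.piFinSuccAbove (fun _ : Fin (m + 1) => ℝ) 0).symm (x, y)
        = (Fin.cons x y : Fin (m + 1) → ℝ) := fun x => by
      ext i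
      refine Fin.cases ?_ (fun i => ?_) i <;> rfl
    by_cases hy : y ∈ cube m
    · set p := ∏ j : Fin m, Real.sqrt (1 + blockSign s j.succ * y j) with hp
      have hp0 : 0 < p := Finset.prod_pos fun j _ => Real.sqrt_pos.2 (by
        linarith [(blockSign_mul_mem hs j.succ (hy j)).1])
      refine (measure_mono ?_).trans (volume_slice_le
        (c := ∏ j : Fin m, (blockSign s j.succ * Real.sqrt (1 - blockSign s j.succ * y j)))
        hp0 ht)
      intro x hx
      rw [Set.mem_preimage, Set.mem_preimage, hsym] at hx
      obtain ⟨h1, h2⟩ := hx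
      have h0 : blockSign s (0 : Fin (m + 1)) = 1 := by simp [blockSign]
      refine ⟨h1 0, ?_⟩
      simp only [detRoot, detLead, Fin.prod_univ_succ, Fin.cons_zero, Fin.cons_succ, h0,
        one_mul] at h2
      rw [mul_comm (∏ j : Fin m, _) (Real.sqrt (1 - x))]
      exact h2
    · refine (measure_mono (t := ∅) ?_).trans (by simp)
      intro x hx
      rw [Set.mem_preimage, Set.mem_preimage, hsym] at hx
      exact hy fun j => by simpa using hx.1 j.succ
  refine (lintegral_mono hslice).trans ?_
  rw [lintegral_const, measure_univ, mul_one]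

/-- A Chernoff bound for `detLead`, a product of independent variables. -/
lemma exists_freeLaw_detLead_le {β : ℝ} (hβ : 0 < β) : ∃ c : ℝ, 0 < c ∧
    ∀ (N : ℕ) (s K : ℝ), s = 1 ∨ s = -1 →
      freeLaw β N {α | α ∈ cube N ∧ detLead s α ≤ Real.exp (-(N * K))}
        ≤ ENNReal.ofReal ((c * Real.exp (-(β * K))) ^ N) := by
  obtain ⟨c, hc, hcE⟩ := exists_lintegral_rpow_le hβ
  refine ⟨c, hc, fun N s K hs => ?_⟩
  have hprob := isProbabilityMeasure_siteLaw hβ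
  -- Markov's inequality for `detLead ^ (-β)`, whose factors are independent
  set f : Fin N → ℝ → ℝ≥0∞ := fun j x => ENNReal.ofReal ((1 + blockSign s j * x) ^ (-(β / 2)))
    with hf
  have hfm : ∀ j, Measurable (f j) := fun j => by
    simp only [hf]; fun_prop
  have hE : ∫⁻ α, ∏ j, f j (α j) ∂(freeLaw β N) ≤ ENNReal.ofReal (c ^ N) := by
    rw [freeLaw, lintegral_pi_prod _ f hfm]
    refine (Finset.prod_le_prod' fun j _ => hcE _ (blockSign_eq hs j)).trans ?_
    rw [Finset.prod_const, Finset.card_univ, Fintype.card_fin, ENNReal.ofReal_pow hc.le]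
  have hsub : {α : Fin N → ℝ | α ∈ cube N ∧ detLead s α ≤ Real.exp (-(N * K))}
      ⊆ {α | ENNReal.ofReal (Real.exp (β * K * N)) ≤ ∏ j, f j (α j)} := by
    rintro α ⟨hα, hle⟩
    have hpos : ∀ j, 0 < 1 + blockSign s j * α j := fun j => by
      linarith [(blockSign_mul_mem hs j (hα j)).1]
    have e : ∏ j, f j (α j) = ENNReal.ofReal (detLead s α ^ (-β)) := by
      rw [detLead, ← Real.finsetProd_rpow _ _ (fun j _ => Real.sqrt_nonneg _),
        ENNReal.ofReal_prod_of_nonneg fun j _ => Real.rpow_nonneg (Real.sqrt_nonneg _) _]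
      refine Finset.prod_congr rfl fun j _ => ?_
      simp only [hf]
      rw [Real.sqrt_eq_rpow, ← Real.rpow_mul (hpos j).le]
      congr 2; ring
    rw [Set.mem_ofPred_eq, e]
    apply ENNReal.ofReal_le_ofReal
    have hlead : 0 < detLead s α := Finset.prod_pos fun j _ => Real.sqrt_pos.2 (hpos j)
    calc Real.exp (β * K * N) = Real.exp (-(N * K)) ^ (-β) := by
          rw [← Real.exp_mul]; congr 1; ring
      _ ≤ detLead s α ^ (-β) :=
          Real.rpow_le_rpow_of_nonpos hlead hle (by linarith)
  refine (measure_mono hsub).trans ?_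
  have hm : Measurable fun α : Fin N → ℝ => ∏ j, f j (α j) :=
    Finset.measurable_prod _ fun j _ => (hfm j).comp (measurable_pi_apply j)
  refine (meas_ge_le_lintegral_div hm.aemeasurable
    (by simp [Real.exp_pos]) ENNReal.ofReal_ne_top).trans ?_
  calc _ ≤ ENNReal.ofReal (c ^ N) / ENNReal.ofReal (Real.exp (β * K * N)) := by gcongr
    _ = ENNReal.ofReal ((c * Real.exp (-(β * K))) ^ N) := by
      rw [← ENNReal.ofReal_div_of_pos (Real.exp_pos _), mul_pow, ← Real.exp_nat_mul, div_eq_mul_inv,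
        ← Real.exp_neg]
      congr 3; ring

/-- The probability that `|detRoot| ≤ e^{-2NK}` is of an exponential order as small as desired, for
`K` large: either `detLead` is small, or `detRoot` is much smaller than `detLead`. -/
lemma exists_freeLaw_detRoot_le {β : ℝ} (hβ : 0 < β) (a : ℝ) : ∃ K B : ℝ, 0 ≤ K ∧
    ∀ (N : ℕ) (s : ℝ), 0 < N → s = 1 ∨ s = -1 →
      freeLaw β N {α | α ∈ cube N ∧ |detRoot s α| ≤ Real.exp (-(2 * N * K))}
        ≤ ENNReal.ofReal (B * Real.exp (-(N * a))) := by
  obtain ⟨C, hC, h1⟩ := exists_freeLaw_detRoot_le_mul hβ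
  obtain ⟨c, hc, h2⟩ := exists_freeLaw_detLead_le hβ
  have hγ : 0 < β / (1 + β) := by positivity
  set γ := β / (1 + β) with hγdef
  set K := max 0 (max ((Real.log c + a) / β) (a / γ)) with hK
  have hK1 : Real.log c + a ≤ β * K := by
    have : (Real.log c + a) / β ≤ K := (le_max_left _ _).trans (le_max_right _ _)
    rw [div_le_iff₀ hβ] at this; linarith
  have hK2 : a ≤ γ * K := by
    have : a / γ ≤ K := (le_max_right _ _).trans (le_max_right _ _)
    rw [div_le_iff₀ hγ] at this; linarith
  refine ⟨K, 1 + C.toReal * 24 ^ γ, le_max_left _ _, fun N s hN hs => ?_⟩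
  have hsub : {α : Fin N → ℝ | α ∈ cube N ∧ |detRoot s α| ≤ Real.exp (-(2 * N * K))} ⊆
      {α | α ∈ cube N ∧ detLead s α ≤ Real.exp (-(N * K))} ∪
      {α | α ∈ cube N ∧ |detRoot s α| ≤ Real.exp (-(N * K)) * detLead s α} := by
    rintro α ⟨hα, h⟩
    rcases le_total (detLead s α) (Real.exp (-(N * K))) with h3 | h3
    · exact Or.inl ⟨hα, h3⟩
    · refine Or.inr ⟨hα, h.trans ?_⟩
      calc Real.exp (-(2 * N * K)) = Real.exp (-(N * K)) * Real.exp (-(N * K)) := by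
            rw [← Real.exp_add]; congr 1; ring
        _ ≤ _ := by gcongr
  refine (measure_mono hsub).trans ((measure_union_le _ _).trans ?_)
  have e1 : (c * Real.exp (-(β * K))) ^ N ≤ Real.exp (-(N * a)) := by
    rw [← Real.exp_log hc, ← Real.exp_add, ← Real.exp_nat_mul, Real.exp_le_exp]
    have : (N : ℝ) * (Real.log c + a) ≤ N * (β * K) := by gcongr
    linarith
  have e2 : C * ENNReal.ofReal (24 * Real.exp (-(N * K))) ^ γ
      ≤ ENNReal.ofReal (C.toReal * 24 ^ γ * Real.exp (-(N * a))) := by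
    rw [ENNReal.ofReal_rpow_of_nonneg (by positivity) hγ.le, ← ENNReal.ofReal_toReal hC,
      ← ENNReal.ofReal_mul ENNReal.toReal_nonneg, ENNReal.ofReal_toReal hC, mul_assoc]
    apply ENNReal.ofReal_le_ofReal
    rw [Real.mul_rpow (by norm_num) (Real.exp_pos _).le, ← Real.exp_mul]
    gcongr
    have : (N : ℝ) * a ≤ N * (γ * K) := by gcongr
    linarith
  calc _ ≤ ENNReal.ofReal (Real.exp (-(N * a)))
        + ENNReal.ofReal (C.toReal * 24 ^ γ * Real.exp (-(N * a))) := by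
        refine add_le_add ((h2 N s K hs).trans (ENNReal.ofReal_le_ofReal e1)) ?_
        exact (h1 N s _ hN hs (Real.exp_pos _).le).trans e2
    _ = _ := by
        rw [← ENNReal.ofReal_add (by positivity) (by positivity)]
        congr 1; ring

lemma norm_det_eq_detRoot_sq {n : ℕ} (hn : 1 ≤ n) {s : ℝ} (hs : s = 1 ∨ s = -1)
    {α : Fin (2 * n) → ℝ} (hα : α ∈ cube (2 * n)) :
    ‖(1 - (s : ℂ) • laxR α).det‖ = detRoot s α ^ 2 :=
  norm_det_one_sub_smul_lax hn hs hα

/-- Almost surely neither `1` nor `-1` is an eigenvalue: this is the case `t = 0` of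
`exists_freeLaw_detRoot_le_mul`. -/
lemma ae_mem_goodSet {β : ℝ} (hβ : 0 < β) {n : ℕ} (hn : 1 ≤ n) :
    ∀ᵐ α ∂(freeLaw β (2 * n)), α ∈ goodSet n := by
  obtain ⟨C, hC, h1⟩ := exists_freeLaw_detRoot_le_mul hβ
  have hγ : 0 < β / (1 + β) := by positivity
  have hnull : ∀ s : ℝ, s = 1 ∨ s = -1 →
      ∀ᵐ α ∂(freeLaw β (2 * n)), ¬ (α ∈ cube (2 * n) ∧ |detRoot s α| ≤ 0 * detLead s α) := by
    intro s hs
    have := h1 (2 * n) s 0 (by omega) hs le_rfl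
    rw [mul_zero, ENNReal.ofReal_zero, ENNReal.zero_rpow_of_pos hγ, mul_zero] at this
    rw [ae_iff]
    simp only [not_not]
    exact le_antisymm this zero_le
  filter_upwards [ae_mem_cube hβ (2 * n), hnull 1 (Or.inl rfl), hnull (-1) (Or.inr rfl)]
    with α hα hp hm
  refine ⟨hα, fun s hs h0 => ?_⟩
  have h2 := norm_det_eq_detRoot_sq hn hs hα
  rw [h0, norm_zero] at h2
  have h3 : detRoot s α = 0 := pow_eq_zero_iff (two_ne_zero) |>.1 h2.symm
  rcases hs with rfl | rfl
  · exact hp ⟨hα, by rw [h3]; simp⟩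
  · exact hm ⟨hα, by rw [h3]; simp⟩

/-- Exponential tightness in `𝓟(I)`: mass accumulates at the end points of `I` only when
`det (1 - 𝓔²)` is exponentially small. -/
lemma exists_freeLaw_tightSet_le {β : ℝ} (hβ : 0 < β) (a : ℝ) : ∃ M : ℝ, ∀ᶠ n : ℕ in atTop,
    freeLaw β (2 * n) {α | muN n α ∉ tightSet M} ≤ ENNReal.ofReal (Real.exp (-(2 * n * a))) := by
  obtain ⟨K, B, hK, hKB⟩ := exists_freeLaw_detRoot_le hβ (a + 1)
  -- off the exceptional event the product of the determinants is at least `e^{-16nK}`, whereas outside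
  -- `tightSet M` it is at most `2^{2n} e^{-2nM}`; the summand `1` in `M` absorbs the power of `2`
  refine ⟨8 * K + 1, ?_⟩
  have hlarge : ∀ᶠ n : ℕ in atTop, 2 * B ≤ Real.exp (2 * n) := by
    have : Tendsto (fun n : ℕ => Real.exp (2 * (n : ℝ))) atTop atTop :=
      Real.tendsto_exp_atTop.comp (tendsto_natCast_atTop_atTop.const_mul_atTop two_pos)
    exact this.eventually_ge_atTop _
  filter_upwards [hlarge, eventually_ge_atTop 1] with n hnB hn
  have hsub : ∀ᵐ α ∂(freeLaw β (2 * n)), α ∈ {α | muN n α ∉ tightSet (8 * K + 1)} →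
      α ∈ {α | α ∈ cube (2 * n) ∧ |detRoot 1 α| ≤ Real.exp (-(2 * (2 * n : ℕ) * K))} ∪
        {α | α ∈ cube (2 * n) ∧ |detRoot (-1) α| ≤ Real.exp (-(2 * (2 * n : ℕ) * K))} := by
    filter_upwards [ae_mem_goodSet hβ hn] with α hα hmem
    have h1 := norm_det_mul_norm_det_le_of_notMem_tightSet hn hα (by positivity) hmem
    by_contra hcon
    simp only [Set.mem_union, Set.mem_ofPred_eq, hα.1, true_and, not_or, not_le] at hcon
    have e1 := norm_det_eq_detRoot_sq hn (s := 1) (Or.inl rfl) hα.1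
    have e2 := norm_det_eq_detRoot_sq hn (s := -1) (Or.inr rfl) hα.1
    rw [Complex.ofReal_one] at e1
    rw [Complex.ofReal_neg, Complex.ofReal_one] at e2
    rw [e1, e2, ← sq_abs, ← sq_abs (detRoot (-1) α)] at h1
    set x := Real.exp (-(2 * (2 * n : ℕ) * K)) with hx
    have hx0 : 0 < x := Real.exp_pos _
    have h2 : x ^ 2 * x ^ 2 < |detRoot 1 α| ^ 2 * |detRoot (-1) α| ^ 2 := by
      have a1 : x ^ 2 < |detRoot 1 α| ^ 2 := pow_lt_pow_left₀ hcon.1 hx0.le two_ne_zero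
      have a2 : x ^ 2 < |detRoot (-1) α| ^ 2 := pow_lt_pow_left₀ hcon.2 hx0.le two_ne_zero
      exact mul_lt_mul'' a1 a2 (by positivity) (by positivity)
    have h3 : (2 : ℝ) ^ (2 * n) * Real.exp (-(2 * n * (8 * K + 1))) ≤ x ^ 2 * x ^ 2 := by
      have b1 : x ^ 2 * x ^ 2 = Real.exp (2 * n) * Real.exp (-(2 * n * (8 * K + 1))) := by
        rw [hx, ← pow_add, ← Real.exp_nat_mul, ← Real.exp_add]
        congr 1; push_cast; ring
      rw [b1]
      gcongr
      have : Real.exp (2 * (n : ℝ)) = Real.exp 1 ^ (2 * n) := by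
        rw [← Real.exp_nat_mul]; push_cast; ring_nf
      rw [this]
      gcongr
      linarith [Real.add_one_le_exp (1 : ℝ)]
    linarith
  refine (measure_mono_ae hsub).trans ((measure_union_le _ _).trans ?_)
  refine (add_le_add (hKB (2 * n) 1 (by omega) (Or.inl rfl))
    (hKB (2 * n) (-1) (by omega) (Or.inr rfl))).trans ?_
  rw [← two_mul, ← ENNReal.ofReal_ofNat 2, ← ENNReal.ofReal_mul (by norm_num)]
  apply ENNReal.ofReal_le_ofReal
  push_cast
  calc 2 * (B * Real.exp (-(2 * n * (a + 1)))) = 2 * B * Real.exp (-(2 * n * (a + 1))) := by ring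
    _ ≤ Real.exp (2 * n) * Real.exp (-(2 * n * (a + 1))) := by gcongr
    _ = Real.exp (-(2 * n * a)) := by rw [← Real.exp_add]; congr 1; ring

/-! ### Supermultiplicativity -/

/-- The configurations whose moments of order at most `k` are within `c` of the targets `t`. The
moments are not normalised by the size. -/
def momentBox (n k : ℕ) (t : ℕ → ℝ) (c : ℝ) : Set (Fin (2 * n) → ℝ) :=
  {α | ∀ j ≤ k, |traceMoment j α - t j| ≤ c}

lemma measurableSet_momentBox (n k : ℕ) (t : ℕ → ℝ) (c : ℝ) :
    MeasurableSet (momentBox n k t c) := by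
  have : momentBox n k t c
      = ⋂ j ∈ Set.Iic k, {α : Fin (2 * n) → ℝ | |traceMoment j α - t j| ≤ c} := by
    ext; simp [momentBox]
  rw [this]
  refine MeasurableSet.biInter (Set.to_countable _) fun j _ => ?_
  exact (isClosed_le ((continuous_traceMoment j).sub continuous_const).abs
    continuous_const).measurableSet

lemma momentBox_mono {n k : ℕ} {t t' : ℕ → ℝ} {c c' : ℝ}
    (h : ∀ j ≤ k, |t j - t' j| + c ≤ c') : momentBox n k t c ⊆ momentBox n k t' c' := by
  intro α hα j hj
  have h1 := hα j hj
  have h2 := h j hj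
  calc |traceMoment j α - t' j| = |(traceMoment j α - t j) + (t j - t' j)| := by congr 1; ring
    _ ≤ |traceMoment j α - t j| + |t j - t' j| := abs_add_le _ _
    _ ≤ c' := by linarith

lemma measurePreserving_concat {β : ℝ} (hβ : 0 < β) (m n : ℕ) :
    MeasurePreserving (fun α : Fin (2 * (m + n)) → ℝ =>
      ((fun i => α (concatEquiv m n (Sum.inl i)), fun i => α (concatEquiv m n (Sum.inr i))) :
        (Fin (2 * m) → ℝ) × (Fin (2 * n) → ℝ)))
      (freeLaw β (2 * (m + n))) ((freeLaw β (2 * m)).prod (freeLaw β (2 * n))) := by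
  have hprob := isProbabilityMeasure_siteLaw hβ
  have h1 := (measurePreserving_piCongrLeft
    (fun _ : Fin (2 * (m + n)) => siteLaw β) (concatEquiv m n)).symm
  have h2 := measurePreserving_sumPiEquivProdPi
    (fun _ : Fin (2 * m) ⊕ Fin (2 * n) => siteLaw β)
  exact h2.comp h1

/-- Concatenation of independent configurations: the events that the moments are close to given
targets are supermultiplicative. -/
lemma freeLaw_momentBox_mul_le {β : ℝ} (hβ : 0 < β) {m n N : ℕ} (hN : N = m + n) (k : ℕ)
    (t t' : ℕ → ℝ) (c c' : ℝ) :
    freeLaw β (2 * m) (momentBox m k t c) * freeLaw β (2 * n) (momentBox n k t' c')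
      ≤ freeLaw β (2 * N) (momentBox N k (fun j => t j + t' j) (c + c' + 16 * k)) := by
  subst hN
  have h1 := isProbabilityMeasure_freeLaw hβ (2 * m)
  have h2 := isProbabilityMeasure_freeLaw hβ (2 * n)
  rw [← Measure.prod_prod, ← (measurePreserving_concat hβ m n).measure_preimage
    ((measurableSet_momentBox m k t c).prod (measurableSet_momentBox n k t' c')).nullMeasurableSet]
  refine measure_mono_ae ?_
  filter_upwards [ae_mem_cube hβ (2 * (m + n))] with α hα hmem
  obtain ⟨ha, hb⟩ := hmem
  intro j hj
  have e0 := abs_traceMoment_concat_le j hα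
  have e1 := ha j hj
  have e2 := hb j hj
  have e3 : (16 : ℝ) * j ≤ 16 * k := by
    have : (j : ℝ) ≤ k := by exact_mod_cast hj
    linarith
  set u := traceMoment j (fun i => α (concatEquiv m n (Sum.inl i)))
  set v := traceMoment j (fun i => α (concatEquiv m n (Sum.inr i)))
  rw [show traceMoment j α - (t j + t' j)
    = (traceMoment j α - (u + v)) + ((u - t j) + (v - t' j)) by ring]
  have f1 := abs_add_le (traceMoment j α - (u + v)) ((u - t j) + (v - t' j))
  have f2 := abs_add_le (u - t j) (v - t' j)
  change |u - t j| ≤ c at e1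
  change |v - t' j| ≤ c' at e2
  linarith

/-- `q` blocks of size `m`, followed by `r` sites on which the moments are bounded trivially. -/
lemma freeLaw_momentBox_pow_le {β : ℝ} (hβ : 0 < β) (m r k : ℕ) {x : ℕ → ℝ}
    (hx : ∀ j, |x j| ≤ 1) (c : ℝ) (q : ℕ) : ∀ n : ℕ, n = q * m + r →
    freeLaw β (2 * m) (momentBox m k (fun j => 2 * m * x j) c) ^ q
      ≤ freeLaw β (2 * n) (momentBox n k (fun j => 2 * n * x j) (q * (c + 16 * k) + 4 * r)) := by
  induction q with
  | zero =>
    intro n hn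
    have hn' : n = r := by omega
    subst hn'
    have := isProbabilityMeasure_freeLaw hβ (2 * n)
    rw [pow_zero, ← measure_univ (μ := freeLaw β (2 * n))]
    refine measure_mono_ae ?_
    filter_upwards [ae_mem_cube hβ (2 * n)] with α hα _ j _
    have h1 := abs_traceMoment_le j hα
    have h2 : |2 * n * x j| ≤ 2 * n := by
      rw [abs_mul, abs_of_nonneg (by positivity : (0 : ℝ) ≤ 2 * n)]
      exact mul_le_of_le_one_right (by positivity) (hx j)
    have h3 := abs_sub (traceMoment j α) (2 * n * x j)
    push_cast
    linarith
  | succ q ih =>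
    intro n hn
    have h1 := ih (q * m + r) rfl
    rw [pow_succ']
    refine (mul_le_mul_right h1 _).trans ?_
    refine (freeLaw_momentBox_mul_le hβ (N := n) (by rw [hn]; ring) k _ _ _ _).trans ?_
    refine measure_mono (momentBox_mono fun j _ => ?_)
    have e : (2 * m * x j + 2 * ((q * m + r : ℕ) : ℝ) * x j) - 2 * n * x j = 0 := by
      rw [hn]; push_cast; ring
    rw [e, abs_zero]
    push_cast
    linarith

lemma abs_two_mul_chebMoment_sub {n : ℕ} (hn : 1 ≤ n) {α : Fin (2 * n) → ℝ} (hα : α ∈ goodSet n)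
    (j : ℕ) (y : ℝ) :
    |traceMoment j α - 2 * n * y| = 2 * n * |chebMoment (muN n α) j - y| := by
  rw [← two_mul_chebMoment_muN hn hα, ← mul_sub, abs_mul,
    abs_of_nonneg (by positivity : (0 : ℝ) ≤ 2 * n)]

lemma freeLaw_preimage_le_momentBox {β : ℝ} (hβ : 0 < β) {n : ℕ} (hn : 1 ≤ n) (k : ℕ) (x : ℕ → ℝ)
    (ε : ℝ) : freeLaw β (2 * n) (muN n ⁻¹' {ν | ∀ j ≤ k, |chebMoment ν j - x j| < ε})
      ≤ freeLaw β (2 * n) (momentBox n k (fun j => 2 * n * x j) (2 * n * ε)) := by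
  refine measure_mono_ae ?_
  filter_upwards [ae_mem_goodSet hβ hn] with α hα hmem j hj
  rw [abs_two_mul_chebMoment_sub hn hα]
  have := (hmem j hj).le
  gcongr

lemma freeLaw_momentBox_le_preimage {β : ℝ} (hβ : 0 < β) {n : ℕ} (hn : 1 ≤ n) (k : ℕ) (x : ℕ → ℝ)
    (ε : ℝ) {O : Set (ProbabilityMeasure I)}
    (hO : ∀ ν : ProbabilityMeasure I, (∀ j ≤ k, |chebMoment ν j - x j| ≤ ε) → ν ∈ O) :
    freeLaw β (2 * n) (momentBox n k (fun j => 2 * n * x j) (2 * n * ε))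
      ≤ freeLaw β (2 * n) (muN n ⁻¹' O) := by
  have hn' : (0 : ℝ) < n := by exact_mod_cast hn
  refine measure_mono_ae ?_
  filter_upwards [ae_mem_goodSet hβ hn] with α hα hmem
  refine hO _ fun j hj => ?_
  have := hmem j hj
  rw [abs_two_mul_chebMoment_sub hn hα] at this
  exact le_of_mul_le_mul_left this (by positivity)

/-! ### The rate function of the free ensemble -/

/-- `a` is an admissible exponent at `μ` when every neighbourhood of `μ` has, eventually,
probability at least `e^{-2na}`. -/
def IsAdmissible (β : ℝ) (μ : ProbabilityMeasure I) (a : ℝ) : Prop :=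
  ∀ O : Set (ProbabilityMeasure I), IsOpen O → μ ∈ O → ∀ᶠ n : ℕ in atTop,
    ENNReal.ofReal (Real.exp (-(2 * n * a))) ≤ freeLaw β (2 * n) (muN n ⁻¹' O)

/-- The rate function `K_β`: the infimum of the admissible exponents. It is `⊤` if there are none. -/
noncomputable def freeRate (β : ℝ) (μ : ProbabilityMeasure I) : EReal :=
  sInf ((fun a : ℝ => (a : EReal)) '' {a | IsAdmissible β μ a})

lemma IsAdmissible.mono {β : ℝ} {μ : ProbabilityMeasure I} {a b : ℝ} (h : IsAdmissible β μ a)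
    (hab : a ≤ b) : IsAdmissible β μ b := by
  intro O hO hμ
  filter_upwards [h O hO hμ] with n hn
  refine le_trans (ENNReal.ofReal_le_ofReal (Real.exp_le_exp.2 ?_)) hn
  have : 2 * (n : ℝ) * a ≤ 2 * n * b := by gcongr
  linarith

lemma isAdmissible_of_freeRate_lt {β : ℝ} {μ : ProbabilityMeasure I} {a : ℝ}
    (h : freeRate β μ < a) : IsAdmissible β μ a := by
  obtain ⟨_, ⟨b, hb, rfl⟩, hlt⟩ := sInf_lt_iff.1 h
  exact hb.mono (EReal.coe_lt_coe_iff.1 hlt).le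

lemma IsAdmissible.freeRate_le {β : ℝ} {μ : ProbabilityMeasure I} {a : ℝ}
    (h : IsAdmissible β μ a) : freeRate β μ ≤ a :=
  sInf_le ⟨a, h, rfl⟩

/-- By supermultiplicativity, a box of moments whose probability is large for one large number of
sites has, after doubling its size, large probability for every large number of sites. Hence the
upper and the lower exponential rates agree locally. -/
lemma exists_open_le_of_lt_freeRate {β : ℝ} (hβ : 0 < β) {μ : ProbabilityMeasure I} {a : ℝ}
    (h : (a : EReal) < freeRate β μ) : ∃ O : Set (ProbabilityMeasure I), IsOpen O ∧ μ ∈ O ∧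
      ∀ᶠ n : ℕ in atTop,
        freeLaw β (2 * n) (muN n ⁻¹' O) ≤ ENNReal.ofReal (Real.exp (-(2 * n * a))) := by
  rcases lt_or_ge a 0 with ha | ha
  · refine ⟨Set.univ, isOpen_univ, trivial, Filter.Eventually.of_forall fun n => ?_⟩
    have := isProbabilityMeasure_freeLaw hβ (2 * n)
    refine prob_le_one.trans ?_
    rw [← ENNReal.ofReal_one]
    apply ENNReal.ofReal_le_ofReal
    rw [Real.one_le_exp_iff]
    have : (n : ℝ) * a ≤ 0 := mul_nonpos_of_nonneg_of_nonpos (by positivity) ha.le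
    linarith
  have hna : ¬ IsAdmissible β μ a := fun hh => absurd h hh.freeRate_le.not_gt
  simp only [IsAdmissible, not_forall] at hna
  obtain ⟨O, hO, hμO, hfreq⟩ := hna
  obtain ⟨k, ε, hε, hbox⟩ := exists_moment_box_subset hO hμO
  refine ⟨{ν | ∀ j ≤ k, |chebMoment ν j - chebMoment μ j| < ε / 2},
    isOpen_moment_box _ _ _, fun j _ => by simpa using hε, ?_⟩
  -- otherwise the smaller box has probability above `e^{-2ma}` for a size `m` so large that the
  -- error `16 k` of each concatenation is negligible, and cutting `n` into blocks of size `m` makes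
  -- the larger box, and with it `O`, likely for all large `n`
  by_contra hcon
  apply hfreq
  rw [not_eventually] at hcon
  obtain ⟨m, hm, hmlarge⟩ := (hcon.and_eventually
    ((eventually_ge_atTop 1).and (tendsto_natCast_atTop_atTop.eventually_ge_atTop
      (32 * (k : ℝ) / ε)))).exists
  obtain ⟨hm1, hm2⟩ := hmlarge
  have hm1' : (0 : ℝ) < m := by exact_mod_cast hm1
  rw [div_le_iff₀ hε] at hm2
  filter_upwards [eventually_ge_atTop 1, tendsto_natCast_atTop_atTop.eventually_ge_atTop
    (8 * (m : ℝ) / ε)] with n hn1 hn2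
  have hn1' : (0 : ℝ) < n := by exact_mod_cast hn1
  rw [div_le_iff₀ hε] at hn2
  have hdiv : n = n / m * m + n % m := by rw [mul_comm]; exact (Nat.div_add_mod n m).symm
  have hdivR : (n : ℝ) = (n / m : ℕ) * m + (n % m : ℕ) := by exact_mod_cast hdiv
  have hr : ((n % m : ℕ) : ℝ) ≤ m := by exact_mod_cast (Nat.mod_lt n hm1).le
  have hr0 : (0 : ℝ) ≤ ((n % m : ℕ) : ℝ) := by positivity
  set q := n / m
  set r := n % m
  have hq0 : (0 : ℝ) ≤ q := by positivity
  have hstep := freeLaw_momentBox_pow_le hβ m r k (abs_chebMoment_le_one μ) (2 * m * (ε / 2)) q n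
    hdiv
  have hlow : ENNReal.ofReal (Real.exp (-(2 * n * a)))
      ≤ freeLaw β (2 * m) (momentBox m k (fun j => 2 * m * chebMoment μ j) (2 * m * (ε / 2))) ^ q := by
    have h1 := (not_le.1 hm).le.trans (freeLaw_preimage_le_momentBox hβ hm1 k _ (ε / 2))
    refine le_trans ?_ (pow_le_pow_left' h1 q)
    rw [← ENNReal.ofReal_pow (Real.exp_pos _).le, ← Real.exp_nat_mul]
    apply ENNReal.ofReal_le_ofReal
    rw [Real.exp_le_exp, hdivR]
    nlinarith [mul_nonneg hr0 ha]
  refine hlow.trans (hstep.trans ?_)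
  refine le_trans (measure_mono (momentBox_mono fun j _ => ?_))
    (freeLaw_momentBox_le_preimage hβ hn1 k (chebMoment μ) ε hbox)
  rw [sub_self, abs_zero, zero_add]
  have e1 : (q : ℝ) * m ≤ n := by linarith
  have e2 : (q : ℝ) * (16 * k) ≤ n * ε / 2 := by
    have : (q : ℝ) * (32 * k) ≤ q * (m * ε) := by gcongr
    nlinarith
  nlinarith

/-! ### Convexity -/

lemma chebMoment_of_mix {s t : NNReal} {μ ν ξ : ProbabilityMeasure I}
    (h : (ξ : Measure I) = s • (μ : Measure I) + t • (ν : Measure I)) (k : ℕ) :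
    chebMoment ξ k = s * chebMoment μ k + t * chebMoment ν k := by
  unfold chebMoment
  have hi : ∀ ρ : ProbabilityMeasure I, Integrable
      (fun x : I => (Polynomial.Chebyshev.T ℝ k).eval (x : ℝ)) (ρ : Measure I) :=
    fun ρ => integrable_polynomial ρ _
  rw [h, integral_add_measure ((hi μ).smul_measure_nnreal) ((hi ν).smul_measure_nnreal),
    integral_smul_nnreal_measure, integral_smul_nnreal_measure]
  rfl

/-- Configurations of size about `s n` near `μ` and of size about `t n` near `ν` concatenate to
configurations of size `n` near the mixture. -/
lemma isAdmissible_mix {β : ℝ} (hβ : 0 < β) {s t : NNReal} (hs : 0 < s) (ht : 0 < t)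
    (hst : s + t = 1) {μ ν ξ : ProbabilityMeasure I}
    (h : (ξ : Measure I) = s • (μ : Measure I) + t • (ν : Measure I)) {a b c : ℝ}
    (ha : IsAdmissible β μ a) (hb : IsAdmissible β ν b) (hc : s * a + t * b < c) :
    IsAdmissible β ξ c := by
  intro O hO hξ
  obtain ⟨k, ε, hε, hbox⟩ := exists_moment_box_subset hO hξ
  have hst' : (s : ℝ) + t = 1 := by exact_mod_cast hst
  have hs' : (0 : ℝ) < s := by exact_mod_cast hs
  have ht' : (0 : ℝ) < t := by exact_mod_cast ht
  have hfl : Tendsto (fun n : ℕ => ⌊(s : ℝ) * n⌋₊) atTop atTop :=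
    tendsto_nat_floor_atTop.comp (tendsto_natCast_atTop_atTop.const_mul_atTop hs')
  have hfl_le : ∀ n : ℕ, ⌊(s : ℝ) * n⌋₊ ≤ n := fun n => by
    apply Nat.floor_le_of_le
    have : (s : ℝ) ≤ 1 := by linarith
    exact mul_le_of_le_one_left (by positivity) this
  have hsub_ge : ∀ n : ℕ, (t : ℝ) * n ≤ ((n - ⌊(s : ℝ) * n⌋₊ : ℕ) : ℝ) := fun n => by
    rw [Nat.cast_sub (hfl_le n)]
    have := Nat.floor_le (show 0 ≤ (s : ℝ) * n by positivity)
    nlinarith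
  have hfl2 : Tendsto (fun n : ℕ => n - ⌊(s : ℝ) * n⌋₊) atTop atTop := by
    rw [← tendsto_natCast_atTop_iff (R := ℝ)]
    exact tendsto_atTop_mono hsub_ge (tendsto_natCast_atTop_atTop.const_mul_atTop ht')
  have e1 := hfl.eventually ((eventually_ge_atTop 1).and (ha _
    (isOpen_moment_box (chebMoment μ) k (ε / 2)) fun j _ => by simpa using hε))
  have e2 := hfl2.eventually ((eventually_ge_atTop 1).and (hb _
    (isOpen_moment_box (chebMoment ν) k (ε / 2)) fun j _ => by simpa using hε))
  filter_upwards [e1, e2, tendsto_natCast_atTop_atTop.eventually_ge_atTop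
    ((16 * (k : ℝ) + 4) / ε), tendsto_natCast_atTop_atTop.eventually_ge_atTop
    ((|a| + |b|) / (c - (s * a + t * b))), eventually_ge_atTop 1] with n h1 h2 h3 h4 hn
  rw [div_le_iff₀ hε] at h3
  rw [div_le_iff₀ (by linarith)] at h4
  have hfloor1 := Nat.floor_le (show 0 ≤ (s : ℝ) * n by positivity)
  have hfloor2 := Nat.lt_floor_add_one ((s : ℝ) * n)
  have hsum : n = ⌊(s : ℝ) * n⌋₊ + (n - ⌊(s : ℝ) * n⌋₊) := (Nat.add_sub_cancel' (hfl_le n)).symm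
  have hsumR : (n : ℝ) = (⌊(s : ℝ) * n⌋₊ : ℝ) + ((n - ⌊(s : ℝ) * n⌋₊ : ℕ) : ℝ) := by
    exact_mod_cast hsum
  set p := ⌊(s : ℝ) * n⌋₊
  set q := n - p
  have hmul := freeLaw_momentBox_mul_le hβ hsum k (fun j => 2 * p * chebMoment μ j)
    (fun j => 2 * q * chebMoment ν j) (2 * p * (ε / 2)) (2 * q * (ε / 2))
  have g1 := h1.2.trans (freeLaw_preimage_le_momentBox hβ h1.1 k _ (ε / 2))
  have g2 := h2.2.trans (freeLaw_preimage_le_momentBox hβ h2.1 k _ (ε / 2))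
  have hlow : ENNReal.ofReal (Real.exp (-(2 * n * c)))
      ≤ ENNReal.ofReal (Real.exp (-(2 * p * a))) * ENNReal.ofReal (Real.exp (-(2 * q * b))) := by
    rw [← ENNReal.ofReal_mul (Real.exp_pos _).le, ← Real.exp_add]
    apply ENNReal.ofReal_le_ofReal
    rw [Real.exp_le_exp]
    have d1 : p * a + q * b = n * (s * a + t * b) + (p - s * n) * (a - b) := by
      have : (q : ℝ) = n - p := by linarith
      have ht2 : (t : ℝ) = 1 - s := by linarith
      rw [this, ht2]; ring
    have d2 : (p - s * n) * (a - b) ≤ |a| + |b| := by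
      calc (p - s * n) * (a - b) ≤ |(p - s * n) * (a - b)| := le_abs_self _
        _ = |(p : ℝ) - s * n| * |a - b| := abs_mul _ _
        _ ≤ 1 * |a - b| := by
            gcongr
            rw [abs_le]
            constructor <;> linarith
        _ ≤ |a| + |b| := by rw [one_mul]; exact abs_sub _ _
    nlinarith
  refine hlow.trans ((mul_le_mul' g1 g2).trans (hmul.trans ?_))
  refine le_trans (measure_mono (momentBox_mono fun j _ => ?_))
    (freeLaw_momentBox_le_preimage hβ hn k (chebMoment ξ) ε hbox)
  have d3 : 2 * p * chebMoment μ j + 2 * q * chebMoment ν j - 2 * n * chebMoment ξ j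
      = 2 * ((p - s * n) * (chebMoment μ j - chebMoment ν j)) := by
    have : (q : ℝ) = n - p := by linarith
    have ht2 : (t : ℝ) = 1 - s := by linarith
    rw [chebMoment_of_mix h, this, ht2]; ring
  have d4 : |(p - s * n) * (chebMoment μ j - chebMoment ν j)| ≤ 2 := by
    rw [abs_mul]
    calc |(p : ℝ) - s * n| * |chebMoment μ j - chebMoment ν j| ≤ 1 * 2 := by
          gcongr
          · rw [abs_le]
            constructor <;> linarith
          · have := abs_sub (chebMoment μ j) (chebMoment ν j)
            have := abs_chebMoment_le_one μ j
            have := abs_chebMoment_le_one ν j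
            linarith
      _ = 2 := by norm_num
  rw [d3, abs_mul, abs_two]
  have d5 : 2 * (p : ℝ) * (ε / 2) + 2 * q * (ε / 2) = n * ε := by
    rw [hsumR]; ring
  linarith

/-! ### From local estimates to a large deviations principle -/

section LDP

variable {E : Type*} [TopologicalSpace E] {Ω : ℕ → Type*} [∀ n, MeasurableSpace (Ω n)]
  {P : ∀ n, Measure (Ω n)} {X : ∀ n, Ω n → E} {J : E → EReal}

lemma neg_le_log_div {n : ℕ} (hn : 1 ≤ n) {p : ℝ≥0∞} {a : ℝ}
    (h : ENNReal.ofReal (Real.exp (-(2 * n * a))) ≤ p) :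
    ((-a : ℝ) : EReal) ≤ ENNReal.log p / ((2 * (n : ℝ) : ℝ) : EReal) := by
  have hn' : (0 : ℝ) < 2 * n := by positivity
  rw [EReal.le_div_iff_mul_le (by exact_mod_cast hn') (EReal.coe_ne_top _), ← EReal.coe_mul]
  have := ENNReal.log_monotone h
  rw [ENNReal.log_ofReal_of_pos (Real.exp_pos _), Real.log_exp] at this
  rwa [show -a * (2 * (n : ℝ)) = -(2 * n * a) by ring]

lemma log_div_le_neg {n : ℕ} (hn : 1 ≤ n) {p : ℝ≥0∞} {a : ℝ}
    (h : p ≤ ENNReal.ofReal (Real.exp (-(2 * n * a)))) :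
    ENNReal.log p / ((2 * (n : ℝ) : ℝ) : EReal) ≤ ((-a : ℝ) : EReal) := by
  have hn' : (0 : ℝ) < 2 * n := by positivity
  rw [EReal.div_le_iff_le_mul (by exact_mod_cast hn') (EReal.coe_ne_top _), ← EReal.coe_mul]
  have := ENNReal.log_monotone h
  rw [ENNReal.log_ofReal_of_pos (Real.exp_pos _), Real.log_exp] at this
  rwa [show 2 * (n : ℝ) * -a = -(2 * n * a) by ring]

lemma eventually_const_mul_exp_le (B : ℝ) {a b : ℝ} (hab : a < b) : ∀ᶠ n : ℕ in atTop,
    B * Real.exp (-(2 * n * b)) ≤ Real.exp (-(2 * n * a)) := by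
  have : Tendsto (fun n : ℕ => Real.exp (2 * (b - a) * (n : ℝ))) atTop atTop :=
    Real.tendsto_exp_atTop.comp (tendsto_natCast_atTop_atTop.const_mul_atTop (by linarith))
  filter_upwards [this.eventually_ge_atTop B] with n hn
  calc B * Real.exp (-(2 * n * b)) ≤ Real.exp (2 * (b - a) * n) * Real.exp (-(2 * n * b)) := by
        gcongr
    _ = Real.exp (-(2 * n * a)) := by rw [← Real.exp_add]; congr 1; ring

/-- Exponents of a lower and an upper bound for the same probabilities compare. -/
lemma le_of_eventually_exp_le {p : ℕ → ℝ≥0∞} {a b : ℝ}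
    (h1 : ∀ᶠ n : ℕ in atTop, ENNReal.ofReal (Real.exp (-(2 * n * b))) ≤ p n)
    (h2 : ∀ᶠ n : ℕ in atTop, p n ≤ ENNReal.ofReal (Real.exp (-(2 * n * a)))) : a ≤ b := by
  obtain ⟨n, hn1, hn2, hn⟩ := (h1.and (h2.and (eventually_ge_atTop 1))).exists
  have h3 := (ENNReal.ofReal_le_ofReal_iff (Real.exp_pos _).le).1 (hn1.trans hn2)
  rw [Real.exp_le_exp] at h3
  have hn' : (0 : ℝ) < 2 * n := by positivity
  have : 2 * (n : ℝ) * a ≤ 2 * n * b := by linarith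
  exact le_of_mul_le_mul_left this hn'

/-- The upper bound for closed sets: the part in a compact set has a finite cover by neighbourhoods
with the local bound, and exponential tightness takes care of the rest. -/
lemma eventually_measure_closed_le
    (hup : ∀ (x : E) (a : ℝ), (a : EReal) < J x → ∃ O : Set E, IsOpen O ∧ x ∈ O ∧
      ∀ᶠ n : ℕ in atTop, P n (X n ⁻¹' O) ≤ ENNReal.ofReal (Real.exp (-(2 * n * a))))
    (htight : ∀ a : ℝ, ∃ C : Set E, IsCompact C ∧
      ∀ᶠ n : ℕ in atTop, P n (X n ⁻¹' Cᶜ) ≤ ENNReal.ofReal (Real.exp (-(2 * n * a))))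
    {F : Set E} (hF : IsClosed F) {a : ℝ} (ha : (a : EReal) < ⨅ x ∈ F, J x) :
    ∀ᶠ n : ℕ in atTop, P n (X n ⁻¹' F) ≤ ENNReal.ofReal (Real.exp (-(2 * n * a))) := by
  obtain ⟨b, hab, hb⟩ := EReal.lt_iff_exists_real_btwn.1 ha
  obtain ⟨C, hC, hCb⟩ := htight b
  have hcov : ∃ k : ℕ, ∀ᶠ n : ℕ in atTop,
      P n (X n ⁻¹' (F ∩ C)) ≤ k * ENNReal.ofReal (Real.exp (-(2 * n * b))) := by
    refine (hC.inter_left hF).induction_on (p := fun S => ∃ k : ℕ, ∀ᶠ n : ℕ in atTop,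
      P n (X n ⁻¹' S) ≤ k * ENNReal.ofReal (Real.exp (-(2 * n * b)))) ⟨0, by simp⟩ ?_ ?_ ?_
    · rintro S T hST ⟨k, hk⟩
      refine ⟨k, ?_⟩
      filter_upwards [hk] with n hn
      exact (measure_mono (Set.preimage_mono hST)).trans hn
    · rintro S T ⟨k, hk⟩ ⟨l, hl⟩
      refine ⟨k + l, ?_⟩
      filter_upwards [hk, hl] with n h1 h2
      rw [Set.preimage_union]
      refine (measure_union_le _ _).trans ((add_le_add h1 h2).trans (le_of_eq ?_))
      push_cast
      ring
    · intro x hx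
      obtain ⟨O, hO, hxO, hOb⟩ := hup x b (hb.trans_le (iInf₂_le x hx.1))
      exact ⟨O, mem_nhdsWithin_of_mem_nhds (hO.mem_nhds hxO), 1, by simpa using hOb⟩
  obtain ⟨k, hk⟩ := hcov
  filter_upwards [hk, hCb, eventually_const_mul_exp_le (k + 1 : ℝ) (EReal.coe_lt_coe_iff.1 hab)]
    with n h1 h2 h3
  have hsub : X n ⁻¹' F ⊆ X n ⁻¹' (F ∩ C) ∪ X n ⁻¹' Cᶜ := by
    intro ω hω
    by_cases h : X n ω ∈ C
    · exact Or.inl ⟨hω, h⟩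
    · exact Or.inr h
  refine (measure_mono hsub).trans ((measure_union_le _ _).trans ((add_le_add h1 h2).trans ?_))
  refine le_trans (le_of_eq ?_) (ENNReal.ofReal_le_ofReal h3)
  rw [ENNReal.ofReal_mul (by positivity), ENNReal.ofReal_add (by positivity) zero_le_one,
    ENNReal.ofReal_natCast, ENNReal.ofReal_one, add_mul, one_mul]

/-- Local lower and upper bounds with the same rate, together with exponential tightness, give the
full principle; that the sublevel sets are compact is a consequence. -/
lemma satisfiesLDP_of_local [T2Space E]
    (hP : ∀ᶠ n : ℕ in atTop, P n Set.univ ≤ 1)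
    (hlow : ∀ (x : E) (a : ℝ), J x < a → ∀ O : Set E, IsOpen O → x ∈ O →
      ∀ᶠ n : ℕ in atTop, ENNReal.ofReal (Real.exp (-(2 * n * a))) ≤ P n (X n ⁻¹' O))
    (hup : ∀ (x : E) (a : ℝ), (a : EReal) < J x → ∃ O : Set E, IsOpen O ∧ x ∈ O ∧
      ∀ᶠ n : ℕ in atTop, P n (X n ⁻¹' O) ≤ ENNReal.ofReal (Real.exp (-(2 * n * a))))
    (htight : ∀ a : ℝ, ∃ C : Set E, IsCompact C ∧
      ∀ᶠ n : ℕ in atTop, P n (X n ⁻¹' Cᶜ) ≤ ENNReal.ofReal (Real.exp (-(2 * n * a)))) :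
    SatisfiesLDP P X (fun n => 2 * (n : ℝ)) J where
  nonneg x := by
    by_contra! hneg
    obtain ⟨a, ha, ha0⟩ := EReal.lt_iff_exists_real_btwn.1 hneg
    have h1 := hlow x a ha Set.univ isOpen_univ trivial
    have h2 : ∀ᶠ n : ℕ in atTop, P n (X n ⁻¹' Set.univ)
        ≤ ENNReal.ofReal (Real.exp (-(2 * n * 0))) := by
      filter_upwards [hP] with n hn
      simpa using hn
    have h3 := le_of_eventually_exp_le h1 h2
    have h4 : a < 0 := by exact_mod_cast ha0
    linarith
  good c := by
    have hclosed : IsClosed {x | J x ≤ (c : EReal)} := by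
      rw [← isOpen_compl_iff, isOpen_iff_forall_mem_open]
      intro x hx
      have hx' : (c : EReal) < J x := not_le.1 hx
      obtain ⟨a, hca, hax⟩ := EReal.lt_iff_exists_real_btwn.1 hx'
      obtain ⟨O, hO, hxO, hOa⟩ := hup x a hax
      refine ⟨O, fun y hy hyc => ?_, hO, hxO⟩
      obtain ⟨b, hcb, hba⟩ := EReal.lt_iff_exists_real_btwn.1 hca
      have h1 := hlow y b (lt_of_le_of_lt hyc hcb) O hO hy
      have h2 := le_of_eventually_exp_le h1 hOa
      have h3 : b < a := by exact_mod_cast hba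
      linarith
    obtain ⟨C, hC, hCa⟩ := htight (c + 2)
    refine hC.of_isClosed_subset hclosed fun y hy => ?_
    by_contra hyC
    have h1 := hlow y (c + 1) (lt_of_le_of_lt hy (by exact_mod_cast lt_add_one c)) Cᶜ
      hC.isClosed.isOpen_compl hyC
    have h2 := le_of_eventually_exp_le h1 hCa
    linarith
  lower O hO := by
    rw [EReal.neg_le]
    refine le_iInf₂ fun x hx => ?_
    by_contra! hcon
    obtain ⟨a, ha, ha'⟩ := EReal.lt_iff_exists_real_btwn.1 hcon
    have h1 : ((-a : ℝ) : EReal)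
        ≤ liminf (fun n => ENNReal.log (P n (X n ⁻¹' O)) / ((2 * (n : ℝ) : ℝ) : EReal)) atTop := by
      refine le_liminf_of_le (by isBoundedDefault) ?_
      filter_upwards [hlow x a ha O hO hx, eventually_ge_atTop 1] with n h1 hn
      exact neg_le_log_div hn h1
    rw [EReal.coe_neg, EReal.neg_le] at h1
    exact absurd (ha'.trans_le h1) (lt_irrefl _)
  upper F hF := by
    rw [EReal.le_neg]
    by_contra! hcon
    obtain ⟨a, ha, ha'⟩ := EReal.lt_iff_exists_real_btwn.1 hcon
    have h1 : limsup (fun n => ENNReal.log (P n (X n ⁻¹' F)) / ((2 * (n : ℝ) : ℝ) : EReal)) atTop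
        ≤ ((-a : ℝ) : EReal) := by
      refine limsup_le_of_le (by isBoundedDefault) ?_
      filter_upwards [eventually_measure_closed_le hup htight hF ha', eventually_ge_atTop 1]
        with n h1 hn
      exact log_div_le_neg hn h1
    rw [EReal.coe_neg, EReal.le_neg] at h1
    exact absurd (ha.trans_le h1) (lt_irrefl _)

end LDP

/-! ### The ensemble as a tilted product law -/

/-- The moments of `muN` agree almost surely with continuous functions of the coefficients. -/
lemma nullMeasurableSet_preimage_muN {β : ℝ} (hβ : 0 < β) {n : ℕ} (hn : 1 ≤ n)
    {O : Set (ProbabilityMeasure I)} (hO : IsOpen O) :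
    NullMeasurableSet (muN n ⁻¹' O) (freeLaw β (2 * n)) := by
  obtain ⟨W, hW, rfl⟩ := isInducing_chebMoment.isOpen_iff.1 hO
  set m : (Fin (2 * n) → ℝ) → ℕ → ℝ := fun α k => traceMoment k α / (2 * n) with hm
  have hmc : Continuous m := continuous_pi fun k => (continuous_traceMoment k).div_const _
  refine (hW.preimage hmc).measurableSet.nullMeasurableSet.congr ?_
  have hn' : (n : ℝ) ≠ 0 := by exact_mod_cast (by omega : n ≠ 0)
  filter_upwards [ae_mem_goodSet hβ hn] with α hα
  have e : m α = chebMoment (muN n α) := by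
    ext k
    simp only [hm]
    rw [← two_mul_chebMoment_muN hn hα]
    field_simp
  change (m α ∈ W) = (chebMoment (muN n α) ∈ W)
  rw [e]

/-- The potential energy `∫ V dμ`. -/
noncomputable def energy (V : ℝ → ℝ) (μ : ProbabilityMeasure I) : ℝ :=
  ∫ x : I, V x ∂(μ : Measure I)

/-- A bounded continuous function on `I`, bundled. -/
noncomputable def bundled {V : ℝ → ℝ} (hV : ContinuousOn V I) {C : ℝ} (hC : ∀ x ∈ I, |V x| ≤ C) :
    BoundedContinuousFunction I ℝ :=
  BoundedContinuousFunction.ofNormedAddCommGroup (fun x : I => V x)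
    (continuousOn_iff_continuous_domRestrict.1 hV) C fun x => hC x x.2

lemma continuous_energy {V : ℝ → ℝ} (hV : ContinuousOn V I) {C : ℝ} (hC : ∀ x ∈ I, |V x| ≤ C) :
    Continuous (energy V) :=
  ProbabilityMeasure.continuous_integral_boundedContinuousFunction (bundled hV hC)

lemma abs_energy_le {V : ℝ → ℝ} {C : ℝ} (hC : ∀ x ∈ I, |V x| ≤ C) (μ : ProbabilityMeasure I) :
    |energy V μ| ≤ C := by
  have := norm_integral_le_of_norm_le_const (μ := (μ : Measure I)) (f := fun x : I => V x)
    (Filter.Eventually.of_forall fun x => hC x x.2)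
  simpa [energy] using this

/-- The density of the ensemble with respect to the free one, up to normalisation. -/
noncomputable def tilt (V : ℝ → ℝ) {N : ℕ} (α : Fin N → ℝ) : ℝ≥0∞ :=
  ENNReal.ofReal (Real.exp (-traceV V α))

lemma tilt_eq {n : ℕ} (hn : 1 ≤ n) {α : Fin (2 * n) → ℝ} (hα : α ∈ goodSet n) (V : ℝ → ℝ) :
    tilt V α = ENNReal.ofReal (Real.exp (-(2 * n * energy V (muN n α)))) := by
  rw [tilt, traceV_eq hn hα]; rfl

lemma aemeasurable_tilt {β : ℝ} (hβ : 0 < β) {V : ℝ → ℝ} (hV : ContinuousOn V I) {C : ℝ}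
    (hC : ∀ x ∈ I, |V x| ≤ C) {n : ℕ} (hn : 1 ≤ n) :
    AEMeasurable (tilt V) (freeLaw β (2 * n)) := by
  have h1 : NullMeasurable (fun α => energy V (muN n α)) (freeLaw β (2 * n)) := by
    have : @Measurable (NullMeasurableSpace (Fin (2 * n) → ℝ) (freeLaw β (2 * n))) ℝ _ _
        (fun α => energy V (muN n α)) :=
      measurable_of_isOpen fun s hs =>
        nullMeasurableSet_preimage_muN hβ hn (hs.preimage (continuous_energy hV hC))
    exact this
  have h2 : AEMeasurable (fun α => energy V (muN n α)) (freeLaw β (2 * n)) := h1.aemeasurable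
  have h3 : AEMeasurable (fun α => ENNReal.ofReal (Real.exp (-(2 * n * energy V (muN n α)))))
      (freeLaw β (2 * n)) :=
    ((h2.const_mul _).neg.exp).ennreal_ofReal
  refine h3.congr ?_
  filter_upwards [ae_mem_goodSet hβ hn] with α hα
  rw [tilt_eq hn hα]

/-- The tilted, unnormalised law. -/
noncomputable def tiltedLaw (β : ℝ) (V : ℝ → ℝ) (N : ℕ) : Measure (Fin N → ℝ) :=
  (freeLaw β N).withDensity (tilt V)

lemma gge_eq {β : ℝ} (hβ : 0 < β) (V : ℝ → ℝ) (N : ℕ)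
    (hV : AEMeasurable (tilt V) (freeLaw β N)) :
    gge β V N = (tiltedLaw β V N Set.univ)⁻¹ • tiltedLaw β V N := by
  have hfin := isFiniteMeasure_siteMeasure hβ
  set Z := siteMeasure β Set.univ ^ N with hZ
  have hZ0 : Z ≠ 0 := pow_ne_zero _ (siteMeasure_univ_ne_zero β)
  have hZt : Z ≠ ∞ := ENNReal.pow_ne_top (measure_ne_top _ _)
  set w : (Fin N → ℝ) → ℝ≥0∞ := fun α => ∏ j, siteDensity β (α j) with hw
  have hwm : Measurable w :=
    Finset.measurable_prod _ fun j _ => (measurable_siteDensity β).comp (measurable_pi_apply j)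
  have hfree : (volume.restrict (cube N)).withDensity w = Z • freeLaw β N := withDensity_cube_eq hβ N
  have hac : volume.restrict (cube N) ≪ Z • freeLaw β N := by
    rw [← hfree]
    refine withDensity_absolutelyContinuous' hwm.aemeasurable ?_
    filter_upwards [ae_restrict_mem (measurableSet_cube N)] with α hα
    refine Finset.prod_ne_zero_iff.2 fun j _ => ?_
    have h0 : 0 < 1 - α j ^ 2 := by nlinarith [(hα j).1, (hα j).2]
    simpa [siteDensity] using Real.rpow_pos_of_pos h0 (β - 1)
  have hgm : AEMeasurable (tilt V) (volume.restrict (cube N)) :=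
    (hV.smul_measure Z).mono_ac hac
  have hweight : (volume.restrict (cube N)).withDensity (weight β V) = Z • tiltedLaw β V N := by
    have h1 : weight β V =ᵐ[volume.restrict (cube N)] w * tilt V := by
      filter_upwards [ae_restrict_mem (measurableSet_cube N)] with α hα
      have h0 : ∀ j, 0 ≤ (1 - α j ^ 2) ^ (β - 1) := fun j =>
        Real.rpow_nonneg (by nlinarith [(hα j).1, (hα j).2]) _
      rw [weight, ENNReal.ofReal_mul (Finset.prod_nonneg fun j _ => h0 j),
        ENNReal.ofReal_prod_of_nonneg fun j _ => h0 j]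
      rfl
    rw [withDensity_congr_ae h1, withDensity_mul₀ hwm.aemeasurable hgm, hfree,
      withDensity_smul_measure]
    rfl
  have hpart : partitionFunction β V N = Z * tiltedLaw β V N Set.univ := by
    have h2 : partitionFunction β V N
        = (volume.restrict (cube N)).withDensity (weight β V) Set.univ := by
      rw [withDensity_apply _ MeasurableSet.univ, Measure.restrict_univ]; rfl
    rw [h2, hweight]; rfl
  rw [gge, hpart, hweight, smul_smul, ENNReal.mul_inv (Or.inl hZ0) (Or.inl hZt), mul_right_comm,
    ENNReal.inv_mul_cancel hZ0 hZt, one_mul]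

lemma gge_zero_eq {β : ℝ} (hβ : 0 < β) (N : ℕ) : gge β (fun _ => 0) N = freeLaw β N := by
  have hprob := isProbabilityMeasure_freeLaw hβ N
  have h1 : (tilt (fun _ => 0) : (Fin N → ℝ) → ℝ≥0∞) = fun _ => 1 := by
    ext α
    simp [tilt, traceV]
  have h2 : tiltedLaw β (fun _ => 0) N = freeLaw β N := by
    rw [tiltedLaw, h1]
    exact withDensity_one
  rw [gge_eq hβ _ _ (by rw [h1]; exact aemeasurable_const), h2, measure_univ, inv_one, one_smul]

lemma tiltedLaw_le {β : ℝ} (hβ : 0 < β) (V : ℝ → ℝ) {n : ℕ} (hn : 1 ≤ n)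
    {O : Set (ProbabilityMeasure I)} (hO : IsOpen O) {v : ℝ} (hv : ∀ μ ∈ O, v ≤ energy V μ) :
    tiltedLaw β V (2 * n) (muN n ⁻¹' O)
      ≤ ENNReal.ofReal (Real.exp (-(2 * n * v))) * freeLaw β (2 * n) (muN n ⁻¹' O) := by
  have hprob := isProbabilityMeasure_freeLaw hβ (2 * n)
  rw [tiltedLaw, withDensity_apply', ← setLIntegral_const]
  refine lintegral_mono_ae ?_
  refine (ae_restrict_iff'₀ (nullMeasurableSet_preimage_muN hβ hn hO)).2 ?_
  filter_upwards [ae_mem_goodSet hβ hn] with α hα hmem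
  rw [tilt_eq hn hα]
  apply ENNReal.ofReal_le_ofReal
  rw [Real.exp_le_exp]
  have : 2 * (n : ℝ) * v ≤ 2 * n * energy V (muN n α) := by
    have := hv _ hmem
    gcongr
  linarith

lemma le_tiltedLaw {β : ℝ} (hβ : 0 < β) (V : ℝ → ℝ) {n : ℕ} (hn : 1 ≤ n)
    {O : Set (ProbabilityMeasure I)} (hO : IsOpen O) {v : ℝ} (hv : ∀ μ ∈ O, energy V μ ≤ v) :
    ENNReal.ofReal (Real.exp (-(2 * n * v))) * freeLaw β (2 * n) (muN n ⁻¹' O)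
      ≤ tiltedLaw β V (2 * n) (muN n ⁻¹' O) := by
  have hprob := isProbabilityMeasure_freeLaw hβ (2 * n)
  rw [tiltedLaw, withDensity_apply', ← setLIntegral_const]
  refine lintegral_mono_ae ?_
  refine (ae_restrict_iff'₀ (nullMeasurableSet_preimage_muN hβ hn hO)).2 ?_
  filter_upwards [ae_mem_goodSet hβ hn] with α hα hmem
  rw [tilt_eq hn hα]
  apply ENNReal.ofReal_le_ofReal
  rw [Real.exp_le_exp]
  have : 2 * (n : ℝ) * energy V (muN n α) ≤ 2 * n * v := by
    have := hv _ hmem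
    gcongr
  linarith

lemma tiltedLaw_univ_ne {β : ℝ} (hβ : 0 < β) {V : ℝ → ℝ} {C : ℝ} (hC : ∀ x ∈ I, |V x| ≤ C) {n : ℕ}
    (hn : 1 ≤ n) : tiltedLaw β V (2 * n) Set.univ ≠ 0 ∧ tiltedLaw β V (2 * n) Set.univ ≠ ∞ := by
  have hprob := isProbabilityMeasure_freeLaw hβ (2 * n)
  have h1 := tiltedLaw_le hβ V hn isOpen_univ (v := -C) fun μ _ =>
    (abs_le.1 (abs_energy_le hC μ)).1
  have h2 := le_tiltedLaw hβ V hn isOpen_univ (v := C) fun μ _ =>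
    (abs_le.1 (abs_energy_le hC μ)).2
  rw [Set.preimage_univ, measure_univ (μ := freeLaw β (2 * n)), mul_one] at h1 h2
  exact ⟨(lt_of_lt_of_le (ENNReal.ofReal_pos.2 (Real.exp_pos _)) h2).ne',
    (h1.trans_lt ENNReal.ofReal_lt_top).ne⟩

lemma isProbabilityMeasure_gge {β : ℝ} (hβ : 0 < β) {V : ℝ → ℝ} (hV : ContinuousOn V I) {C : ℝ}
    (hC : ∀ x ∈ I, |V x| ≤ C) {n : ℕ} (hn : 1 ≤ n) :
    IsProbabilityMeasure (gge β V (2 * n)) := by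
  obtain ⟨h0, ht⟩ := tiltedLaw_univ_ne hβ hC hn
  rw [gge_eq hβ V _ (aemeasurable_tilt hβ hV hC hn)]
  constructor
  rw [Measure.smul_apply, smul_eq_mul, ENNReal.inv_mul_cancel h0 ht]

lemma gge_absolutelyContinuous {β : ℝ} (hβ : 0 < β) {V : ℝ → ℝ} (hV : ContinuousOn V I) {C : ℝ}
    (hC : ∀ x ∈ I, |V x| ≤ C) {n : ℕ} (hn : 1 ≤ n) : gge β V (2 * n) ≪ freeLaw β (2 * n) := by
  rw [gge_eq hβ V _ (aemeasurable_tilt hβ hV hC hn)]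
  exact Measure.smul_absolutelyContinuous.trans (withDensity_absolutelyContinuous _ _)

/-! ### Large deviations of the free and of the tilted ensemble -/

lemma exists_compact_freeLaw_le {β : ℝ} (hβ : 0 < β) (a : ℝ) :
    ∃ C : Set (ProbabilityMeasure I), IsCompact C ∧ ∀ᶠ n : ℕ in atTop,
      freeLaw β (2 * n) (muN n ⁻¹' Cᶜ) ≤ ENNReal.ofReal (Real.exp (-(2 * n * a))) := by
  obtain ⟨M, hM⟩ := exists_freeLaw_tightSet_le hβ a
  exact ⟨tightSet M, isCompact_tightSet M, hM⟩

lemma satisfiesLDP_freeLaw {β : ℝ} (hβ : 0 < β) :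
    SatisfiesLDP (fun n => freeLaw β (2 * n)) muN (fun n => 2 * (n : ℝ)) (freeRate β) := by
  refine satisfiesLDP_of_local (Filter.Eventually.of_forall fun n => ?_)
    (fun x a hx O hO hxO => isAdmissible_of_freeRate_lt hx O hO hxO)
    (fun x a hx => exists_open_le_of_lt_freeRate hβ hx) (exists_compact_freeLaw_le hβ)
  have := isProbabilityMeasure_freeLaw hβ (2 * n)
  exact prob_le_one

lemma freeRate_nonneg {β : ℝ} (hβ : 0 < β) (μ : ProbabilityMeasure I) : 0 ≤ freeRate β μ :=
  (satisfiesLDP_freeLaw hβ).nonneg μ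

/-- The whole space has probability `1`, so an infinite rate would contradict the upper bound. -/
lemma exists_freeRate_lt_top {β : ℝ} (hβ : 0 < β) : ∃ μ, freeRate β μ < ⊤ := by
  by_contra! hcon
  have h1 : ((1 : ℝ) : EReal) < ⨅ x ∈ (Set.univ : Set (ProbabilityMeasure I)), freeRate β x := by
    refine lt_of_lt_of_le (EReal.coe_lt_top 1) ?_
    exact le_iInf₂ fun x _ => hcon x
  have h2 := eventually_measure_closed_le (P := fun n => freeLaw β (2 * n)) (X := muN)
    (fun x a hx => exists_open_le_of_lt_freeRate hβ hx) (exists_compact_freeLaw_le hβ)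
    isClosed_univ h1
  have h3 : ∀ᶠ n : ℕ in atTop, ENNReal.ofReal (Real.exp (-(2 * n * 0)))
      ≤ freeLaw β (2 * n) (muN n ⁻¹' Set.univ) := by
    refine Filter.Eventually.of_forall fun n => ?_
    have := isProbabilityMeasure_freeLaw hβ (2 * n)
    simp
  have := le_of_eventually_exp_le h3 h2
  linarith

lemma add_coe_lt_coe_iff {u : EReal} {v a : ℝ} :
    u + (v : EReal) < (a : EReal) ↔ u < ((a - v : ℝ) : EReal) := by
  induction u using EReal.rec with
  | bot => simp only [EReal.bot_add, EReal.bot_lt_coe]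
  | coe x =>
    rw [← EReal.coe_add, EReal.coe_lt_coe_iff, EReal.coe_lt_coe_iff]
    constructor <;> intro h <;> linarith
  | top => simp

lemma coe_lt_add_coe_iff {u : EReal} {v a : ℝ} :
    (a : EReal) < u + (v : EReal) ↔ ((a - v : ℝ) : EReal) < u := by
  induction u using EReal.rec with
  | bot => simp
  | coe x =>
    rw [← EReal.coe_add, EReal.coe_lt_coe_iff, EReal.coe_lt_coe_iff]
    constructor <;> intro h <;> linarith
  | top => simp only [EReal.top_add_coe, EReal.coe_lt_top]

lemma ofReal_exp_mul (n : ℕ) (a b : ℝ) :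
    ENNReal.ofReal (Real.exp (-(2 * n * a))) * ENNReal.ofReal (Real.exp (-(2 * n * b)))
      = ENNReal.ofReal (Real.exp (-(2 * n * (a + b)))) := by
  rw [← ENNReal.ofReal_mul (Real.exp_pos _).le, ← Real.exp_add]
  congr 2; ring

section Tilted

variable {β : ℝ} {V : ℝ → ℝ} {C : ℝ}

lemma hFun_freeRate (μ : ProbabilityMeasure I) :
    hFun (freeRate β) V μ = freeRate β μ + (energy V μ : EReal) := rfl

/-- Near `μ` the density is about `e^{-2n ∫ V dμ}`, by continuity of the energy. -/
lemma tiltedLaw_lower (hβ : 0 < β) (hV : ContinuousOn V I) (hC : ∀ x ∈ I, |V x| ≤ C)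
    {μ : ProbabilityMeasure I} {a : ℝ} (h : hFun (freeRate β) V μ < a)
    {O : Set (ProbabilityMeasure I)} (hO : IsOpen O) (hμ : μ ∈ O) : ∀ᶠ n : ℕ in atTop,
      ENNReal.ofReal (Real.exp (-(2 * n * a))) ≤ tiltedLaw β V (2 * n) (muN n ⁻¹' O) := by
  rw [hFun_freeRate, add_coe_lt_coe_iff] at h
  obtain ⟨b, hb, hba⟩ := EReal.lt_iff_exists_real_btwn.1 h
  have hba' : b < a - energy V μ := by exact_mod_cast hba
  have hO' : IsOpen (O ∩ {ν | energy V ν < a - b}) :=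
    hO.inter (isOpen_lt (continuous_energy hV hC) continuous_const)
  filter_upwards [isAdmissible_of_freeRate_lt hb _ hO' ⟨hμ, by
    change energy V μ < a - b; linarith⟩, eventually_ge_atTop 1] with n hn hn1
  calc ENNReal.ofReal (Real.exp (-(2 * n * a)))
      = ENNReal.ofReal (Real.exp (-(2 * n * (a - b))))
          * ENNReal.ofReal (Real.exp (-(2 * n * b))) := by rw [ofReal_exp_mul]; congr 2; ring
    _ ≤ ENNReal.ofReal (Real.exp (-(2 * n * (a - b))))
          * freeLaw β (2 * n) (muN n ⁻¹' (O ∩ {ν | energy V ν < a - b})) := by gcongr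
    _ ≤ tiltedLaw β V (2 * n) (muN n ⁻¹' (O ∩ {ν | energy V ν < a - b})) :=
        le_tiltedLaw hβ V hn1 hO' fun ν hν => hν.2.le
    _ ≤ _ := measure_mono (Set.preimage_mono Set.inter_subset_left)

lemma tiltedLaw_upper (hβ : 0 < β) (hV : ContinuousOn V I) (hC : ∀ x ∈ I, |V x| ≤ C)
    {μ : ProbabilityMeasure I} {a : ℝ} (h : (a : EReal) < hFun (freeRate β) V μ) :
    ∃ O : Set (ProbabilityMeasure I), IsOpen O ∧ μ ∈ O ∧ ∀ᶠ n : ℕ in atTop,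
      tiltedLaw β V (2 * n) (muN n ⁻¹' O) ≤ ENNReal.ofReal (Real.exp (-(2 * n * a))) := by
  rw [hFun_freeRate, coe_lt_add_coe_iff] at h
  obtain ⟨b, hab, hb⟩ := EReal.lt_iff_exists_real_btwn.1 h
  have hab' : a - energy V μ < b := by exact_mod_cast hab
  obtain ⟨O, hO, hμ, hOb⟩ := exists_open_le_of_lt_freeRate hβ hb
  have hO' : IsOpen (O ∩ {ν | a - b < energy V ν}) :=
    hO.inter (isOpen_lt continuous_const (continuous_energy hV hC))
  refine ⟨_, hO', ⟨hμ, by change a - b < energy V μ; linarith⟩, ?_⟩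
  filter_upwards [hOb, eventually_ge_atTop 1] with n hn hn1
  calc tiltedLaw β V (2 * n) (muN n ⁻¹' (O ∩ {ν | a - b < energy V ν}))
      ≤ ENNReal.ofReal (Real.exp (-(2 * n * (a - b))))
          * freeLaw β (2 * n) (muN n ⁻¹' (O ∩ {ν | a - b < energy V ν})) :=
        tiltedLaw_le hβ V hn1 hO' fun ν hν => hν.2.le
    _ ≤ ENNReal.ofReal (Real.exp (-(2 * n * (a - b))))
          * ENNReal.ofReal (Real.exp (-(2 * n * b))) := by
        gcongr
        exact (measure_mono (Set.preimage_mono Set.inter_subset_left)).trans hn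
    _ = _ := by rw [ofReal_exp_mul]; congr 2; ring

lemma tiltedLaw_tight (hβ : 0 < β) (hC : ∀ x ∈ I, |V x| ≤ C) (a : ℝ) :
    ∃ S : Set (ProbabilityMeasure I), IsCompact S ∧ ∀ᶠ n : ℕ in atTop,
      tiltedLaw β V (2 * n) (muN n ⁻¹' Sᶜ) ≤ ENNReal.ofReal (Real.exp (-(2 * n * a))) := by
  obtain ⟨S, hS, hSa⟩ := exists_compact_freeLaw_le hβ (a + C)
  refine ⟨S, hS, ?_⟩
  filter_upwards [hSa, eventually_ge_atTop 1] with n hn hn1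
  calc tiltedLaw β V (2 * n) (muN n ⁻¹' Sᶜ)
      ≤ ENNReal.ofReal (Real.exp (-(2 * n * (-C)))) * freeLaw β (2 * n) (muN n ⁻¹' Sᶜ) :=
        tiltedLaw_le hβ V hn1 hS.isClosed.isOpen_compl fun ν _ =>
          (abs_le.1 (abs_energy_le hC ν)).1
    _ ≤ ENNReal.ofReal (Real.exp (-(2 * n * (-C))))
          * ENNReal.ofReal (Real.exp (-(2 * n * (a + C)))) := by gcongr
    _ = _ := by rw [ofReal_exp_mul]; congr 2; ring

/-- The infimum of `h` is finite, so that subtracting it involves no undefined difference. -/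
lemma exists_iInf_hFun_eq_coe (hβ : 0 < β) (hC : ∀ x ∈ I, |V x| ≤ C) :
    ∃ c : ℝ, ⨅ ν, hFun (freeRate β) V ν = (c : EReal) := by
  obtain ⟨μ, hμ⟩ := exists_freeRate_lt_top hβ
  have h1 : ⨅ ν, hFun (freeRate β) V ν ≠ ⊤ := by
    refine ne_of_lt (lt_of_le_of_lt (iInf_le _ μ) ?_)
    rw [hFun_freeRate]
    exact EReal.add_lt_top hμ.ne (EReal.coe_ne_top _)
  have h2 : ⨅ ν, hFun (freeRate β) V ν ≠ ⊥ := by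
    refine ne_of_gt (lt_of_lt_of_le (EReal.bot_lt_coe (-C)) (le_iInf fun ν => ?_))
    rw [hFun_freeRate, ← zero_add ((-C : ℝ) : EReal)]
    exact add_le_add (freeRate_nonneg hβ ν)
      (EReal.coe_le_coe_iff.2 (abs_le.1 (abs_energy_le hC ν)).1)
  exact ⟨_, (EReal.coe_toReal h1 h2).symm⟩

/-- The normalising constant decays at the exponential rate `inf h`. -/
lemma tiltedLaw_univ_bounds (hβ : 0 < β) (hV : ContinuousOn V I) (hC : ∀ x ∈ I, |V x| ≤ C) {c : ℝ}
    (hc : ⨅ ν, hFun (freeRate β) V ν = (c : EReal)) {δ : ℝ} (hδ : 0 < δ) :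
    (∀ᶠ n : ℕ in atTop, ENNReal.ofReal (Real.exp (-(2 * n * (c + δ))))
      ≤ tiltedLaw β V (2 * n) Set.univ) ∧
    (∀ᶠ n : ℕ in atTop, tiltedLaw β V (2 * n) Set.univ
      ≤ ENNReal.ofReal (Real.exp (-(2 * n * (c - δ))))) := by
  constructor
  · have h1 : ⨅ ν, hFun (freeRate β) V ν < ((c + δ : ℝ) : EReal) := by
      rw [hc]; exact_mod_cast lt_add_of_pos_right c hδ
    obtain ⟨μ, hμ⟩ := iInf_lt_iff.1 h1
    simpa using tiltedLaw_lower hβ hV hC hμ isOpen_univ (Set.mem_univ μ)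
  · have h1 : ((c - δ : ℝ) : EReal)
        < ⨅ ν ∈ (Set.univ : Set (ProbabilityMeasure I)), hFun (freeRate β) V ν := by
      simp only [Set.mem_univ, iInf_pos, hc]
      exact_mod_cast sub_lt_self c hδ
    simpa using eventually_measure_closed_le (P := fun n => tiltedLaw β V (2 * n)) (X := muN)
      (fun x a hx => tiltedLaw_upper hβ hV hC hx) (tiltedLaw_tight hβ hC) isClosed_univ h1

lemma rateS_eq {c : ℝ} (hc : ⨅ ν, hFun (freeRate β) V ν = (c : EReal))
    (μ : ProbabilityMeasure I) :
    rateS (freeRate β) V μ = freeRate β μ + ((energy V μ - c : ℝ) : EReal) := by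
  rw [rateS, hc, hFun_freeRate, sub_eq_add_neg, ← EReal.coe_neg, add_assoc, ← EReal.coe_add,
    sub_eq_add_neg]

lemma rateS_eq' {c : ℝ} (hc : ⨅ ν, hFun (freeRate β) V ν = (c : EReal))
    (μ : ProbabilityMeasure I) :
    rateS (freeRate β) V μ = hFun (freeRate β) V μ + ((-c : ℝ) : EReal) := by
  rw [rateS, hc, sub_eq_add_neg, ← EReal.coe_neg]

/-- Normalising multiplies upper bounds by a factor of the order of `e^{2nc}`. -/
lemma gge_upper (hβ : 0 < β) (hV : ContinuousOn V I) (hC : ∀ x ∈ I, |V x| ≤ C) {c : ℝ}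
    (hc : ⨅ ν, hFun (freeRate β) V ν = (c : EReal)) {a b : ℝ} (hab : a + c < b)
    {A : Set (ProbabilityMeasure I)} (h : ∀ᶠ n : ℕ in atTop,
      tiltedLaw β V (2 * n) (muN n ⁻¹' A) ≤ ENNReal.ofReal (Real.exp (-(2 * n * b)))) :
    ∀ᶠ n : ℕ in atTop,
      gge β V (2 * n) (muN n ⁻¹' A) ≤ ENNReal.ofReal (Real.exp (-(2 * n * a))) := by
  filter_upwards [h, (tiltedLaw_univ_bounds hβ hV hC hc (δ := b - (a + c)) (by linarith)).1,
    eventually_ge_atTop 1] with n h1 h2 hn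
  obtain ⟨h0, ht⟩ := tiltedLaw_univ_ne hβ hC hn
  rw [gge_eq hβ V _ (aemeasurable_tilt hβ hV hC hn), Measure.smul_apply, smul_eq_mul,
    mul_comm (tiltedLaw β V (2 * n) Set.univ)⁻¹, ← div_eq_mul_inv, ENNReal.div_le_iff h0 ht]
  calc _ ≤ ENNReal.ofReal (Real.exp (-(2 * n * b))) := h1
    _ = ENNReal.ofReal (Real.exp (-(2 * n * a)))
        * ENNReal.ofReal (Real.exp (-(2 * n * (c + (b - (a + c)))))) := by
        rw [ofReal_exp_mul]; congr 2; ring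
    _ ≤ _ := by gcongr

lemma gge_lower (hβ : 0 < β) (hV : ContinuousOn V I) (hC : ∀ x ∈ I, |V x| ≤ C) {c : ℝ}
    (hc : ⨅ ν, hFun (freeRate β) V ν = (c : EReal)) {a b : ℝ} (hab : b < a + c)
    {A : Set (ProbabilityMeasure I)} (h : ∀ᶠ n : ℕ in atTop,
      ENNReal.ofReal (Real.exp (-(2 * n * b))) ≤ tiltedLaw β V (2 * n) (muN n ⁻¹' A)) :
    ∀ᶠ n : ℕ in atTop,
      ENNReal.ofReal (Real.exp (-(2 * n * a))) ≤ gge β V (2 * n) (muN n ⁻¹' A) := by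
  filter_upwards [h, (tiltedLaw_univ_bounds hβ hV hC hc (δ := a + c - b) (by linarith)).2,
    eventually_ge_atTop 1] with n h1 h2 hn
  obtain ⟨h0, ht⟩ := tiltedLaw_univ_ne hβ hC hn
  rw [gge_eq hβ V _ (aemeasurable_tilt hβ hV hC hn), Measure.smul_apply, smul_eq_mul,
    mul_comm (tiltedLaw β V (2 * n) Set.univ)⁻¹, ← div_eq_mul_inv, ENNReal.le_div_iff_mul_le (Or.inl h0) (Or.inl ht)]
  calc _ ≤ ENNReal.ofReal (Real.exp (-(2 * n * a)))
        * ENNReal.ofReal (Real.exp (-(2 * n * (c - (a + c - b))))) := by gcongr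
    _ = ENNReal.ofReal (Real.exp (-(2 * n * b))) := by rw [ofReal_exp_mul]; congr 2; ring
    _ ≤ _ := h1

lemma satisfiesLDP_gge (hβ : 0 < β) (hV : ContinuousOn V I) (hC : ∀ x ∈ I, |V x| ≤ C) :
    SatisfiesLDP (fun n => gge β V (2 * n)) muN (fun n => 2 * (n : ℝ))
      (rateS (freeRate β) V) := by
  obtain ⟨c, hc⟩ := exists_iInf_hFun_eq_coe hβ hC
  refine satisfiesLDP_of_local ?_ ?_ ?_ ?_
  · filter_upwards [eventually_ge_atTop 1] with n hn
    have := isProbabilityMeasure_gge hβ hV hC hn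
    exact prob_le_one
  · intro x a hx O hO hxO
    rw [rateS_eq' hc, add_coe_lt_coe_iff] at hx
    obtain ⟨b, hb, hba⟩ := EReal.lt_iff_exists_real_btwn.1 hx
    have hba' : b < a - -c := by exact_mod_cast hba
    exact gge_lower hβ hV hC hc (by linarith) (tiltedLaw_lower hβ hV hC hb hO hxO)
  · intro x a hx
    rw [rateS_eq' hc, coe_lt_add_coe_iff] at hx
    obtain ⟨b, hab, hb⟩ := EReal.lt_iff_exists_real_btwn.1 hx
    have hab' : a - -c < b := by exact_mod_cast hab
    obtain ⟨O, hO, hxO, hOb⟩ := tiltedLaw_upper hβ hV hC hb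
    exact ⟨O, hO, hxO, gge_upper hβ hV hC hc (by linarith) hOb⟩
  · intro a
    obtain ⟨S, hS, hSa⟩ := tiltedLaw_tight hβ hC (a + c + 1)
    exact ⟨S, hS, gge_upper hβ hV hC hc (by linarith) hSa⟩

/-- In the cases `s = 0` and `t = 0` the product `0 * ⊤` may occur, which is `0` in `EReal`; they are
treated directly. -/
lemma isConvexRate_freeRate (hβ : 0 < β) : IsConvexRate (freeRate β) := by
  intro s t μ ν ξ hst h
  rcases eq_or_ne s 0 with rfl | hs
  · have ht : t = 1 := by simpa using hst
    subst ht
    have : ξ = ν := by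
      apply ProbabilityMeasure.toMeasure_injective
      simpa using h
    simp [this]
  rcases eq_or_ne t 0 with rfl | ht
  · have hs1 : s = 1 := by simpa using hst
    subst hs1
    have : ξ = μ := by
      apply ProbabilityMeasure.toMeasure_injective
      simpa using h
    simp [this]
  have hs' : 0 < s := pos_iff_ne_zero.2 hs
  have ht' : 0 < t := pos_iff_ne_zero.2 ht
  have hsR : (0 : EReal) < ((s : ℝ) : EReal) := by exact_mod_cast hs'
  have htR : (0 : EReal) < ((t : ℝ) : EReal) := by exact_mod_cast ht'
  have hμ0 := freeRate_nonneg hβ μ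
  have hν0 := freeRate_nonneg hβ ν
  have hb1 : ((s : ℝ) : EReal) * freeRate β μ ≠ ⊥ :=
    ne_of_gt (lt_of_lt_of_le EReal.bot_lt_zero (mul_nonneg hsR.le hμ0))
  have hb2 : ((t : ℝ) : EReal) * freeRate β ν ≠ ⊥ :=
    ne_of_gt (lt_of_lt_of_le EReal.bot_lt_zero (mul_nonneg htR.le hν0))
  by_cases hμt : freeRate β μ = ⊤
  · rw [hμt, EReal.mul_top_of_pos hsR, EReal.top_add_of_ne_bot hb2]
    exact le_top
  by_cases hνt : freeRate β ν = ⊤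
  · rw [hνt, EReal.mul_top_of_pos htR, EReal.add_top_of_ne_bot hb1]
    exact le_top
  obtain ⟨x, hx⟩ : ∃ x : ℝ, freeRate β μ = x := ⟨_, (EReal.coe_toReal hμt
    (ne_of_gt (lt_of_lt_of_le EReal.bot_lt_zero hμ0))).symm⟩
  obtain ⟨y, hy⟩ : ∃ y : ℝ, freeRate β ν = y := ⟨_, (EReal.coe_toReal hνt
    (ne_of_gt (lt_of_lt_of_le EReal.bot_lt_zero hν0))).symm⟩
  by_contra! hcon
  rw [hx, hy, ← EReal.coe_mul, ← EReal.coe_mul, ← EReal.coe_add] at hcon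
  obtain ⟨c, hc1, hc2⟩ := EReal.lt_iff_exists_real_btwn.1 hcon
  rw [EReal.coe_lt_coe_iff] at hc1
  set δ := (c - (s * x + t * y)) / 2 with hδ
  have hδ0 : 0 < δ := by rw [hδ]; linarith
  have ha : IsAdmissible β μ (x + δ) := isAdmissible_of_freeRate_lt (by
    rw [hx]; exact_mod_cast lt_add_of_pos_right x hδ0)
  have hb : IsAdmissible β ν (y + δ) := isAdmissible_of_freeRate_lt (by
    rw [hy]; exact_mod_cast lt_add_of_pos_right y hδ0)
  have hst' : (s : ℝ) + t = 1 := by exact_mod_cast hst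
  have hlt : s * (x + δ) + t * (y + δ) < c := by
    have e : s * (x + δ) + t * (y + δ) = s * x + t * y + (s + t) * δ := by ring
    rw [e, hst', hδ]
    linarith
  exact absurd (isAdmissible_mix hβ hs' ht' hst h ha hb hlt).freeRate_le hc2.not_ge

lemma energy_of_mix (hV : ContinuousOn V I) (hC : ∀ x ∈ I, |V x| ≤ C) {s t : NNReal}
    {μ ν ξ : ProbabilityMeasure I}
    (h : (ξ : Measure I) = s • (μ : Measure I) + t • (ν : Measure I)) :
    energy V ξ = s * energy V μ + t * energy V ν := by
  unfold energy
  have hi : ∀ ρ : ProbabilityMeasure I, Integrable (fun x : I => V x) (ρ : Measure I) :=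
    fun ρ => (bundled hV hC).integrable _
  rw [h, integral_add_measure ((hi μ).smul_measure_nnreal) ((hi ν).smul_measure_nnreal),
    integral_smul_nnreal_measure, integral_smul_nnreal_measure]
  rfl

lemma isConvexRate_rateS (hβ : 0 < β) (hV : ContinuousOn V I) (hC : ∀ x ∈ I, |V x| ≤ C) :
    IsConvexRate (rateS (freeRate β) V) := by
  obtain ⟨c, hc⟩ := exists_iInf_hFun_eq_coe hβ hC
  intro s t μ ν ξ hst h
  have hst' : (s : ℝ) + t = 1 := by exact_mod_cast hst
  have hK := isConvexRate_freeRate hβ s t μ ν ξ hst h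
  have hs0 : (0 : EReal) ≤ ((s : ℝ) : EReal) := by exact_mod_cast s.2
  have ht0 : (0 : EReal) ≤ ((t : ℝ) : EReal) := by exact_mod_cast t.2
  rw [rateS_eq hc, rateS_eq hc, rateS_eq hc,
    EReal.left_distrib_of_nonneg_of_ne_top hs0 (EReal.coe_ne_top _),
    EReal.left_distrib_of_nonneg_of_ne_top ht0 (EReal.coe_ne_top _), add_add_add_comm]
  refine add_le_add hK (le_of_eq ?_)
  rw [← EReal.coe_mul, ← EReal.coe_mul, ← EReal.coe_add, energy_of_mix hV hC h]
  congr 1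
  have ht2 : (t : ℝ) = 1 - s := by linarith
  rw [ht2]; ring

end Tilted

end SchurFlow

theorem mainTheorem8 (β : ℝ) (hβ : 0 < β) :
    ∃ K : ProbabilityMeasure SchurFlow.I → EReal,
      -- `K` is the good, convex rate function of `μ_n(𝓔)` for `V = 0`, at speed `N = 2n`
      (SchurFlow.SatisfiesLDP (fun n => SchurFlow.gge β (fun _ => 0) (2 * n)) SchurFlow.muN
          (fun n => 2 * (n : ℝ)) K ∧
        SchurFlow.IsConvexRate K) ∧
      ∀ V : ℝ → ℝ, ContinuousOn V SchurFlow.I → (∃ C : ℝ, ∀ x ∈ SchurFlow.I, |V x| ≤ C) →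
        -- the ensemble and the empirical measures are well defined
        (∀ n : ℕ, 1 ≤ n →
          IsProbabilityMeasure (SchurFlow.gge β V (2 * n)) ∧
          ∀ᵐ α ∂(SchurFlow.gge β V (2 * n)),
            IsProbabilityMeasure (SchurFlow.empiricalMeasure n α)) ∧
        SchurFlow.SatisfiesLDP (fun n => SchurFlow.gge β V (2 * n)) SchurFlow.muN
          (fun n => 2 * (n : ℝ)) (SchurFlow.rateS K V) ∧
        SchurFlow.IsConvexRate (SchurFlow.rateS K V) := by
  refine ⟨SchurFlow.freeRate β, ⟨?_, SchurFlow.isConvexRate_freeRate hβ⟩, ?_⟩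
  · simp only [SchurFlow.gge_zero_eq hβ]
    exact SchurFlow.satisfiesLDP_freeLaw hβ
  · rintro V hV ⟨C, hC⟩
    refine ⟨fun n hn => ⟨SchurFlow.isProbabilityMeasure_gge hβ hV hC hn, ?_⟩,
      SchurFlow.satisfiesLDP_gge hβ hV hC, SchurFlow.isConvexRate_rateS hβ hV hC⟩
    filter_upwards [(SchurFlow.gge_absolutelyContinuous hβ hV hC hn).ae_le
      (SchurFlow.ae_mem_goodSet hβ hn)] with α hα
    exact SchurFlow.isProbabilityMeasure_empiricalMeasure hn hα
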